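/- Let $L>0$, $T\ge 0$, $\Omega=[0,L]$, $\mathcal J=[0,T]$, and let $r\ge 1$ be an integer. Let $E\in C^1(\mathcal J)$ (the relaxation modulus) with $E(0)>0$, let $\nu>-1$ (the Poisson ratio), and let $\varepsilon_{\max}$, $M$, $\underline C_E,\overline C_E,\underline C_G,\overline C_G$ be real numbers with $\underline C_E,\underline C_G>0$. Then there is a constant $C>0$, depending only on these data, such that the following holds. Let $\hat I,\hat A\in W^{r,\infty}(\Omega)$, all of whose weak derivatives of orders $0,\dots,r$ are bounded by $M$, satisfy $$\underline C_E\le E(0)\hat I(x)\le\overline C_E,\qquad \underline C_G\le \frac{E(0)}{2(1+\nu)}\hat A(x)\le\overline C_G\qquad\text{for a.e. }x\in\Omega.$$ Let $0<\varepsilon\le\varepsilon_{\max}$ and $\lambda=2(1+\nu)\varepsilon^2$. Let $0=x_0<x_1<\dots<x_n=L$ be any partition of $\Omega$, with $h=\max_i(x_i-x_{i-1})$. Let $q_E\in L^1(\mathcal J;H^r(\Omega))$. For subspaces $V\subset H^1_0(\Omega)$ and $Q\subset L^2(\Omega)$, consider the problem of finding $(\theta,w,\gamma)\in L^1(\mathcal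 J;V\times V\times Q)$ such that, for a.e. $t\in\mathcal J$ and all $\eta,v\in V$, $\psi\in Q$, $$(\hat I\theta'(t),\eta')+(\gamma(t),\eta-v')=(q_E(t),v)+\int_0^t\frac{\dot E(t-s)}{E(0)}\Big[(\hat I\theta'(s),\eta')+(\gamma(s),\eta-v')\Big]\,ds,$$ $$(\theta(t)-w'(t),\psi)-\lambda(\gamma(t)/\hat A,\psi)=0,$$ where $(\cdot,\cdot)$ is the inner product of $L^2(\Omega)$. Let $(\theta,w,\gamma)$ be a solution for $V=H^1_0(\Omega)$, $Q=L^2(\Omega)$, and let $(\theta_h,w_h,\gamma_h)$ be a solution for $$V=\{v\in H^1_0(\Omega): v|_{(x_{i-1},x_i)}\in\mathbb P_r\ \forall i\},\qquad Q=\{q\in L^2(\Omega): q|_{(x_{i-1},x_i)}\in\mathbb P_{r-1}\ \forall i\}.$$ Then $$\int_0^T\Big(\|\theta(t)-\theta_h(t)\|_{L^2(\Omega)}^2+\|w(t)-w_h(t)\|_{L^2(\Omega)}^2\Big)^{1/2}dt\;\le\; C\,h^{r+1}\int_0^T\|q_E(t)\|_{H^r(\Omega)}\,dt .$$ In particular $C$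 is independent of $h$ (and of the mesh) and of $\lambda$. -/

import Mathlib

open MeasureTheory

noncomputable section

namespace Timoshenko

/-- Lebesgue measure on the interval `Ω = [0, L]`. -/
abbrev dom (L : ℝ) : Measure ℝ := volume.restrict (Set.Icc 0 L)

/-- The Lebesgue space `L²(Ω)`. -/
abbrev L2 (L : ℝ) : Type := Lp ℝ 2 (dom L)

/-- Test functions `C_c^∞(0, L)`. -/
structure IsTest (L : ℝ) (φ : ℝ → ℝ) : Prop where
  smooth : ContDiff ℝ (⊤ : ℕ∞) φ
  compact : HasCompactSupport φ
  inside : tsupport φ ⊆ Set.Ioo 0 L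

/-- `g` is the weak derivative of `f` on `(0, L)`. It is only applied to functions that are
square integrable, or bounded and measurable, on `Ω`. -/
def IsWeakDeriv (L : ℝ) (f g : ℝ → ℝ) : Prop :=
  ∀ φ : ℝ → ℝ, IsTest L φ →
    ∫ x, f x * deriv φ x ∂(dom L) = - ∫ x, g x * φ x ∂(dom L)

theorem L2.integrable_mul {L : ℝ} (f : L2 L) {φ : ℝ → ℝ} (hc : Continuous φ)
    (hs : HasCompactSupport φ) : Integrable (fun x => f x * φ x) (dom L) :=
  MemLp.integrable_mul (p := 2) (q := 2) (Lp.memLp f) (hc.memLp_of_hasCompactSupport hs)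

theorem IsTest.continuous_deriv {L : ℝ} {φ : ℝ → ℝ} (h : IsTest L φ) : Continuous (deriv φ) :=
  h.smooth.continuous_deriv (by exact_mod_cast le_top)

/-- The Sobolev space `H^k(Ω)`: a function is recorded together with its weak derivatives of
orders `0, …, k`, all in `L²(Ω)`. The norm inherited from the `ℓ²` product is the usual one,
`‖u‖² = ∑_{j ≤ k} ‖u^{(j)}‖²_{L²(Ω)}`. -/
def Sobolev (L : ℝ) (k : ℕ) : Submodule ℝ (PiLp 2 fun _ : Fin (k + 1) => L2 L) where
  carrier := {u | ∀ j : Fin k, IsWeakDeriv L (u j.castSucc) (u j.succ)}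
  zero_mem' := by
    intro j φ _
    have key : ∀ ψ : ℝ → ℝ, ∫ x, (0 : L2 L) x * ψ x ∂(dom L) = 0 := by
      intro ψ
      refine integral_eq_zero_of_ae ?_
      filter_upwards [Lp.coeFn_zero ℝ 2 (dom L)] with x hx
      rw [hx]
      simp
    have h : ∫ x, (0 : L2 L) x * deriv φ x ∂(dom L) = -∫ x, (0 : L2 L) x * φ x ∂(dom L) := by
      rw [key, key, neg_zero]
    exact h
  add_mem' := by
    intro u v hu hv j φ hφ
    have key : ∀ (f g : L2 L) (ψ : ℝ → ℝ), Continuous ψ → HasCompactSupport ψ →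
        ∫ x, (f + g : L2 L) x * ψ x ∂(dom L)
          = ∫ x, f x * ψ x ∂(dom L) + ∫ x, g x * ψ x ∂(dom L) := by
      intro f g ψ hc hs
      rw [← integral_add (L2.integrable_mul f hc hs) (L2.integrable_mul g hc hs)]
      refine integral_congr_ae ?_
      filter_upwards [Lp.coeFn_add f g] with x hx
      rw [hx, Pi.add_apply, add_mul]
    have e1 := key (u j.castSucc) (v j.castSucc) (deriv φ) hφ.continuous_deriv hφ.compact.deriv
    have e2 := key (u j.succ) (v j.succ) φ hφ.smooth.continuous hφ.compact
    simp only [PiLp.add_apply]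
    rw [e1, e2, hu j φ hφ, hv j φ hφ]
    ring
  smul_mem' := by
    intro c u hu j φ hφ
    have key : ∀ (f : L2 L) (ψ : ℝ → ℝ),
        ∫ x, (c • f : L2 L) x * ψ x ∂(dom L) = c * ∫ x, f x * ψ x ∂(dom L) := by
      intro f ψ
      rw [← integral_const_mul]
      refine integral_congr_ae ?_
      filter_upwards [Lp.coeFn_smul c f] with x hx
      rw [hx, Pi.smul_apply, smul_eq_mul, mul_assoc]
    simp only [PiLp.smul_apply]
    rw [key, key, hu j φ hφ]
    ring

/-- The underlying `L²` function of an element of `H^k(Ω)`. -/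
def fn {L : ℝ} {k : ℕ} (u : Sobolev L k) : L2 L :=
  (u : PiLp 2 fun _ : Fin (k + 1) => L2 L) 0

/-- The first weak derivative of an element of `H¹(Ω)`. -/
def der {L : ℝ} (u : Sobolev L 1) : L2 L :=
  (u : PiLp 2 fun _ : Fin (1 + 1) => L2 L) 1

theorem fn_add {L : ℝ} {k : ℕ} (u v : Sobolev L k) : fn (u + v) = fn u + fn v := rfl

theorem fn_smul {L : ℝ} {k : ℕ} (c : ℝ) (u : Sobolev L k) : fn (c • u) = c • fn u := rfl

theorem fn_zero {L : ℝ} {k : ℕ} : fn (0 : Sobolev L k) = 0 := rfl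

/-- `H₀¹(Ω)`: the functions of `H¹(Ω)` whose continuous representative vanishes at `0` and `L`. -/
def H10 (L : ℝ) : Submodule ℝ (Sobolev L 1) where
  carrier := {u | ∃ f : ℝ → ℝ, ContinuousOn f (Set.Icc 0 L) ∧ fn u =ᵐ[dom L] f ∧
    f 0 = 0 ∧ f L = 0}
  zero_mem' := ⟨0, continuousOn_const, Lp.coeFn_zero ℝ 2 (dom L), rfl, rfl⟩
  add_mem' := by
    rintro u v ⟨f, hf, huf, hf0, hfL⟩ ⟨g, hg, hvg, hg0, hgL⟩
    refine ⟨f + g, hf.add hg, ?_, by simp [hf0, hg0], by simp [hfL, hgL]⟩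
    rw [fn_add]
    exact (Lp.coeFn_add (fn u) (fn v)).trans (huf.add hvg)
  smul_mem' := by
    rintro c u ⟨f, hf, huf, hf0, hfL⟩
    refine ⟨c • f, hf.const_smul c, ?_, by simp [hf0], by simp [hfL]⟩
    rw [fn_smul]
    exact (Lp.coeFn_smul c (fn u)).trans (huf.const_smul c)

/-- `f ∈ W^{r,∞}(Ω)`, with `f` and its weak derivatives up to order `r` bounded by `M`. -/
def SobolevInftyBound (L : ℝ) (r : ℕ) (M : ℝ) (f : ℝ → ℝ) : Prop :=
  ∃ D : ℕ → ℝ → ℝ, D 0 = f ∧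
    (∀ j ≤ r, AEStronglyMeasurable (D j) (dom L) ∧ ∀ᵐ x ∂(dom L), |D j x| ≤ M) ∧
    ∀ j < r, IsWeakDeriv L (D j) (D (j + 1))

/-- A partition `0 = x₀ < x₁ < ⋯ < xₙ = L`. -/
structure Mesh (L : ℝ) where
  n : ℕ
  node : Fin (n + 1) → ℝ
  strictMono : StrictMono node
  first : node 0 = 0
  final : node (Fin.last n) = L

/-- The `i`-th open cell of a mesh. -/
def Mesh.cell {L : ℝ} (m : Mesh L) (i : Fin m.n) : Set ℝ :=
  Set.Ioo (m.node i.castSucc) (m.node i.succ)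

/-- The maximal cell length `h`. -/
def Mesh.h {L : ℝ} (m : Mesh L) : ℝ := ⨆ i : Fin m.n, (m.node i.succ - m.node i.castSucc)

/-- On every cell, `f` agrees almost everywhere with a polynomial from `P`. -/
def PiecewiseIn {L : ℝ} (m : Mesh L) (P : Submodule ℝ (Polynomial ℝ)) (f : L2 L) : Prop :=
  ∀ i : Fin m.n, ∃ p ∈ P, ∀ᵐ x ∂(dom L), x ∈ m.cell i → f x = p.eval x

theorem PiecewiseIn.zero {L : ℝ} (m : Mesh L) (P : Submodule ℝ (Polynomial ℝ)) :
    PiecewiseIn m P 0 := by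
  intro i
  refine ⟨0, P.zero_mem, ?_⟩
  filter_upwards [Lp.coeFn_zero ℝ 2 (dom L)] with x hx _
  rw [hx]
  simp

theorem PiecewiseIn.add {L : ℝ} {m : Mesh L} {P : Submodule ℝ (Polynomial ℝ)} {f g : L2 L}
    (hf : PiecewiseIn m P f) (hg : PiecewiseIn m P g) : PiecewiseIn m P (f + g) := by
  intro i
  obtain ⟨p, hp, hfp⟩ := hf i
  obtain ⟨q, hq, hgq⟩ := hg i
  refine ⟨p + q, P.add_mem hp hq, ?_⟩
  filter_upwards [Lp.coeFn_add f g, hfp, hgq] with x hx h1 h2 hi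
  rw [hx, Pi.add_apply, h1 hi, h2 hi, Polynomial.eval_add]

theorem PiecewiseIn.smul {L : ℝ} {m : Mesh L} {P : Submodule ℝ (Polynomial ℝ)} {f : L2 L}
    (c : ℝ) (hf : PiecewiseIn m P f) : PiecewiseIn m P (c • f) := by
  intro i
  obtain ⟨p, hp, hfp⟩ := hf i
  refine ⟨c • p, P.smul_mem c hp, ?_⟩
  filter_upwards [Lp.coeFn_smul c f, hfp] with x hx h1 hi
  rw [hx, Pi.smul_apply, h1 hi, Polynomial.eval_smul]

/-- Continuous piecewise polynomials of degree at most `r` with zero boundary values; the discrete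
space for each of the two components of `(θ, w)`. -/
def Vh {L : ℝ} (m : Mesh L) (r : ℕ) : Submodule ℝ (Sobolev L 1) where
  carrier := {u | u ∈ H10 L ∧ PiecewiseIn m (Polynomial.degreeLE ℝ r) (fn u)}
  zero_mem' := ⟨(H10 L).zero_mem, PiecewiseIn.zero m _⟩
  add_mem' := by
    rintro u v ⟨hu, hu'⟩ ⟨hv, hv'⟩
    exact ⟨(H10 L).add_mem hu hv, hu'.add hv'⟩
  smul_mem' := by
    rintro c u ⟨hu, hu'⟩
    exact ⟨(H10 L).smul_mem c hu, hu'.smul c⟩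

/-- Discontinuous piecewise polynomials of degree at most `r - 1`, i.e. of degree `< r`. -/
def Qh {L : ℝ} (m : Mesh L) (r : ℕ) : Submodule ℝ (L2 L) where
  carrier := {q | PiecewiseIn m (Polynomial.degreeLT ℝ r) q}
  zero_mem' := PiecewiseIn.zero m _
  add_mem' := fun hf hg => hf.add hg
  smul_mem' := fun c _ hf => hf.smul c

/-- The form `(Î θ', η')_{0,Ω}`. -/
def aForm {L : ℝ} (Ihat : ℝ → ℝ) (θ η : Sobolev L 1) : ℝ :=
  ∫ x, Ihat x * der θ x * der η x ∂(dom L)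

/-- The form `(γ, η - v')_{0,Ω}`. -/
def bForm {L : ℝ} (η v : Sobolev L 1) (γ : L2 L) : ℝ :=
  ∫ x, γ x * (fn η x - der v x) ∂(dom L)

/-- The form `(γ / Â, ψ)_{0,Ω}`. -/
def cForm {L : ℝ} (Ahat : ℝ → ℝ) (γ ψ : L2 L) : ℝ :=
  ∫ x, γ x / Ahat x * ψ x ∂(dom L)

/-- The pairing `(q, v)_{0,Ω}`. -/
def loadForm {L : ℝ} (q v : L2 L) : ℝ := ∫ x, q x * v x ∂(dom L)

/-- The memory kernel `k(t, s) = Ė(t - s) / E(0)`, where `Ė` is the derivative on `[0, T]`. -/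
def kernel (T : ℝ) (E : ℝ → ℝ) (t s : ℝ) : ℝ := derivWithin E (Set.Icc 0 T) (t - s) / E 0

/-- `(θ, w, γ) ∈ L¹(J; V × V × Q)` solves the mixed Volterra beam equations for almost every
`t ∈ J = [0, T]`, tested against all `η, v ∈ V` and `ψ ∈ Q`. The continuous problem has
`V = H₀¹(Ω)`, `Q = L²(Ω)`; the semi-discrete one has the finite element spaces. -/
structure IsMixedSolution {L : ℝ} (T : ℝ) (E Ihat Ahat : ℝ → ℝ) (lam : ℝ)
    (V : Submodule ℝ (Sobolev L 1)) (Q : Submodule ℝ (L2 L)) (qE : ℝ → L2 L)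
    (θ w : ℝ → Sobolev L 1) (γ : ℝ → L2 L) : Prop where
  integrable_rotation : Integrable θ (volume.restrict (Set.Icc 0 T))
  integrable_displacement : Integrable w (volume.restrict (Set.Icc 0 T))
  integrable_shear : Integrable γ (volume.restrict (Set.Icc 0 T))
  mem : ∀ᵐ t ∂(volume.restrict (Set.Icc 0 T)), θ t ∈ V ∧ w t ∈ V ∧ γ t ∈ Q
  momentum : ∀ᵐ t ∂(volume.restrict (Set.Icc 0 T)), ∀ η ∈ V, ∀ v ∈ V,
    aForm Ihat (θ t) η + bForm η v (γ t) =
      loadForm (qE t) (fn v) +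
        ∫ s in (0 : ℝ)..t, kernel T E t s * (aForm Ihat (θ s) η + bForm η v (γ s))
  constitutive : ∀ᵐ t ∂(volume.restrict (Set.Icc 0 T)), ∀ ψ ∈ Q,
    bForm (θ t) (w t) ψ - lam * cForm Ahat (γ t) ψ = 0

end Timoshenko

end

noncomputable section

namespace Timoshenko

variable {L : ℝ}

/-! The memory integral contains the same expression as the left-hand side of the momentum equation,
so it can be removed. Seen as a functional of the test pair `(η, v)`, that expression `G` satisfies
`G = A q + κ * G`, where `A` is the load pairing. If `p` solves `p = q + κ * p` in `L¹(0, T; H^r)`,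
then `A p` solves the same equation, and uniqueness gives `G t = A (p t)`. So for almost every `t`
the exact and the discrete solution both solve a memory-free elastic problem with the same load `p
t`, and the `L¹` norm of `p` is controlled by that of `q`. It remains to integrate in time an
elastic error bound that is uniform in mesh and thickness.

In one dimension the elastic problem is nearly explicit. Functions of `H¹₀` are primitives `J` of
mean-zero functions, and the mean-zero part of `Qh` consists exactly of the derivatives of `Vh`.
Hence everything is expressed through `t = θ'`, `u = w'` and `γ`. The exact solution is `γ = γ₀ + J
p`, `Î t = z₀ + J γ`, `u = J t - λ γ / Â`, which yields `r` bounded derivatives of `t`, `u`, `γ`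
uniformly in `λ` (`exists_regularity`).

For the error put `τ = t - th`, `μ = u - uh`, `D = γ - γh`. Each equation leaves a residual
orthogonal to `Q`: `δ = D - d`, `S = Î τ - J D - κ` and `U = J τ - μ - λ D / Â`. A duality argument
(`IsBeam.norm_prim_mul_le`) shows that `J` gains a factor `h` on such residuals, even after
multiplication by a Lipschitz coefficient. The two constants `κ`, `d` solve a linear system that is
coercive uniformly in `λ`, because the term in `λ` has a favourable sign (`IsBeam.abs_add_abs_le`).
For small `h` the resulting inequalities close up by absorption (`error_arithmetic`); for large `h`
stability alone suffices. -/

/-! ### Primitives of integrable functions on `[0, L]`. -/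

theorem intervalIntegrable_of_dom {f : ℝ → ℝ} (hf : Integrable f (dom L)) {x y : ℝ}
    (hx : x ∈ Set.Icc 0 L) (hy : y ∈ Set.Icc 0 L) : IntervalIntegrable f volume x y := by
  have h : IntegrableOn f (Set.uIcc x y) :=
    IntegrableOn.mono_set hf (Set.uIcc_subset_Icc hx hy)
  exact h.intervalIntegrable

theorem integral_dom (hL : 0 ≤ L) (f : ℝ → ℝ) : ∫ x, f x ∂(dom L) = ∫ x in (0 : ℝ)..L, f x := by
  rw [intervalIntegral.integral_of_le hL, integral_Icc_eq_integral_Ioc]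

theorem ae_dom_iff {p : ℝ → Prop} : (∀ᵐ x ∂(dom L), p x) ↔ ∀ᵐ x, x ∈ Set.Icc 0 L → p x :=
  ae_restrict_iff' measurableSet_Icc

theorem primitive_congr {f g : ℝ → ℝ} (h : f =ᵐ[dom L] g) {x y : ℝ} (hx : x ∈ Set.Icc 0 L)
    (hy : y ∈ Set.Icc 0 L) : ∫ t in x..y, f t = ∫ t in x..y, g t := by
  apply intervalIntegral.integral_congr_ae
  filter_upwards [ae_dom_iff.1 h] with t ht hty
  exact ht (Set.uIcc_subset_Icc hx hy (Set.uIoc_subset_uIcc hty))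

theorem absolutelyContinuous_primitive (hL : 0 ≤ L) {f : ℝ → ℝ} (hf : Integrable f (dom L))
    (c : ℝ) {x : ℝ} (hx : x ∈ Set.Icc 0 L) :
    AbsolutelyContinuousOnInterval (fun x => c + ∫ y in (0 : ℝ)..x, f y) 0 x := by
  have h0 : (0 : ℝ) ∈ Set.Icc 0 L := ⟨le_rfl, hL⟩
  have h1 := (intervalIntegrable_of_dom hf h0 hx).absolutelyContinuousOnInterval_intervalIntegral
    (c := 0) (by simp)
  have h2 : AbsolutelyContinuousOnInterval (fun _ : ℝ => c) 0 x :=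
    (LipschitzWith.const c).lipschitzOnWith.absolutelyContinuousOnInterval
  exact h2.add h1

theorem continuousOn_primitive (hL : 0 ≤ L) {f : ℝ → ℝ} (hf : Integrable f (dom L)) (c : ℝ) :
    ContinuousOn (fun x => c + ∫ y in (0 : ℝ)..x, f y) (Set.Icc 0 L) := by
  have := (absolutelyContinuous_primitive hL hf c (x := L) ⟨hL, le_rfl⟩).continuousOn
  rwa [Set.uIcc_of_le hL] at this

theorem ae_hasDerivAt_primitive (hL : 0 ≤ L) {f : ℝ → ℝ} (hf : Integrable f (dom L)) (c : ℝ) :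
    ∀ᵐ x ∂(dom L), HasDerivAt (fun x => c + ∫ y in (0 : ℝ)..x, f y) (f x) x := by
  rw [ae_dom_iff]
  have h0 : (0 : ℝ) ∈ Set.Icc 0 L := ⟨le_rfl, hL⟩
  filter_upwards [(intervalIntegrable_of_dom hf h0 ⟨hL, le_rfl⟩).ae_hasDerivAt_integral]
    with x hx hxL
  rw [Set.uIcc_of_le hL] at hx
  exact (hx hxL 0 h0).const_add c

theorem abs_primitive_le {f : ℝ → ℝ} (hf : Integrable f (dom L)) {x : ℝ}
    (hx : x ∈ Set.Icc 0 L) : |∫ y in (0 : ℝ)..x, f y| ≤ ∫ y, |f y| ∂(dom L) := by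
  rw [intervalIntegral.integral_of_le hx.1, ← Real.norm_eq_abs]
  refine (norm_integral_le_integral_norm f).trans ?_
  exact setIntegral_mono_set hf.norm (Filter.Eventually.of_forall fun _ => norm_nonneg _)
    (Filter.Eventually.of_forall fun y hy => ⟨hy.1.le, hy.2.trans hx.2⟩)

theorem aestronglyMeasurable_primitive (hL : 0 ≤ L) {f : ℝ → ℝ} (hf : Integrable f (dom L))
    (c : ℝ) : AEStronglyMeasurable (fun x => c + ∫ y in (0 : ℝ)..x, f y) (dom L) :=
  (continuousOn_primitive hL hf c).aestronglyMeasurable measurableSet_Icc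

/-- A continuous factor preserves integrability on `[0, L]`. -/
theorem Integrable.mul_continuousOn_dom {f g : ℝ → ℝ} (hf : Integrable f (dom L))
    (hg : ContinuousOn g (Set.Icc 0 L)) : Integrable (fun x => f x * g x) (dom L) :=
  IntegrableOn.mul_continuousOn hf hg isCompact_Icc

theorem Integrable.continuousOn_mul_dom {f g : ℝ → ℝ} (hf : ContinuousOn f (Set.Icc 0 L))
    (hg : Integrable g (dom L)) : Integrable (fun x => f x * g x) (dom L) :=
  IntegrableOn.continuousOn_mul hf hg isCompact_Icc

/-- Product rule for primitives of integrable functions. -/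
theorem primitive_mul_primitive (hL : 0 ≤ L) {f g : ℝ → ℝ} (hf : Integrable f (dom L))
    (hg : Integrable g (dom L)) (c d : ℝ) {x : ℝ} (hx : x ∈ Set.Icc 0 L) :
    (c + ∫ y in (0 : ℝ)..x, f y) * (d + ∫ y in (0 : ℝ)..x, g y) =
      c * d + ∫ y in (0 : ℝ)..x,
        (f y * (d + ∫ z in (0 : ℝ)..y, g z) + (c + ∫ z in (0 : ℝ)..y, f z) * g y) := by
  have h := (absolutelyContinuous_primitive hL hf c hx).integral_deriv_mul_eq_sub
    (absolutelyContinuous_primitive hL hg d hx)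
  have h0 : (0 : ℝ) ∈ Set.Icc 0 L := ⟨le_rfl, hL⟩
  have e : ∫ y in (0 : ℝ)..x,
        (f y * (d + ∫ z in (0 : ℝ)..y, g z) + (c + ∫ z in (0 : ℝ)..y, f z) * g y) =
      ∫ y in (0 : ℝ)..x, (deriv (fun x => c + ∫ y in (0 : ℝ)..x, f y) y *
        (d + ∫ z in (0 : ℝ)..y, g z) + (c + ∫ z in (0 : ℝ)..y, f z) *
        deriv (fun x => d + ∫ y in (0 : ℝ)..x, g y) y) := by
    apply primitive_congr (L := L) _ h0 hx
    filter_upwards [ae_hasDerivAt_primitive hL hf c, ae_hasDerivAt_primitive hL hg d]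
      with y h1 h2
    rw [h1.deriv, h2.deriv]
  rw [e, h]
  simp

/-- Two integrable functions with the same primitive up to a constant on a subinterval agree almost
everywhere there. -/
theorem ae_eq_of_primitive_eq (hL : 0 ≤ L) {f : ℝ → ℝ} (hf : Integrable f (dom L)) {c : ℝ}
    {G G' : ℝ → ℝ} (hG : ∀ x, HasDerivAt G (G' x) x) {a b : ℝ}
    (h : ∀ x ∈ Set.Ioo a b, x ∈ Set.Icc 0 L → c + ∫ y in (0 : ℝ)..x, f y = G x) :
    ∀ᵐ x ∂(dom L), x ∈ Set.Ioo a b → f x = G' x := by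
  have hne : ∀ᵐ x : ℝ, x ∉ ({0, L} : Set ℝ) :=
    measure_eq_zero_iff_ae_notMem.1 ((Set.toFinite _).measure_zero _)
  filter_upwards [ae_hasDerivAt_primitive hL hf c, ae_dom_iff.2 (hne.mono fun x hx _ => hx),
    ae_restrict_mem measurableSet_Icc] with x hx hx0 hxL hxab
  simp only [Set.mem_insert_iff, Set.mem_singleton_iff, not_or] at hx0
  have hn : Set.Ioo a b ∩ Set.Icc 0 L ∈ nhds x :=
    Filter.inter_mem (Ioo_mem_nhds hxab.1 hxab.2)
      (Icc_mem_nhds (lt_of_le_of_ne hxL.1 (Ne.symm hx0.1)) (lt_of_le_of_ne hxL.2 hx0.2))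
  refine hx.unique ((hG x).congr_of_eventuallyEq ?_)
  filter_upwards [hn] with y hy
  exact h y hy.1 hy.2

/-! ### Test functions and the lemma of du Bois-Reymond. -/

theorem IsTest.eq_zero_of_notMem {φ : ℝ → ℝ} (h : IsTest L φ) {x : ℝ} (hx : x ∉ Set.Ioo 0 L) :
    φ x = 0 :=
  image_eq_zero_of_notMem_tsupport fun hm => hx (h.inside hm)

theorem IsTest.eq_primitive {φ : ℝ → ℝ} (h : IsTest L φ) (x : ℝ) :
    ∫ y in (0 : ℝ)..x, deriv φ y = φ x := by
  rw [intervalIntegral.integral_deriv_eq_sub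
    (fun y _ => (h.smooth.differentiable (by simp)).differentiableAt)
    (h.continuous_deriv.intervalIntegrable _ _), h.eq_zero_of_notMem (x := 0) (by simp), sub_zero]

/-- The primitive of an integrable function has that function as weak derivative. -/
theorem isWeakDeriv_of_primitive (hL : 0 ≤ L) {f g : ℝ → ℝ} (hg : Integrable g (dom L)) {c : ℝ}
    (hf : f =ᵐ[dom L] fun x => c + ∫ y in (0 : ℝ)..x, g y) : IsWeakDeriv L f g := by
  intro φ hφ
  have hφ' : Integrable (deriv φ) (dom L) :=
    (hφ.continuous_deriv.integrable_of_hasCompactSupport hφ.compact.deriv).integrableOn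
  have h := primitive_mul_primitive hL hg hφ' c 0 (x := L) ⟨hL, le_rfl⟩
  simp only [hφ.eq_primitive, hφ.eq_zero_of_notMem (x := L) (by simp), zero_add, mul_zero] at h
  rw [← integral_dom hL, integral_add] at h
  · rw [integral_congr_ae (g := fun x => (c + ∫ y in (0 : ℝ)..x, g y) * deriv φ x)]
    · linarith
    · filter_upwards [hf] with x hx
      rw [hx]
  · exact Integrable.mul_continuousOn_dom hg hφ.smooth.continuous.continuousOn
  · exact Integrable.continuousOn_mul_dom (continuousOn_primitive hL hg c) hφ'

theorem exists_isTest_integral_eq_one (hL : 0 < L) :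
    ∃ φ : ℝ → ℝ, IsTest L φ ∧ ∫ x, φ x = 1 := by
  let b : ContDiffBump (L / 2) := ⟨L / 8, L / 4, by positivity, by linarith⟩
  refine ⟨b.normed volume, ⟨b.contDiff_normed, b.hasCompactSupport_normed, ?_⟩, b.integral_normed⟩
  rw [b.tsupport_normed_eq]
  intro x hx
  rw [Real.closedBall_eq_Icc] at hx
  have h1 : b.rOut = L / 4 := rfl
  rw [h1] at hx
  constructor <;> [linarith [hx.1]; linarith [hx.2]]

theorem IsTest.integral_eq {φ : ℝ → ℝ} (h : IsTest L φ) (f : ℝ → ℝ) :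
    ∫ x, φ x * f x = ∫ x, f x * φ x ∂(dom L) := by
  rw [setIntegral_eq_integral_of_forall_compl_eq_zero]
  · simp only [mul_comm]
  · intro x hx
    rw [h.eq_zero_of_notMem fun hm => hx (Set.Ioo_subset_Icc_self hm), mul_zero]

theorem IsTest.sub_smul {φ ψ : ℝ → ℝ} (h : IsTest L φ) (h' : IsTest L ψ) (c : ℝ) :
    IsTest L (fun x => φ x - c * ψ x) where
  smooth := h.smooth.sub (contDiff_const.mul h'.smooth)
  compact := h.compact.sub (h'.compact.mul_left (f := fun _ => c))
  inside := by
    refine (tsupport_sub _ _).trans (Set.union_subset h.inside ?_)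
    exact (closure_mono (Function.support_mul_subset_right _ _)).trans h'.inside

theorem IsTest.integrable {φ : ℝ → ℝ} (h : IsTest L φ) : Integrable φ :=
  h.smooth.continuous.integrable_of_hasCompactSupport h.compact

/-- This keeps the support away from both endpoints, a margin that the primitive of a mean-zero test
function inherits. -/
theorem IsTest.exists_Icc {φ : ℝ → ℝ} (hL : 0 < L) (h : IsTest L φ) :
    ∃ a b, 0 < a ∧ b < L ∧ ∀ x, x ∉ Set.Icc a b → φ x = 0 := by
  by_cases hne : (tsupport φ).Nonempty
  · obtain ⟨a, ha⟩ := h.compact.isCompact.exists_isLeast hne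
    obtain ⟨b, hb⟩ := h.compact.isCompact.exists_isGreatest hne
    exact ⟨a, b, (h.inside ha.1).1, (h.inside hb.1).2, fun x hx =>
      image_eq_zero_of_notMem_tsupport fun hm => hx ⟨ha.2 hm, hb.2 hm⟩⟩
  · refine ⟨L / 2, L / 2, by linarith, by linarith, fun x _ => ?_⟩
    exact image_eq_zero_of_notMem_tsupport fun hm => hne ⟨x, hm⟩

/-- A test function of mean zero is the derivative of a test function. -/
theorem IsTest.exists_deriv_eq {φ : ℝ → ℝ} (hL : 0 < L) (h : IsTest L φ) (h0 : ∫ x, φ x = 0) :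
    ∃ ψ, IsTest L ψ ∧ deriv ψ = φ := by
  obtain ⟨a, b, ha, hb, hab⟩ := h.exists_Icc hL
  have hc := h.smooth.continuous
  have hd : ∀ x, HasDerivAt (fun x => ∫ y in (0 : ℝ)..x, φ y) (φ x) x := fun x =>
    intervalIntegral.integral_hasDerivAt_right (hc.intervalIntegrable _ _)
      hc.stronglyMeasurable.stronglyMeasurableAtFilter hc.continuousAt
  have hde : deriv (fun x => ∫ y in (0 : ℝ)..x, φ y) = φ := funext fun x => (hd x).deriv
  have hz : ∀ x, x ∉ Set.Icc a b → ∫ y in (0 : ℝ)..x, φ y = 0 := by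
    intro x hx
    rcases lt_or_ge x a with hxa | hxa
    · rw [intervalIntegral.integral_congr (g := fun _ => (0 : ℝ)), intervalIntegral.integral_zero]
      intro y hy
      exact hab y fun hm => by
        have := (Set.mem_uIcc.1 hy)
        rcases this with h1 | h1 <;> linarith [hm.1, h1.2]
    · have hbx : b < x := by
        by_contra! hcon
        exact hx ⟨hxa, hcon⟩
      have hx0 : 0 ≤ x := by linarith
      rw [intervalIntegral.integral_of_le hx0, setIntegral_eq_integral_of_forall_compl_eq_zero, h0]
      intro y hy
      refine hab y fun hm => hy ⟨by linarith [hm.1], by linarith [hm.2]⟩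
  have hts : tsupport (fun x => ∫ y in (0 : ℝ)..x, φ y) ⊆ Set.Icc a b := by
    refine closure_minimal (fun x hx => ?_) isClosed_Icc
    by_contra hcon
    exact hx (hz x hcon)
  refine ⟨fun x => ∫ y in (0 : ℝ)..x, φ y, ⟨?_, ?_, ?_⟩, hde⟩
  · refine contDiff_infty_iff_deriv.2 ⟨fun x => (hd x).differentiableAt, ?_⟩
    rw [hde]
    exact h.smooth
  · exact isCompact_Icc.of_isClosed_subset (isClosed_tsupport _) hts
  · exact hts.trans fun x hx => ⟨by linarith [hx.1], by linarith [hx.2]⟩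

/-- Lemma of du Bois-Reymond: a function with a weak derivative is almost everywhere a primitive of
it. -/
theorem IsWeakDeriv.exists_primitive (hL : 0 < L) {f g : ℝ → ℝ} (hf : Integrable f (dom L))
    (hg : Integrable g (dom L)) (h : IsWeakDeriv L f g) :
    ∃ c : ℝ, f =ᵐ[dom L] fun x => c + ∫ y in (0 : ℝ)..x, g y := by
  obtain ⟨φ₀, hφ₀, hφ₀1⟩ := exists_isTest_integral_eq_one hL
  set G : ℝ → ℝ := fun x => 0 + ∫ y in (0 : ℝ)..x, g y with hG
  have hGc : ContinuousOn G (Set.Icc 0 L) := continuousOn_primitive hL.le hg 0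
  have hGi : Integrable G (dom L) := hGc.integrableOn_compact isCompact_Icc
  set k : ℝ → ℝ := fun x => f x - G x with hk
  have hki : Integrable k (dom L) := hf.sub hGi
  have hmul : ∀ {u φ : ℝ → ℝ}, Integrable u (dom L) → Continuous φ →
      Integrable (fun x => u x * φ x) (dom L) := fun hu hφ =>
    Integrable.mul_continuousOn_dom hu hφ.continuousOn
  have hk0 : ∀ φ, IsTest L φ → ∫ x, k x * deriv φ x ∂(dom L) = 0 := by
    intro φ hφ
    have h1 := h φ hφ
    have h2 := isWeakDeriv_of_primitive hL.le hg (f := G) (c := 0) Filter.EventuallyEq.rfl φ hφ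
    simp only [hk, sub_mul]
    rw [integral_sub (hmul hf hφ.continuous_deriv) (hmul hGi hφ.continuous_deriv), h1, h2, sub_self]
  set c := ∫ x, k x * φ₀ x ∂(dom L) with hc
  have key : ∀ φ : ℝ → ℝ, IsTest L φ → ∫ x, φ x * (k x - c) = 0 := by
    intro φ hφ
    -- Subtracting the right multiple of `φ₀` leaves a mean-zero test function, hence a derivative,
    -- which `k` annihilates. Therefore `k` acts on `φ` as the constant `c`.
    obtain ⟨ψ, hψ, hψd⟩ := (hφ.sub_smul hφ₀ (∫ x, φ x)).exists_deriv_eq hL (by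
      rw [integral_sub hφ.integrable (hφ₀.integrable.const_mul _), integral_const_mul, hφ₀1,
        mul_one, sub_self])
    have h1 := hk0 ψ hψ
    have h2 : ∫ x, φ x * 1 = ∫ x, 1 * φ x ∂(dom L) := hφ.integral_eq fun _ => 1
    simp only [mul_one, one_mul] at h2
    rw [hψd] at h1
    simp only [mul_sub] at h1
    rw [integral_sub (hmul hki hφ.smooth.continuous)
      (hmul hki (hφ₀.smooth.continuous.const_mul _))] at h1
    simp only [mul_left_comm (k _)] at h1
    rw [integral_const_mul, ← hc, h2] at h1
    rw [hφ.integral_eq]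
    simp only [sub_mul]
    rw [integral_sub (hmul hki hφ.smooth.continuous)
      ((hφ.integrable.integrableOn (s := Set.Icc 0 L)).const_mul c), integral_const_mul]
    linarith
  have hloc : LocallyIntegrableOn (fun x => k x - c) (Set.Ioo 0 L) volume := by
    have : IntegrableOn (fun x => k x - c) (Set.Icc 0 L) volume :=
      hki.sub (integrable_const c)
    exact (this.mono_set Set.Ioo_subset_Icc_self).locallyIntegrableOn
  have hz := isOpen_Ioo.ae_eq_zero_of_integral_contDiff_smul_eq_zero hloc
    (fun φ h1 h2 h3 => key φ ⟨h1, h2, h3⟩)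
  refine ⟨c, ?_⟩
  rw [show dom L = volume.restrict (Set.Ioo 0 L) from restrict_Ioo_eq_restrict_Icc.symm]
  rw [Filter.EventuallyEq, ae_restrict_iff' measurableSet_Ioo]
  filter_upwards [hz] with x hx hxL
  have := hx hxL
  simp only [hk, hG, zero_add] at this
  linarith

/-! ### Multiplication and primitive operators on `L²`. -/

theorem L2.integrable (f : L2 L) : Integrable f (dom L) :=
  (Lp.memLp f).integrable (by norm_num)

theorem inner_L2 (f g : L2 L) : inner ℝ f g = ∫ x, f x * g x ∂(dom L) := by
  rw [L2.inner_def]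
  simp [mul_comm]

/-- The constant function `1`. -/
def one (L : ℝ) : L2 L := (memLp_const (1 : ℝ)).toLp _

theorem coeFn_one : one L =ᵐ[dom L] fun _ => (1 : ℝ) := MemLp.coeFn_toLp _

theorem inner_one (f : L2 L) : inner ℝ (one L) f = ∫ x, f x ∂(dom L) := by
  rw [inner_L2]
  apply integral_congr_ae
  filter_upwards [coeFn_one] with x hx
  rw [hx, one_mul]

theorem norm_one_sq (hL : 0 ≤ L) : ‖one L‖ ^ 2 = L := by
  rw [← real_inner_self_eq_norm_sq, inner_one, integral_congr_ae coeFn_one]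
  simp [hL]

theorem L2.norm_le_of_ae_bound {f : L2 L} {C : ℝ} (h : ∀ᵐ x ∂(dom L), |f x| ≤ C) :
    ‖f‖ ≤ C * ‖one L‖ := by
  apply Lp.norm_le_mul_norm_of_ae_le_mul
  filter_upwards [h, coeFn_one] with x hx h1
  rw [h1]
  simpa using hx

theorem L2.integral_abs_le (f : L2 L) : ∫ x, |f x| ∂(dom L) ≤ ‖one L‖ * ‖f‖ := by
  have h : ∫ x, |f x| ∂(dom L) = inner ℝ (one L) |f| := by
    rw [inner_one]
    exact integral_congr_ae ((Lp.coeFn_abs f).mono fun x hx => hx.symm)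
  rw [h, ← norm_abs_eq_norm f]
  exact real_inner_le_norm _ _

/-- The operator of multiplication by a bounded function. -/
theorem exists_mul_operator {a : ℝ → ℝ} {B : ℝ} (ha : AEStronglyMeasurable a (dom L))
    (hB : ∀ᵐ x ∂(dom L), |a x| ≤ B) (hB0 : 0 ≤ B) :
    ∃ A : L2 L →L[ℝ] L2 L, ‖A‖ ≤ B ∧ ∀ f, A f =ᵐ[dom L] fun x => a x * f x := by
  have hm : ∀ f : L2 L, MemLp (fun x => a x * f x) 2 (dom L) := fun f =>
    (Lp.memLp f).of_le_mul (c := B) (ha.mul (Lp.aestronglyMeasurable f)) (by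
      filter_upwards [hB] with x hx
      rw [norm_mul]
      exact mul_le_mul_of_nonneg_right hx (norm_nonneg _))
  let A₀ : L2 L →ₗ[ℝ] L2 L :=
    { toFun := fun f => (hm f).toLp _
      map_add' := fun f g => by
        rw [← MemLp.toLp_add]
        apply MemLp.toLp_congr
        filter_upwards [Lp.coeFn_add f g] with x hx
        rw [hx, Pi.add_apply, Pi.add_apply, mul_add]
      map_smul' := fun c f => by
        rw [RingHom.id_apply, ← MemLp.toLp_const_smul]
        apply MemLp.toLp_congr
        filter_upwards [Lp.coeFn_smul c f] with x hx
        simp [hx, mul_left_comm] }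
  have hA₀ : ∀ f, A₀ f =ᵐ[dom L] fun x => a x * f x := fun f => MemLp.coeFn_toLp (hm f)
  have hn : ∀ f, ‖A₀ f‖ ≤ B * ‖f‖ := fun f => by
    apply Lp.norm_le_mul_norm_of_ae_le_mul
    filter_upwards [hA₀ f, hB] with x hx h1
    rw [hx, norm_mul]
    exact mul_le_mul_of_nonneg_right h1 (norm_nonneg _)
  exact ⟨A₀.mkContinuous B hn, A₀.mkContinuous_norm_le hB0 hn, hA₀⟩

theorem memLp_primitive (hL : 0 ≤ L) {f : ℝ → ℝ} (hf : Integrable f (dom L)) (c : ℝ) :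
    MemLp (fun x => c + ∫ y in (0 : ℝ)..x, f y) 2 (dom L) := by
  obtain ⟨C, hC⟩ := isCompact_Icc.exists_bound_of_continuousOn (continuousOn_primitive hL hf c)
  exact MemLp.of_bound (aestronglyMeasurable_primitive hL hf c) C
    ((ae_restrict_mem measurableSet_Icc).mono hC)

/-- The operator `f ↦ ∫₀ˣ f`. -/
def prim (hL : 0 ≤ L) : L2 L →L[ℝ] L2 L :=
  LinearMap.mkContinuous
    { toFun := fun f => (memLp_primitive hL f.integrable 0).toLp _
      map_add' := fun f g => by
        rw [← MemLp.toLp_add]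
        apply MemLp.toLp_congr
        filter_upwards [ae_restrict_mem measurableSet_Icc] with x hx
        have h0 : (0 : ℝ) ∈ Set.Icc 0 L := ⟨le_rfl, hL⟩
        rw [primitive_congr (Lp.coeFn_add f g) h0 hx]
        simp only [Pi.add_apply, zero_add]
        exact intervalIntegral.integral_add (intervalIntegrable_of_dom f.integrable h0 hx)
          (intervalIntegrable_of_dom g.integrable h0 hx)
      map_smul' := fun c f => by
        rw [RingHom.id_apply, ← MemLp.toLp_const_smul]
        apply MemLp.toLp_congr
        filter_upwards [ae_restrict_mem measurableSet_Icc] with x hx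
        rw [primitive_congr (Lp.coeFn_smul c f) ⟨le_rfl, hL⟩ hx]
        simp }
    L (fun f => by
      have h : ∀ᵐ x ∂(dom L), |((memLp_primitive hL f.integrable 0).toLp _ : L2 L) x| ≤
          ‖one L‖ * ‖f‖ := by
        filter_upwards [MemLp.coeFn_toLp (memLp_primitive hL f.integrable 0),
          ae_restrict_mem measurableSet_Icc] with x hx hxL
        rw [hx, zero_add]
        exact (abs_primitive_le f.integrable hxL).trans f.integral_abs_le
      refine (L2.norm_le_of_ae_bound h).trans (le_of_eq ?_)
      rw [mul_right_comm, ← pow_two, norm_one_sq hL])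

theorem coeFn_prim (hL : 0 ≤ L) (f : L2 L) :
    prim hL f =ᵐ[dom L] fun x => ∫ y in (0 : ℝ)..x, f y := by
  refine (MemLp.coeFn_toLp (memLp_primitive hL f.integrable 0)).trans ?_
  simp only [zero_add]
  rfl

theorem norm_prim_le (hL : 0 ≤ L) : ‖prim hL‖ ≤ L := LinearMap.mkContinuous_norm_le _ hL _

/-- Integration by parts. -/
theorem inner_prim_add (hL : 0 ≤ L) (f g : L2 L) :
    inner ℝ (prim hL f) g + inner ℝ f (prim hL g) =
      inner ℝ (one L) f * inner ℝ (one L) g := by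
  have h := primitive_mul_primitive hL f.integrable g.integrable 0 0 (x := L) ⟨hL, le_rfl⟩
  simp only [zero_add, mul_zero] at h
  rw [inner_one, inner_one, integral_dom hL, integral_dom hL, h, ← integral_dom hL, inner_L2,
    inner_L2, ← integral_add]
  · apply integral_congr_ae
    filter_upwards [coeFn_prim hL f, coeFn_prim hL g] with x h1 h2
    rw [h1, h2, add_comm]
  · exact MemLp.integrable_mul (Lp.memLp _) (Lp.memLp _)
  · exact MemLp.integrable_mul (Lp.memLp _) (Lp.memLp _)

/-! ### `H¹₀` as the space of primitives of mean-zero functions. -/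

theorem Sobolev.exists_primitive (hL : 0 < L) {k : ℕ} (u : Sobolev L k) (j : Fin k) :
    ∃ c : ℝ, (u : PiLp 2 fun _ : Fin (k + 1) => L2 L) j.castSucc =ᵐ[dom L]
      fun x => c + ∫ y in (0 : ℝ)..x, (u : PiLp 2 fun _ : Fin (k + 1) => L2 L) j.succ y :=
  IsWeakDeriv.exists_primitive hL (L2.integrable _) (L2.integrable _) (u.2 j)

/-- By du Bois-Reymond `u` is a constant plus the primitive of its derivative; this is continuous,
so it equals the continuous representative everywhere. The value at `0` kills the constant, and the
value at `L` is the integral of the derivative. -/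
theorem fn_eq_prim_of_mem_H10 (hL : 0 < L) {u : Sobolev L 1} (hu : u ∈ H10 L) :
    fn u = prim hL.le (der u) ∧ inner ℝ (one L) (der u) = 0 := by
  obtain ⟨c, hc⟩ := Sobolev.exists_primitive hL u 0
  obtain ⟨f, hf, huf, hf0, hfL⟩ := hu
  change fn u =ᵐ[dom L] fun x => c + ∫ y in (0 : ℝ)..x, der u y at hc
  have he := Measure.eqOn_Icc_of_ae_eq volume hL.ne (hc.symm.trans huf)
    (continuousOn_primitive hL.le (der u).integrable c) hf
  have h0 := he ⟨le_rfl, hL.le⟩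
  have h1 := he ⟨hL.le, le_rfl⟩
  simp only [intervalIntegral.integral_same, add_zero] at h0
  rw [hf0] at h0
  subst h0
  simp only [zero_add] at h1 hc
  refine ⟨Lp.ext (hc.trans (coeFn_prim hL.le _).symm), ?_⟩
  rw [inner_one, integral_dom hL.le, h1, hfL]

/-- Converse of `fn_eq_prim_of_mem_H10`: together they identify `H¹₀` with the mean-zero functions,
so that the beam problem can be posed in the derivatives alone. -/
theorem exists_mem_H10_der_eq (hL : 0 < L) {g : L2 L} (hg : inner ℝ (one L) g = 0) :
    ∃ u ∈ H10 L, der u = g := by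
  let u : Sobolev L 1 := ⟨WithLp.toLp 2 ![prim hL.le g, g], by
    intro j
    have hj : j = 0 := Subsingleton.elim _ _
    subst hj
    refine isWeakDeriv_of_primitive (f := prim hL.le g) (g := g) hL.le (c := 0) (L2.integrable g) ?_
    simpa only [zero_add] using coeFn_prim hL.le g⟩
  refine ⟨u, ⟨fun x => 0 + ∫ y in (0 : ℝ)..x, g y,
    continuousOn_primitive hL.le g.integrable 0, ?_, by simp, ?_⟩, rfl⟩
  · simp only [zero_add]
    exact coeFn_prim hL.le g
  · simp only []
    rw [zero_add, ← integral_dom hL.le, ← inner_one, hg]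

/-! ### Calculus of functions with bounded derivatives. -/

/-- `f` and its derivatives of orders up to `k` are bounded by `B` on `[0, L]`, all up to a null
set. -/
def BddDerivs (L : ℝ) : ℕ → ℝ → (ℝ → ℝ) → Prop
  | 0, B, f => AEStronglyMeasurable f (dom L) ∧ ∀ᵐ x ∂(dom L), |f x| ≤ B
  | k + 1, B, f => (∀ᵐ x ∂(dom L), |f x| ≤ B) ∧
      ∃ (g : ℝ → ℝ) (c : ℝ), BddDerivs L k B g ∧
        f =ᵐ[dom L] fun x => c + ∫ y in (0 : ℝ)..x, g y

namespace BddDerivs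

theorem bound : ∀ {k : ℕ} {B : ℝ} {f : ℝ → ℝ}, BddDerivs L k B f → ∀ᵐ x ∂(dom L), |f x| ≤ B
  | 0, _, _, h => h.2
  | _ + 1, _, _, h => h.1

theorem aestronglyMeasurable (hL : 0 ≤ L) : ∀ {k : ℕ} {B : ℝ} {f : ℝ → ℝ}, BddDerivs L k B f →
    AEStronglyMeasurable f (dom L)
  | 0, _, _, h => h.1
  | _ + 1, B, _, ⟨_, g, c, hg, hf⟩ => by
    have hgi : Integrable g (dom L) :=
      Integrable.of_bound (aestronglyMeasurable hL hg) B hg.bound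
    exact (aestronglyMeasurable_primitive hL hgi c).congr hf.symm

theorem integrable (hL : 0 ≤ L) {k : ℕ} {B : ℝ} {f : ℝ → ℝ} (h : BddDerivs L k B f) :
    Integrable f (dom L) :=
  Integrable.of_bound (h.aestronglyMeasurable hL) B h.bound

theorem congr {k : ℕ} {B : ℝ} {f f' : ℝ → ℝ} (h : BddDerivs L k B f) (hf : f =ᵐ[dom L] f') :
    BddDerivs L k B f' := by
  cases k with
  | zero => exact ⟨h.1.congr hf, by filter_upwards [h.2, hf] with x h1 h2; rwa [← h2]⟩
  | succ k =>
    obtain ⟨hb, g, c, hg, hfg⟩ := h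
    exact ⟨by filter_upwards [hb, hf] with x h1 h2; rwa [← h2], g, c, hg, hf.symm.trans hfg⟩

theorem mono {k : ℕ} {B C : ℝ} {f : ℝ → ℝ} (h : BddDerivs L k B f) (hBC : B ≤ C) :
    BddDerivs L k C f := by
  induction k generalizing f with
  | zero => exact ⟨h.1, h.2.mono fun x hx => hx.trans hBC⟩
  | succ k ih =>
    obtain ⟨hb, g, c, hg, hfg⟩ := h
    exact ⟨hb.mono fun x hx => hx.trans hBC, g, c, ih hg, hfg⟩

theorem of_succ (hL : 0 ≤ L) {k : ℕ} {B : ℝ} {f : ℝ → ℝ} (h : BddDerivs L (k + 1) B f) :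
    BddDerivs L k B f := by
  induction k generalizing f with
  | zero => exact ⟨h.aestronglyMeasurable hL, h.bound⟩
  | succ k ih =>
    obtain ⟨hb, g, c, hg, hfg⟩ := h
    exact ⟨hb, g, c, ih hg, hfg⟩

theorem of_le (hL : 0 ≤ L) {k l : ℕ} (hkl : k ≤ l) {B : ℝ} {f : ℝ → ℝ} (h : BddDerivs L l B f) :
    BddDerivs L k B f := by
  induction l, hkl using Nat.le_induction with
  | base => exact h
  | succ l _ ih => exact ih (h.of_succ hL)

theorem nonneg (hL : 0 < L) {k : ℕ} {B : ℝ} {f : ℝ → ℝ} (h : BddDerivs L k B f) : 0 ≤ B := by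
  have : (ae (dom L)).NeBot := by
    rw [ae_neBot, Ne, Measure.restrict_eq_zero]
    simp [hL]
  obtain ⟨x, hx⟩ := h.bound.exists
  exact (abs_nonneg _).trans hx

theorem const {k : ℕ} {B c : ℝ} (h : |c| ≤ B) : BddDerivs L k B fun _ => c := by
  induction k generalizing c with
  | zero => exact ⟨aestronglyMeasurable_const, Filter.Eventually.of_forall fun _ => h⟩
  | succ k ih =>
    exact ⟨Filter.Eventually.of_forall fun _ => h, fun _ => 0, c,
      ih (by simpa using (abs_nonneg c).trans h), Filter.Eventually.of_forall fun x => by simp⟩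

theorem add (hL : 0 ≤ L) {k : ℕ} {B C : ℝ} {f g : ℝ → ℝ} (hf : BddDerivs L k B f)
    (hg : BddDerivs L k C g) : BddDerivs L k (B + C) fun x => f x + g x := by
  have hb : ∀ᵐ x ∂(dom L), |f x + g x| ≤ B + C := by
    filter_upwards [hf.bound, hg.bound] with x h1 h2
    exact (abs_add_le _ _).trans (add_le_add h1 h2)
  induction k generalizing f g with
  | zero => exact ⟨hf.1.add hg.1, hb⟩
  | succ k ih =>
    obtain ⟨_, f', c, hf', hff⟩ := hf
    obtain ⟨_, g', d, hg', hgg⟩ := hg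
    refine ⟨hb, fun x => f' x + g' x, c + d, ih hf' hg' ?_, ?_⟩
    · filter_upwards [hf'.bound, hg'.bound] with x h1 h2
      exact (abs_add_le _ _).trans (add_le_add h1 h2)
    · filter_upwards [hff, hgg, ae_restrict_mem measurableSet_Icc] with x h1 h2 hx
      have h0 : (0 : ℝ) ∈ Set.Icc 0 L := ⟨le_rfl, hL⟩
      rw [h1, h2, intervalIntegral.integral_add
        (intervalIntegrable_of_dom (hf'.integrable hL) h0 hx)
        (intervalIntegrable_of_dom (hg'.integrable hL) h0 hx)]
      ring

theorem neg {k : ℕ} {B : ℝ} {g : ℝ → ℝ} (hg : BddDerivs L k B g) :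
    BddDerivs L k B fun y => -g y := by
  induction k generalizing g with
  | zero => exact ⟨hg.1.neg, hg.2.mono fun x hx => by rwa [abs_neg]⟩
  | succ k ih =>
    obtain ⟨h1, g', c, hg', hgg⟩ := hg
    refine ⟨h1.mono fun x hx => by rwa [abs_neg], fun y => -g' y, -c, ih hg', ?_⟩
    filter_upwards [hgg] with x hx
    rw [hx, intervalIntegral.integral_neg]
    ring

/-- The product rule writes the derivative as a sum of two products of the same kind one order
lower, so each order doubles the constant. -/
theorem mul (hL : 0 < L) {k : ℕ} {B C : ℝ} {f g : ℝ → ℝ} (hf : BddDerivs L k B f)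
    (hg : BddDerivs L k C g) : BddDerivs L k (2 ^ k * (B * C)) fun x => f x * g x := by
  have hB := hf.nonneg hL
  have hC := hg.nonneg hL
  have hb : ∀ᵐ x ∂(dom L), |f x * g x| ≤ B * C := by
    filter_upwards [hf.bound, hg.bound] with x h1 h2
    rw [abs_mul]
    exact mul_le_mul h1 h2 (abs_nonneg _) hB
  induction k generalizing f g with
  | zero => exact ⟨hf.1.mul hg.1, by simpa using hb⟩
  | succ k ih =>
    have hfk := hf.of_succ hL.le
    have hgk := hg.of_succ hL.le
    obtain ⟨_, f', c, hf', hff⟩ := hf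
    obtain ⟨_, g', d, hg', hgg⟩ := hg
    have hmulb : ∀ {u v : ℝ → ℝ}, BddDerivs L k B u → BddDerivs L k C v →
        BddDerivs L k (2 ^ k * (B * C)) fun x => u x * v x := fun hu hv => ih hu hv (by
      filter_upwards [hu.bound, hv.bound] with x h1 h2
      rw [abs_mul]
      exact mul_le_mul h1 h2 (abs_nonneg _) hB)
    refine ⟨?_, fun x => f' x * (d + ∫ y in (0 : ℝ)..x, g' y) +
      (c + ∫ y in (0 : ℝ)..x, f' y) * g' x, c * d, ?_, ?_⟩
    · filter_upwards [hb] with x hx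
      refine hx.trans (le_mul_of_one_le_left (by positivity) (one_le_pow₀ (by norm_num)))
    · have := (hmulb hf' (hgk.congr hgg)).add hL.le (hmulb (hfk.congr hff) hg')
      refine this.mono (le_of_eq (by ring))
    · filter_upwards [hff, hgg, ae_restrict_mem measurableSet_Icc] with x h1 h2 hx
      rw [h1, h2, primitive_mul_primitive hL.le (hf'.integrable hL.le) (hg'.integrable hL.le) c d hx]

theorem primitive (hL : 0 < L) {k : ℕ} {B C c : ℝ} {g : ℝ → ℝ} (hg : BddDerivs L k B g)
    (hc : |c| ≤ C) :
    BddDerivs L (k + 1) (C + (1 + L) * B) fun x => c + ∫ y in (0 : ℝ)..x, g y := by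
  have hB := hg.nonneg hL
  have hC := (abs_nonneg c).trans hc
  refine ⟨?_, g, c, hg.mono (by nlinarith), Filter.EventuallyEq.rfl⟩
  filter_upwards [ae_restrict_mem measurableSet_Icc] with x hx
  have h1 : |∫ y in (0 : ℝ)..x, g y| ≤ L * B := by
    refine (abs_primitive_le (hg.integrable hL.le) hx).trans ?_
    refine (integral_mono_ae (hg.integrable hL.le).abs (integrable_const B) hg.bound).trans ?_
    simp [hL.le]
  calc |c + ∫ y in (0 : ℝ)..x, g y| ≤ |c| + |∫ y in (0 : ℝ)..x, g y| := abs_add_le _ _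
    _ ≤ C + (1 + L) * B := by linarith

/-- Continuity upgrades the lower bound to every point of `[0, L]`. Hence `F⁻¹` is Lipschitz, so
absolutely continuous, and is recovered from its derivative `-g F⁻²`. -/
theorem primitive_inv (hL : 0 < L) {B α c : ℝ} {g : ℝ → ℝ} (hα : 0 < α) (hg : BddDerivs L 0 B g)
    (h : ∀ᵐ x ∂(dom L), α ≤ c + ∫ y in (0 : ℝ)..x, g y) {x : ℝ} (hx : x ∈ Set.Icc 0 L) :
    (c + ∫ y in (0 : ℝ)..x, g y)⁻¹ = c⁻¹ + ∫ y in (0 : ℝ)..x,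
      -g y * ((c + ∫ z in (0 : ℝ)..y, g z)⁻¹ * (c + ∫ z in (0 : ℝ)..y, g z)⁻¹) := by
  have hgi := hg.integrable hL.le
  have h0 : (0 : ℝ) ∈ Set.Icc 0 L := ⟨le_rfl, hL.le⟩
  set F : ℝ → ℝ := fun x => c + ∫ y in (0 : ℝ)..x, g y with hF
  have hFc : ContinuousOn F (Set.Icc 0 L) := continuousOn_primitive hL.le hgi c
  have hge : ∀ y ∈ Set.Icc 0 L, α ≤ F y := by
    -- `F` and `max F α` are continuous and agree almost everywhere, hence everywhere.
    have := Measure.eqOn_Icc_of_ae_eq volume hL.ne (f := F) (g := fun x => max (F x) α)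
      (by filter_upwards [h] with y hy; exact (max_eq_left hy).symm) hFc
      (hFc.sup continuousOn_const)
    intro y hy
    rw [this hy]
    exact le_max_right _ _
  have hLip : ∀ y ∈ Set.Icc 0 L, ∀ z ∈ Set.Icc 0 L, |F z - F y| ≤ B * |z - y| := by
    intro y hy z hz
    have e : F z - F y = ∫ t in y..z, g t := by
      simp only [hF, add_sub_add_left_eq_sub]
      exact intervalIntegral.integral_interval_sub_left (intervalIntegrable_of_dom hgi h0 hz)
        (intervalIntegrable_of_dom hgi h0 hy)
    rw [e, ← Real.norm_eq_abs]
    apply intervalIntegral.norm_integral_le_of_norm_le_const_ae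
    filter_upwards [ae_dom_iff.1 hg.2] with t ht htyz
    exact ht (Set.uIcc_subset_Icc hy hz (Set.uIoc_subset_uIcc htyz))
  have hB := hg.nonneg hL
  have hsub : Set.uIcc 0 x ⊆ Set.Icc 0 L := Set.uIcc_subset_Icc h0 hx
  have hAC : AbsolutelyContinuousOnInterval (fun x => (F x)⁻¹) 0 x := by
    apply LipschitzOnWith.absolutelyContinuousOnInterval (K := ⟨B / α ^ 2, by positivity⟩)
    refine LipschitzOnWith.of_dist_le_mul fun y hy z hz => ?_
    have hy' := hge y (hsub hy)
    have hz' := hge z (hsub hz)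
    have hy0 : 0 < F y := by linarith
    have hz0 : 0 < F z := by linarith
    rw [Real.dist_eq, Real.dist_eq, inv_sub_inv hy0.ne' hz0.ne', abs_div, abs_mul, abs_of_pos hy0,
      abs_of_pos hz0]
    change _ ≤ B / α ^ 2 * _
    rw [div_mul_eq_mul_div]
    refine div_le_div₀ (by positivity) ?_ (by positivity) (by nlinarith)
    have := hLip y (hsub hy) z (hsub hz)
    rwa [abs_sub_comm y z]
  have h1 := hAC.integral_deriv_eq_sub
  have hFz : F 0 = c := by simp [hF]
  rw [hFz] at h1
  have h2 : ∫ y in (0 : ℝ)..x, -g y * ((F y)⁻¹ * (F y)⁻¹) =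
      ∫ y in (0 : ℝ)..x, deriv (fun x => (F x)⁻¹) y := by
    apply primitive_congr (L := L) _ h0 hx
    filter_upwards [ae_hasDerivAt_primitive hL.le hgi c, ae_restrict_mem measurableSet_Icc]
      with y hy hyL
    have := hge y hyL
    rw [(HasDerivAt.fun_inv (x := y) (c := F) hy (by linarith)).deriv]
    field_simp
  rw [h2, h1]
  ring

/-- Induction through `(1 / f)' = -f' (1 / f)²`: the bound for the inverse at order `k`, combined
with `mul`, gives order `k + 1`. -/
theorem exists_inv (hL : 0 < L) (k : ℕ) (B : ℝ) {α : ℝ} (hα : 0 < α) :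
    ∃ C : ℝ, ∀ f : ℝ → ℝ, BddDerivs L k B f → (∀ᵐ x ∂(dom L), α ≤ f x) →
      BddDerivs L k C fun x => (f x)⁻¹ := by
  have hb : ∀ f : ℝ → ℝ, (∀ᵐ x ∂(dom L), α ≤ f x) → ∀ᵐ x ∂(dom L), |(f x)⁻¹| ≤ α⁻¹ := by
    intro f hf
    filter_upwards [hf] with x hx
    rw [abs_inv, abs_of_pos (hα.trans_le hx)]
    exact inv_anti₀ hα hx
  induction k with
  | zero =>
    exact ⟨α⁻¹, fun f hf hα' => ⟨hf.1.aemeasurable.inv.aestronglyMeasurable, hb f hα'⟩⟩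
  | succ k ih =>
    obtain ⟨C, hC⟩ := ih
    refine ⟨α⁻¹ + 2 ^ k * (B * (2 ^ k * (C * C))), fun f hf hαf => ?_⟩
    have hBpos := hf.nonneg hL
    have hfk := hC f (hf.of_succ hL.le) hαf
    have hCpos := hfk.nonneg hL
    obtain ⟨_, g, c, hg, hfg⟩ := hf
    refine ⟨?_, fun y => -g y * ((c + ∫ z in (0 : ℝ)..y, g z)⁻¹ * (c + ∫ z in (0 : ℝ)..y, g z)⁻¹),
      c⁻¹, ?_, ?_⟩
    · filter_upwards [hb f hαf] with x hx
      refine hx.trans (le_add_of_nonneg_right (by positivity))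
    · have hinv : BddDerivs L k C fun y => (c + ∫ z in (0 : ℝ)..y, g z)⁻¹ :=
        hfk.congr (hfg.mono fun x hx => by simp only [hx])
      refine (hg.neg.mul hL (hinv.mul hL hinv)).mono ?_
      have := inv_pos.2 hα
      linarith
    · filter_upwards [hfg, ae_restrict_mem measurableSet_Icc] with x hx hxL
      have hg0 : BddDerivs L 0 B g := hg.of_le hL.le (Nat.zero_le k)
      rw [hx]
      exact primitive_inv hL hα hg0 (by filter_upwards [hαf, hfg] with y h1 h2; rwa [← h2]) hxL

end BddDerivs

/-- Du Bois-Reymond turns each weak derivative into a primitive, the form in which product and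
inverse rules can be iterated. -/
theorem SobolevInftyBound.bddDerivs (hL : 0 < L) {r : ℕ} {M : ℝ} {f : ℝ → ℝ}
    (h : SobolevInftyBound L r M f) : BddDerivs L r M f := by
  obtain ⟨D, hD0, hDb, hDw⟩ := h
  have key : ∀ k j, j + k ≤ r → BddDerivs L k M (D j) := by
    intro k
    induction k with
    | zero => exact fun j hj => hDb j hj
    | succ k ih =>
      intro j hj
      have hi : ∀ i ≤ r, Integrable (D i) (dom L) := fun i hi =>
        Integrable.of_bound (hDb i hi).1 M (hDb i hi).2
      obtain ⟨c, hc⟩ := (hDw j (by omega)).exists_primitive hL (hi j (by omega))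
        (hi (j + 1) (by omega))
      exact ⟨(hDb j (by omega)).2, D (j + 1), c, ih (j + 1) (by omega), hc⟩
  rw [← hD0]
  exact key r 0 (by omega)

/-- The Sobolev embedding `H^{k+1} ⊂ W^{k,∞}`. -/
theorem Sobolev.bddDerivs (hL : 0 < L) {k : ℕ} (u : Sobolev L (k + 1)) :
    BddDerivs L k (((1 + L) / ‖one L‖ + ‖one L‖) * ‖u‖) (fn u) := by
  have h1 : 0 < ‖one L‖ := by
    have := norm_one_sq hL.le
    by_contra! hcon
    have h0 := le_antisymm hcon (norm_nonneg _)
    rw [h0] at this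
    simp at this
    linarith
  let v : PiLp 2 fun _ : Fin (k + 1 + 1) => L2 L := u
  have hv : ∀ j, ‖v j‖ ≤ ‖u‖ := fun j => PiLp.norm_apply_le v j
  have hb : ∀ j : Fin (k + 1), ∀ᵐ x ∂(dom L),
      |v j.castSucc x| ≤ ((1 + L) / ‖one L‖ + ‖one L‖) * ‖u‖ := by
    intro j
    obtain ⟨c, hc⟩ := Sobolev.exists_primitive hL u j
    change v j.castSucc =ᵐ[dom L] fun x => c + ∫ y in (0 : ℝ)..x, v j.succ y at hc
    -- The integration constant is bounded in `L²` by writing it as the function minus the primitive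
    -- of its derivative; both are controlled by `‖u‖`.
    have hcone : c • one L = v j.castSucc - prim hL.le (v j.succ) := by
      apply Lp.ext
      filter_upwards [hc, coeFn_prim hL.le (v j.succ), Lp.coeFn_smul c (one L), coeFn_one (L := L),
        Lp.coeFn_sub (v j.castSucc) (prim hL.le (v j.succ))] with x e1 e2 e3 e4 e5
      rw [e3, e5, Pi.sub_apply, e1, e2, Pi.smul_apply, e4]
      simp
    have hcn : |c| * ‖one L‖ ≤ (1 + L) * ‖u‖ := by
      rw [← Real.norm_eq_abs, ← norm_smul, hcone]
      refine (norm_sub_le _ _).trans ?_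
      have := (prim hL.le).le_of_opNorm_le (norm_prim_le hL.le) (v j.succ)
      nlinarith [hv j.castSucc, hv j.succ]
    filter_upwards [hc, ae_restrict_mem measurableSet_Icc] with x hx hxL
    rw [hx, add_mul]
    refine (abs_add_le _ _).trans (add_le_add ?_ ?_)
    · rw [div_mul_eq_mul_div, le_div_iff₀ h1]
      exact hcn
    · refine (abs_primitive_le (L2.integrable _) hxL).trans ((L2.integral_abs_le _).trans ?_)
      exact mul_le_mul_of_nonneg_left (hv _) (norm_nonneg _)
  have key : ∀ i (j : Fin (k + 1)), (j : ℕ) + i ≤ k →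
      BddDerivs L i (((1 + L) / ‖one L‖ + ‖one L‖) * ‖u‖) (v j.castSucc) := by
    intro i
    induction i with
    | zero => exact fun j _ => ⟨Lp.aestronglyMeasurable _, hb j⟩
    | succ i ih =>
      intro j hj
      obtain ⟨c, hc⟩ := Sobolev.exists_primitive hL u j
      refine ⟨hb j, v j.succ, c, ?_, hc⟩
      have := ih ⟨j + 1, by omega⟩ (by simp only []; omega)
      exact this
  exact key k 0 (by simp)

/-! ### Meshes and piecewise polynomial approximation. -/

theorem exists_polynomial_antiderivative {k : ℕ} {p : Polynomial ℝ}
    (hp : p ∈ Polynomial.degreeLT ℝ k) :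
    ∃ P ∈ Polynomial.degreeLT ℝ (k + 1), Polynomial.derivative P = p := by
  refine ⟨∑ i ∈ Finset.range k, Polynomial.monomial (i + 1) (p.coeff i / (i + 1)), ?_, ?_⟩
  · refine Submodule.sum_mem _ fun i hi => ?_
    rw [Polynomial.mem_degreeLT]
    refine (Polynomial.degree_monomial_le _ _).trans_lt ?_
    exact_mod_cast Nat.succ_lt_succ (Finset.mem_range.1 hi)
  · rw [Polynomial.derivative_sum]
    have h : p = ∑ i ∈ Finset.range k, Polynomial.monomial i (p.coeff i) := by
      by_cases h0 : p = 0
      · simp [h0]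
      · rw [Polynomial.mem_degreeLT] at hp
        exact p.as_sum_range' k ((Polynomial.natDegree_lt_iff_degree_lt h0).2 hp)
    conv_rhs => rw [h]
    refine Finset.sum_congr rfl fun i _ => ?_
    rw [Polynomial.derivative_monomial]
    have : (i : ℝ) + 1 ≠ 0 := by positivity
    simp [this]

namespace Mesh

variable (m : Mesh L)

theorem node_mem (i : Fin (m.n + 1)) : m.node i ∈ Set.Icc 0 L :=
  ⟨m.first.symm.le.trans (m.strictMono.monotone (Fin.zero_le i)),
    (m.strictMono.monotone (Fin.le_last i)).trans m.final.le⟩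

theorem node_lt (i : Fin m.n) : m.node i.castSucc < m.node i.succ :=
  m.strictMono i.castSucc_lt_succ

theorem length_le_h (i : Fin m.n) : m.node i.succ - m.node i.castSucc ≤ m.h :=
  le_ciSup (f := fun i : Fin m.n => m.node i.succ - m.node i.castSucc) (Set.finite_range _).bddAbove i

theorem h_pos (hL : 0 < L) : 0 < m.h := by
  have hn : 0 < m.n := by
    rcases Nat.eq_zero_or_pos m.n with h0 | h0
    · exfalso
      have h1 : Fin.last m.n = 0 := by
        ext
        simpa using h0
      have := m.final
      rw [h1, m.first] at this
      exact hL.ne this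
    · exact h0
  have := m.length_le_h ⟨0, hn⟩
  linarith [m.node_lt ⟨0, hn⟩]

theorem measurableSet_cell (i : Fin m.n) : MeasurableSet (m.cell i) := measurableSet_Ioo

theorem cell_subset (i : Fin m.n) : m.cell i ⊆ Set.Icc 0 L := fun _ hx =>
  ⟨(m.node_mem _).1.trans hx.1.le, hx.2.le.trans (m.node_mem _).2⟩

theorem cell_disjoint {i j : Fin m.n} (hij : i ≠ j) : Disjoint (m.cell i) (m.cell j) := by
  wlog h : i < j generalizing i j
  · exact (this hij.symm (lt_of_le_of_ne (not_lt.1 h) hij.symm)).symm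
  rw [Set.disjoint_left]
  intro x hx hy
  have : m.node i.succ ≤ m.node j.castSucc :=
    m.strictMono.monotone (Fin.succ_le_castSucc_iff.2 h)
  exact absurd (hx.2.trans_le this) (not_lt.2 hy.1.le)

theorem ae_mem_cell : ∀ᵐ x ∂(dom L), ∃ i, x ∈ m.cell i := by
  have hne : ∀ᵐ x : ℝ, x ∉ Set.range m.node :=
    measure_eq_zero_iff_ae_notMem.1 ((Set.finite_range _).measure_zero _)
  filter_upwards [ae_dom_iff.2 (hne.mono fun x hx _ => hx), ae_restrict_mem measurableSet_Icc]
    with x hx hxL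
  by_contra! hcon
  have hlt : ∀ k : Fin (m.n + 1), m.node k < x := by
    intro k
    induction k using Fin.induction with
    | zero =>
      rw [m.first]
      exact lt_of_le_of_ne hxL.1 fun h => hx ⟨0, by rw [m.first, h]⟩
    | succ i ih =>
      by_contra! hle
      exact hcon i ⟨ih, lt_of_le_of_ne hle fun h => hx ⟨i.succ, h.symm⟩⟩
  have := hlt (Fin.last m.n)
  rw [m.final] at this
  exact absurd hxL.2 (not_le.2 this)

theorem integral_eq_sum_cell {f : ℝ → ℝ} (hf : Integrable f (dom L)) :
    ∫ x, f x ∂(dom L) = ∑ i, ∫ x in m.cell i, f x := by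
  rw [← integral_iUnion_fintype (fun i => m.measurableSet_cell i) (fun i j hij => m.cell_disjoint hij)
    (fun i => IntegrableOn.mono_set hf (m.cell_subset i))]
  refine setIntegral_congr_set ?_
  refine Filter.EventuallyLE.antisymm ?_ ?_
  · filter_upwards [ae_dom_iff.1 m.ae_mem_cell] with x hx hxL
    exact Set.mem_iUnion.2 (hx hxL)
  · exact Filter.Eventually.of_forall fun x hx => by
      obtain ⟨i, hi⟩ := Set.mem_iUnion.1 hx
      exact m.cell_subset i hi

/-- Piecewise polynomials with prescribed pieces. -/
theorem exists_mem_Qh {r : ℕ} (p : Fin m.n → Polynomial ℝ)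
    (hp : ∀ i, p i ∈ Polynomial.degreeLT ℝ r) :
    ∃ q ∈ Qh m r, ∀ i, ∀ᵐ x ∂(dom L), x ∈ m.cell i → q x = (p i).eval x := by
  have hmem : MemLp (fun x => ∑ i, (m.cell i).indicator (fun x => (p i).eval x) x) 2 (dom L) := by
    refine memLp_finsetSum _ fun i _ => MemLp.indicator measurableSet_Ioo ?_
    obtain ⟨C, hC⟩ := (isCompact_Icc (a := (0 : ℝ)) (b := L)).exists_bound_of_continuousOn
      (p i).continuous.continuousOn
    exact MemLp.of_bound (p i).continuous.aestronglyMeasurable C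
      ((ae_restrict_mem measurableSet_Icc).mono hC)
  have key : ∀ i, ∀ᵐ x ∂(dom L), x ∈ m.cell i → hmem.toLp _ x = (p i).eval x := by
    intro i
    filter_upwards [hmem.coeFn_toLp] with x hx hi
    rw [hx, Finset.sum_eq_single i]
    · rw [Set.indicator_of_mem hi]
    · intro j _ hji
      exact Set.indicator_of_notMem (Set.disjoint_left.1 (m.cell_disjoint hji.symm) hi) _
    · simp
  exact ⟨hmem.toLp _, fun i => ⟨p i, hp i, key i⟩, key⟩

end Mesh

/-- Local polynomial approximation of order `k`. -/
theorem BddDerivs.exists_polynomial (hL : 0 ≤ L) {k : ℕ} {B : ℝ} {f : ℝ → ℝ}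
    (hf : BddDerivs L k B f) {a b : ℝ} (ha : a ∈ Set.Icc 0 L) (hb : b ∈ Set.Icc 0 L) :
    ∃ p ∈ Polynomial.degreeLT ℝ k,
      ∀ᵐ x ∂(dom L), x ∈ Set.Ioo a b → |f x - p.eval x| ≤ (b - a) ^ k * B := by
  induction k generalizing f with
  | zero => exact ⟨0, Submodule.zero_mem _, hf.2.mono fun x hx _ => by simpa using hx⟩
  | succ k ih =>
    obtain ⟨_, g, c, hg, hfg⟩ := hf
    obtain ⟨p, hp, hgp⟩ := ih hg
    obtain ⟨P, hP, hPp⟩ := exists_polynomial_antiderivative hp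
    have h0 : (0 : ℝ) ∈ Set.Icc 0 L := ⟨le_rfl, hL⟩
    -- The constant makes the new polynomial agree with `c + ∫ g` at `a`. The error at `x` is then
    -- `∫ₐˣ (g - p)`, which gains a factor `b - a`.
    refine ⟨P + Polynomial.C (c + (∫ y in (0 : ℝ)..a, g y) - P.eval a),
      Submodule.add_mem _ hP ?_, ?_⟩
    · rw [Polynomial.mem_degreeLT]
      exact Polynomial.degree_C_le.trans_lt (by exact_mod_cast Nat.succ_pos k)
    filter_upwards [hfg] with x hx hxab
    have hxL : x ∈ Set.Icc 0 L := ⟨ha.1.trans hxab.1.le, hxab.2.le.trans hb.2⟩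
    have hgi := hg.integrable hL
    have e1 : ∫ y in (0 : ℝ)..x, g y = (∫ y in (0 : ℝ)..a, g y) + ∫ y in a..x, g y :=
      (intervalIntegral.integral_add_adjacent_intervals (intervalIntegrable_of_dom hgi h0 ha)
        (intervalIntegrable_of_dom hgi ha hxL)).symm
    have e2 : ∫ y in a..x, p.eval y = P.eval x - P.eval a := by
      rw [← hPp]
      exact intervalIntegral.integral_eq_sub_of_hasDerivAt (fun y _ => P.hasDerivAt y)
        ((Polynomial.derivative P).continuous.intervalIntegrable _ _)
    have e3 : f x - (P + Polynomial.C (c + (∫ y in (0 : ℝ)..a, g y) - P.eval a)).eval x =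
        ∫ y in a..x, (g y - p.eval y) := by
      rw [intervalIntegral.integral_sub (intervalIntegrable_of_dom hgi ha hxL)
        (p.continuous.intervalIntegrable _ _), e2, hx, e1]
      simp
      ring
    rw [e3, ← Real.norm_eq_abs]
    have h1 : ‖∫ y in a..x, (g y - p.eval y)‖ ≤ (b - a) ^ k * B * |x - a| := by
      apply intervalIntegral.norm_integral_le_of_norm_le_const_ae
      filter_upwards [ae_dom_iff.1 hgp] with y hy hyx
      rw [Set.uIoc_of_le hxab.1.le] at hyx
      exact hy ⟨ha.1.trans hyx.1.le, hyx.2.trans hxL.2⟩ ⟨hyx.1, hyx.2.trans_lt hxab.2⟩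
    refine h1.trans ?_
    rw [abs_of_nonneg (by linarith [hxab.1]), pow_succ]
    have hnn : 0 ≤ (b - a) ^ k * B * (x - a) := by
      have h2 := norm_nonneg (∫ y in a..x, (g y - p.eval y))
      rw [abs_of_nonneg (by linarith [hxab.1])] at h1
      exact h2.trans h1
    have hxa : 0 < x - a := by linarith [hxab.1]
    have hpB : 0 ≤ (b - a) ^ k * B := nonneg_of_mul_nonneg_left hnn hxa
    rw [mul_right_comm _ (b - a) B]
    exact mul_le_mul_of_nonneg_left (by linarith [hxab.2]) hpB

theorem exists_mem_Qh_norm_sub_le (hL : 0 < L) (m : Mesh L) {r : ℕ} {B : ℝ} {f : L2 L}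
    (hf : BddDerivs L r B f) : ∃ q ∈ Qh m r, ‖f - q‖ ≤ m.h ^ r * (B * ‖one L‖) := by
  choose p hp hfp using fun i : Fin m.n => hf.exists_polynomial hL.le (m.node_mem i.castSucc)
    (m.node_mem i.succ)
  obtain ⟨q, hq, hqp⟩ := m.exists_mem_Qh p hp
  refine ⟨q, hq, ?_⟩
  rw [← mul_assoc]
  apply L2.norm_le_of_ae_bound
  filter_upwards [ae_all_iff.2 hqp, ae_all_iff.2 hfp, m.ae_mem_cell, Lp.coeFn_sub f q]
    with x h1 h2 ⟨i, hi⟩ h3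
  rw [h3, Pi.sub_apply, h1 i hi]
  refine (h2 i hi).trans ?_
  exact mul_le_mul_of_nonneg_right
    (pow_le_pow_left₀ (by linarith [m.node_lt i]) (m.length_le_h i) _) (hf.nonneg hL)

/-- Cauchy-Schwarz on `[a, x]`, read off from the nonnegativity of `∫ ((x - a) f - I)²`. -/
theorem sq_integral_le {f : ℝ → ℝ} {a x : ℝ} (hax : a < x) (hf : IntervalIntegrable f volume a x)
    (hf2 : IntervalIntegrable (fun y => f y ^ 2) volume a x) :
    (∫ y in a..x, f y) ^ 2 ≤ (x - a) * ∫ y in a..x, f y ^ 2 := by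
  set I := ∫ y in a..x, f y with hI
  have h : 0 ≤ ∫ y in a..x, ((x - a) * f y - I) ^ 2 :=
    intervalIntegral.integral_nonneg hax.le fun _ _ => sq_nonneg _
  have e : ∫ y in a..x, ((x - a) * f y - I) ^ 2 =
      (x - a) * ((x - a) * (∫ y in a..x, f y ^ 2) - I ^ 2) := by
    have e1 : ∀ y, ((x - a) * f y - I) ^ 2 =
        ((x - a) ^ 2 * f y ^ 2 - 2 * (x - a) * I * f y) + I ^ 2 := fun y => by ring
    simp only [e1]
    rw [intervalIntegral.integral_add ((hf2.const_mul _).sub (hf.const_mul _))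
      intervalIntegrable_const, intervalIntegral.integral_sub (hf2.const_mul _) (hf.const_mul _),
      intervalIntegral.integral_const_mul, intervalIntegral.integral_const_mul,
      intervalIntegral.integral_const, ← hI, smul_eq_mul]
    ring
  rw [e] at h
  have := nonneg_of_mul_nonneg_right h (sub_pos.2 hax)
  linarith

theorem L2.norm_sq_eq (f : L2 L) : ‖f‖ ^ 2 = ∫ x, f x ^ 2 ∂(dom L) := by
  rw [← real_inner_self_eq_norm_sq, inner_L2]
  simp only [pow_two]

theorem L2.integrable_sq (f : L2 L) : Integrable (fun x => f x ^ 2) (dom L) :=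
  (Lp.memLp f).integrable_sq

/-- First order approximation of primitives by piecewise polynomials. -/
theorem exists_mem_Qh_norm_primitive_sub_le (hL : 0 < L) (m : Mesh L) {r : ℕ} (hr : 1 ≤ r) (c : ℝ)
    (f : L2 L) : ∃ q ∈ Qh m r, ‖c • one L + prim hL.le f - q‖ ≤ m.h * ‖f‖ := by
  have h0 : (0 : ℝ) ∈ Set.Icc 0 L := ⟨le_rfl, hL.le⟩
  -- Piecewise constants suffice: each cell takes the value at its left node, so the difference is a
  -- primitive starting there. This is where `1 ≤ r` enters.
  obtain ⟨q, hq, hqp⟩ := m.exists_mem_Qh (r := r)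
    (fun i => Polynomial.C (c + ∫ y in (0 : ℝ)..(m.node i.castSucc), f y)) (fun i => by
      rw [Polynomial.mem_degreeLT]
      exact Polynomial.degree_C_le.trans_lt (by exact_mod_cast hr))
  refine ⟨q, hq, ?_⟩
  set v := c • one L + prim hL.le f - q with hv
  have hh := (m.h_pos hL).le
  have hvx : ∀ i, ∀ᵐ x ∂(dom L), x ∈ m.cell i → v x = ∫ y in (m.node i.castSucc)..x, f y := by
    intro i
    filter_upwards [Lp.coeFn_sub (c • one L + prim hL.le f) q,
      Lp.coeFn_add (c • one L) (prim hL.le f), Lp.coeFn_smul c (one L), coeFn_one (L := L),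
      coeFn_prim hL.le f, hqp i] with x e1 e2 e3 e4 e5 e6 hx
    have hxL := m.cell_subset i hx
    rw [hv, e1, Pi.sub_apply, e2, Pi.add_apply, e3, Pi.smul_apply, e4, e5, e6 hx,
      ← intervalIntegral.integral_add_adjacent_intervals
        (intervalIntegrable_of_dom f.integrable h0 (m.node_mem i.castSucc))
        (intervalIntegrable_of_dom f.integrable (m.node_mem i.castSucc) hxL)]
    simp
  have hcell : ∀ i, ∫ x in m.cell i, v x ^ 2 ≤ m.h ^ 2 * ∫ x in m.cell i, f x ^ 2 := by
    intro i
    set a := m.node i.castSucc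
    set b := m.node i.succ
    have hab : a < b := m.node_lt i
    have hf2 : IntegrableOn (fun x => f x ^ 2) (m.cell i) :=
      IntegrableOn.mono_set f.integrable_sq (m.cell_subset i)
    have hb : ∀ᵐ x ∂(volume.restrict (m.cell i)),
        v x ^ 2 ≤ m.h * ∫ x in m.cell i, f x ^ 2 := by
      rw [ae_restrict_iff' (m.measurableSet_cell i)]
      filter_upwards [ae_dom_iff.1 (hvx i)] with x hx hxi
      have hxL := m.cell_subset i hxi
      rw [hx hxL hxi]
      refine (sq_integral_le hxi.1 (intervalIntegrable_of_dom f.integrable (m.node_mem _) hxL)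
        (intervalIntegrable_of_dom f.integrable_sq (m.node_mem _) hxL)).trans ?_
      refine mul_le_mul ?_ ?_ ?_ hh
      · exact (sub_le_sub_right hxi.2.le _).trans (m.length_le_h i)
      · rw [intervalIntegral.integral_of_le hxi.1.le]
        refine setIntegral_mono_set hf2 (Filter.Eventually.of_forall fun _ => sq_nonneg _)
          (Filter.Eventually.of_forall fun y hy => ⟨hy.1, hy.2.trans_lt hxi.2⟩)
      · exact intervalIntegral.integral_nonneg hxi.1.le fun _ _ => sq_nonneg _
    have hnn : 0 ≤ ∫ x in m.cell i, f x ^ 2 := integral_nonneg fun _ => sq_nonneg _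
    have hfin : IntegrableOn (fun _ : ℝ => m.h * ∫ x in m.cell i, f x ^ 2) (m.cell i) volume :=
      integrableOn_const (by simp [Mesh.cell]) ENNReal.coe_ne_top
    calc ∫ x in m.cell i, v x ^ 2 ≤ ∫ x in m.cell i, (m.h * ∫ x in m.cell i, f x ^ 2) :=
          integral_mono_ae (IntegrableOn.mono_set v.integrable_sq (m.cell_subset i)) hfin hb
      _ = (b - a) * (m.h * ∫ x in m.cell i, f x ^ 2) := by
          rw [integral_const, smul_eq_mul]
          congr 1
          simp [Mesh.cell, a, b, hab.le]
      _ ≤ m.h * (m.h * ∫ x in m.cell i, f x ^ 2) :=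
          mul_le_mul_of_nonneg_right (m.length_le_h i) (by positivity)
      _ = m.h ^ 2 * ∫ x in m.cell i, f x ^ 2 := by ring
  refine le_of_sq_le_sq ?_ (by positivity)
  rw [mul_pow, L2.norm_sq_eq, L2.norm_sq_eq, m.integral_eq_sum_cell v.integrable_sq,
    m.integral_eq_sum_cell f.integrable_sq, Finset.mul_sum]
  exact Finset.sum_le_sum fun i _ => hcell i

theorem one_mem_Qh (m : Mesh L) {r : ℕ} (hr : 1 ≤ r) : one L ∈ Qh m r := fun i =>
  ⟨Polynomial.C 1, by
    rw [Polynomial.mem_degreeLT]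
    exact Polynomial.degree_C_le.trans_lt (by exact_mod_cast hr),
    coeFn_one.mono fun x hx _ => by simp [hx]⟩

/-- On a cell the primitive of `der u` and the polynomial `p` are continuous and agree almost
everywhere, hence everywhere; differentiating lowers the degree from `≤ r` to `< r`. -/
theorem der_mem_Qh (hL : 0 < L) {m : Mesh L} {r : ℕ} {u : Sobolev L 1}
    (hu : u ∈ Vh m r) : der u ∈ Qh m r := by
  intro i
  obtain ⟨p, hp, hup⟩ := hu.2 i
  have hfn := (fn_eq_prim_of_mem_H10 hL hu.1).1
  refine ⟨Polynomial.derivative p, ?_, ?_⟩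
  · rw [Polynomial.mem_degreeLE] at hp
    rw [Polynomial.mem_degreeLT]
    by_cases h0 : p = 0
    · simp only [h0, Polynomial.derivative_zero, Polynomial.degree_zero]
      exact WithBot.bot_lt_coe _
    · exact (Polynomial.degree_derivative_lt h0).trans_le hp
  · refine ae_eq_of_primitive_eq hL.le (c := 0) (der u).integrable (G := fun x => p.eval x)
      (fun x => p.hasDerivAt x) (fun x hx _ => ?_)
    have he : (fun x => 0 + ∫ y in (0 : ℝ)..x, der u y) =ᵐ[volume.restrict (m.cell i)]
        fun x => p.eval x := by
      rw [Filter.EventuallyEq, ae_restrict_iff' (m.measurableSet_cell i)]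
      filter_upwards [ae_dom_iff.1 hup, ae_dom_iff.1 (coeFn_prim hL.le (der u))] with x h1 h2 hxi
      have hxL := m.cell_subset i hxi
      rw [zero_add, ← h1 hxL hxi, ← h2 hxL, hfn]
    exact Measure.eqOn_open_of_ae_eq he isOpen_Ioo
      ((continuousOn_primitive hL.le (der u).integrable 0).mono (m.cell_subset i))
      p.continuous.continuousOn hx

/-- The primitive of a mean-zero piecewise polynomial lies in `H10` and gains one degree on each
cell. With `der_mem_Qh`, the derivatives of `Vh` are exactly the mean-zero part of `Qh`. -/
theorem exists_mem_Vh_der_eq (hL : 0 < L) {m : Mesh L} {r : ℕ} {q : L2 L} (hq : q ∈ Qh m r)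
    (hq0 : inner ℝ (one L) q = 0) : ∃ u ∈ Vh m r, der u = q := by
  obtain ⟨u, hu, rfl⟩ := exists_mem_H10_der_eq hL hq0
  refine ⟨u, ⟨hu, fun i => ?_⟩, rfl⟩
  obtain ⟨p, hp, hup⟩ := hq i
  obtain ⟨P, hP, hPp⟩ := exists_polynomial_antiderivative hp
  set a := m.node i.castSucc with ha
  have haL := m.node_mem i.castSucc
  have h0 : (0 : ℝ) ∈ Set.Icc 0 L := ⟨le_rfl, hL.le⟩
  refine ⟨P + Polynomial.C ((∫ y in (0 : ℝ)..a, der u y) - P.eval a), ?_, ?_⟩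
  · rw [Polynomial.mem_degreeLE]
    rw [Polynomial.mem_degreeLT] at hP
    refine (Polynomial.degree_add_le _ _).trans (max_le ?_ ?_)
    · exact Order.lt_succ_iff.1 (by exact_mod_cast hP)
    · exact Polynomial.degree_C_le.trans (by exact_mod_cast Nat.zero_le r)
  rw [(fn_eq_prim_of_mem_H10 hL hu).1]
  filter_upwards [coeFn_prim hL.le (der u)] with x hx hxi
  have hxL := m.cell_subset i hxi
  have e : ∫ y in a..x, der u y = P.eval x - P.eval a := by
    rw [← intervalIntegral.integral_eq_sub_of_hasDerivAt (fun y _ => P.hasDerivAt y)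
      ((Polynomial.derivative P).continuous.intervalIntegrable _ _), hPp]
    apply intervalIntegral.integral_congr_ae
    filter_upwards [ae_dom_iff.1 hup] with y hy hyx
    rw [Set.uIoc_of_le hxi.1.le] at hyx
    exact hy ⟨haL.1.trans hyx.1.le, hyx.2.trans hxL.2⟩ ⟨hyx.1, hyx.2.trans_lt hxi.2⟩
  rw [hx, ← intervalIntegral.integral_add_adjacent_intervals
    (intervalIntegrable_of_dom (der u).integrable h0 haL)
    (intervalIntegrable_of_dom (der u).integrable haL hxL), e]
  simp
  ring

/-! ### The static beam problem in an abstract inner product space. -/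

section Abstract

variable {H : Type*} [NormedAddCommGroup H] [InnerProductSpace ℝ H]

/-- An operator behaving like multiplication by a Lipschitz function, relative to the constant
function `e` and the primitive operator `J`. -/
structure IsLipschitzMul (K : ℝ) (e : H) (J A : H →L[ℝ] H) : Prop where
  norm_le : ‖A‖ ≤ K
  symm : ∀ f g, inner ℝ (A f) g = inner ℝ f (A g)
  primitive : ∀ (c : ℝ) (g : H), ∃ (c' : ℝ) (g' : H),
    A (c • e + J g) = c' • e + J g' ∧ ‖g'‖ ≤ K * (|c| + ‖g‖)

/-- The operators of the beam problem: `e` is the constant function `1`, `J` the primitive, and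
`I`, `a`, `b` are the multiplications by `Î`, `1 / Î` and `1 / Â`. -/
structure IsBeam (K : ℝ) (e : H) (J I a b : H →L[ℝ] H) : Prop where
  one_le : 1 ≤ K
  norm_e : ‖e‖ ≤ K
  norm_J : ‖J‖ ≤ K
  norm_I : ‖I‖ ≤ K
  parts : ∀ f g, inner ℝ (J f) g + inner ℝ f (J g) = inner ℝ e f * inner ℝ e g
  mul_a : IsLipschitzMul K e J a
  mul_b : IsLipschitzMul K e J b
  a_I : ∀ f, a (I f) = f
  coercive_I : ∀ f, ‖f‖ ^ 2 ≤ K * inner ℝ f (I f)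
  coercive_a : ∀ f, ‖f‖ ^ 2 ≤ K * inner ℝ f (a f)
  coercive_b : ∀ f, ‖f‖ ^ 2 ≤ K * inner ℝ f (b f)
  gram : ∀ κ c : ℝ, κ ^ 2 + c ^ 2 ≤ K * ‖κ • e - c • J e‖ ^ 2

/-- The static beam problem with load `p` in a space of derivatives `Q`; `t` and `u` are the
derivatives of the rotation and of the displacement. -/
structure IsStaticSolution (e : H) (J I b : H →L[ℝ] H) (lam : ℝ) (p : H) (Q : Submodule ℝ H)
    (t u γ : H) : Prop where
  mem_t : t ∈ Q
  mem_u : u ∈ Q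
  mem_γ : γ ∈ Q
  mean_t : inner ℝ e t = 0
  mean_u : inner ℝ e u = 0
  shear : ∀ g ∈ Q, inner ℝ e g = 0 → inner ℝ γ g = -inner ℝ p (J g)
  moment : ∀ g ∈ Q, inner ℝ e g = 0 → inner ℝ (I t) g + inner ℝ γ (J g) = 0
  constitutive : ∀ ψ ∈ Q, inner ℝ (J t - u) ψ = lam * inner ℝ (b γ) ψ

/-- A vector orthogonal to the mean-zero part of `Q` is, up to a multiple of `e`, orthogonal
to `Q`. -/
theorem exists_sub_smul_orthogonal {e : H} (he : e ≠ 0) {Q : Submodule ℝ H} (heQ : e ∈ Q) {v : H}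
    (hv : ∀ g ∈ Q, inner ℝ e g = 0 → inner ℝ v g = 0) :
    ∃ κ : ℝ, ‖v - κ • e‖ ≤ ‖v‖ ∧ ∀ g ∈ Q, inner ℝ (v - κ • e) g = 0 := by
  have hee : inner ℝ e e ≠ 0 := inner_self_ne_zero.2 he
  have h0 : inner ℝ (v - (inner ℝ e v / inner ℝ e e) • e) e = 0 := by
    rw [inner_sub_left, real_inner_smul_left, div_mul_cancel₀ _ hee, real_inner_comm, sub_self]
  refine ⟨inner ℝ e v / inner ℝ e e, ?_, fun g hg => ?_⟩
  · set w := v - (inner ℝ e v / inner ℝ e e) • e with hw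
    have h1 : inner ℝ w v = inner ℝ w w := by
      have : v = w + (inner ℝ e v / inner ℝ e e) • e := by rw [hw]; abel
      conv_lhs => rw [this]
      rw [inner_add_right, real_inner_smul_right, h0, mul_zero, add_zero]
    by_cases hw0 : ‖w‖ = 0
    · rw [hw0]
      exact norm_nonneg _
    · have h2 := real_inner_le_norm w v
      rw [h1, real_inner_self_eq_norm_mul_norm] at h2
      exact le_of_mul_le_mul_left h2 (lt_of_le_of_ne (norm_nonneg _) (Ne.symm hw0))
  · have hg' : g = (g - (inner ℝ e g / inner ℝ e e) • e) + (inner ℝ e g / inner ℝ e e) • e := by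
      abel
    have hmean : inner ℝ e (g - (inner ℝ e g / inner ℝ e e) • e) = 0 := by
      rw [inner_sub_right, real_inner_smul_right, div_mul_cancel₀ _ hee, sub_self]
    rw [hg', inner_add_right, real_inner_smul_right, h0, mul_zero, add_zero, inner_sub_left,
      real_inner_smul_left, hmean, mul_zero, sub_zero]
    exact hv _ (Q.sub_mem hg (Q.smul_mem _ heQ)) hmean

theorem norm_apply_le {K : ℝ} {A : H →L[ℝ] H} (hA : ‖A‖ ≤ K) (f : H) : ‖A f‖ ≤ K * ‖f‖ :=
  A.le_of_opNorm_le hA f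

theorem abs_inner_le {x y : H} {A B : ℝ} (hx : ‖x‖ ≤ A) (hy : ‖y‖ ≤ B) : |inner ℝ x y| ≤ A * B :=
  (abs_real_inner_le_norm x y).trans
    (mul_le_mul hx hy (norm_nonneg _) ((norm_nonneg _).trans hx))

variable {K : ℝ} {e : H} {J I a b : H →L[ℝ] H}

theorem IsBeam.ne_zero (hB : IsBeam K e J I a b) : e ≠ 0 := by
  intro h
  have := hB.gram 1 0
  simp [h] at this
  linarith

theorem IsBeam.mul_id (hB : IsBeam K e J I a b) :
    IsLipschitzMul K e J (ContinuousLinearMap.id ℝ H) where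
  norm_le := ContinuousLinearMap.norm_id_le.trans hB.one_le
  symm _ _ := rfl
  primitive c g := ⟨c, g, rfl, by
    have := hB.one_le
    nlinarith [abs_nonneg c, norm_nonneg g]⟩

/-- The quality of the space `Q`: it approximates primitives to first order. -/
def Approximates (e : H) (J : H →L[ℝ] H) (h : ℝ) (Q : Submodule ℝ H) : Prop :=
  ∀ (c : ℝ) (f : H), ∃ q ∈ Q, ‖c • e + J f - q‖ ≤ h * ‖f‖

/-- `A` sends primitives to primitives, which `Q` approximates to first order, and `S` annihilates
the approximant. -/
theorem IsLipschitzMul.abs_inner_le {A : H →L[ℝ] H} (hA : IsLipschitzMul K e J A) {h : ℝ}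
    (hh : 0 ≤ h) {Q : Submodule ℝ H} (hQ : Approximates e J h Q) {S : H}
    (hS : ∀ g ∈ Q, inner ℝ S g = 0) (c : ℝ) (g : H) :
    |inner ℝ (A (c • e + J g)) S| ≤ h * (K * (|c| + ‖g‖)) * ‖S‖ := by
  obtain ⟨c', g', he, hg'⟩ := hA.primitive c g
  obtain ⟨q, hq, hqn⟩ := hQ c' g'
  have : inner ℝ (A (c • e + J g)) S = inner ℝ (c' • e + J g' - q) S := by
    rw [he, inner_sub_left, real_inner_comm S q, hS q hq, sub_zero]
  rw [this]
  exact Timoshenko.abs_inner_le (hqn.trans (mul_le_mul_of_nonneg_left hg' hh)) le_rfl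

/-- Duality in the manner of Aubin and Nitsche. For `g = J (A S)`, integration by parts and symmetry
of `A` give `‖g‖² = ⟨A (⟨e, g⟩ e - J g), S⟩`, where `A` acts on a primitive whose data are bounded
by `‖g‖`. -/
theorem IsBeam.norm_prim_mul_le (hB : IsBeam K e J I a b) {A : H →L[ℝ] H}
    (hA : IsLipschitzMul K e J A) {h : ℝ} (hh : 0 ≤ h) {Q : Submodule ℝ H}
    (hQ : Approximates e J h Q) {S : H} (hS : ∀ g ∈ Q, inner ℝ S g = 0) :
    ‖J (A S)‖ ≤ 2 * K ^ 2 * (h * ‖S‖) := by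
  have hK := hB.one_le
  set g := J (A S) with hg
  have h1 : ‖g‖ ^ 2 = inner ℝ (A ((inner ℝ e g) • e + J (-g))) S := by
    rw [← real_inner_self_eq_norm_sq, hA.symm, inner_add_left, real_inner_smul_left, map_neg,
      inner_neg_left]
    have := hB.parts (A S) g
    rw [← hg, real_inner_comm (J g)] at this
    linarith [mul_comm (inner ℝ e g) (inner ℝ e (A S))]
  have h2 := hA.abs_inner_le hh hQ hS (inner ℝ e g) (-g)
  rw [← h1, abs_of_nonneg (sq_nonneg _), norm_neg] at h2
  have h3 : |inner ℝ e g| ≤ K * ‖g‖ := Timoshenko.abs_inner_le hB.norm_e le_rfl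
  have h4 : K * (|inner ℝ e g| + ‖g‖) ≤ 2 * K ^ 2 * ‖g‖ := by
    have h5 : K * |inner ℝ e g| ≤ K * (K * ‖g‖) := mul_le_mul_of_nonneg_left h3 (by linarith)
    have h6 : K * ‖g‖ ≤ K * (K * ‖g‖) :=
      mul_le_mul_of_nonneg_left (le_mul_of_one_le_left (norm_nonneg g) hK) (by linarith)
    linarith
  have h5 : ‖g‖ * ‖g‖ ≤ ‖g‖ * (2 * K ^ 2 * (h * ‖S‖)) := by
    calc ‖g‖ * ‖g‖ = ‖g‖ ^ 2 := by ring
      _ ≤ h * (K * (|inner ℝ e g| + ‖g‖)) * ‖S‖ := h2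
      _ ≤ h * (2 * K ^ 2 * ‖g‖) * ‖S‖ := by gcongr
      _ = ‖g‖ * (2 * K ^ 2 * (h * ‖S‖)) := by ring
  by_cases hg0 : ‖g‖ = 0
  · rw [hg0]
    positivity
  · exact le_of_mul_le_mul_left h5 (lt_of_le_of_ne (norm_nonneg _) (Ne.symm hg0))

/-- Bounds for the two free constants of the beam problem. -/
theorem IsBeam.abs_add_abs_le (hB : IsBeam K e J I a b) {lam : ℝ} (hlam : 0 ≤ lam)
    {κ c S₀ : ℝ} {τ R : H} (hτ : τ = a (κ • e - c • J e + R)) (hmean : inner ℝ e τ = 0)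
    (hcon : inner ℝ (J τ) e = S₀ - lam * c * inner ℝ (b e) e) :
    |κ| + |c| ≤ 2 * K ^ 2 * (|inner ℝ e (a R)| + |inner ℝ (J e) (a R)| + |S₀|) := by
  have hK := hB.one_le
  set y := κ • e - c • J e with hy
  set T := |inner ℝ e (a R)| + |inner ℝ (J e) (a R)| + |S₀| with hT
  have hb : 0 ≤ inner ℝ (b e) e := by
    have := hB.coercive_b e
    rw [real_inner_comm]
    nlinarith [sq_nonneg ‖e‖]
  -- The two constraints determine the pairings of `a y` with `e` and `J e`. As `y` is a combination
  -- of these two vectors, `⟨y, a y⟩` is known, and coercivity together with `gram` bounds the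
  -- coefficients.
  have h1 : inner ℝ e (a y) = -inner ℝ e (a R) := by
    rw [hτ, map_add, inner_add_right] at hmean
    linarith
  have h2 : inner ℝ (J e) (a y) = -S₀ + lam * c * inner ℝ (b e) e - inner ℝ (J e) (a R) := by
    have h3 := hB.parts e τ
    rw [hmean, mul_zero, real_inner_comm, real_inner_comm (J τ), hcon] at h3
    have h4 : inner ℝ (J e) τ = inner ℝ (J e) (a y) + inner ℝ (J e) (a R) := by
      rw [hτ, map_add, inner_add_right]
    rw [real_inner_comm] at h4
    linarith
  have h3 : inner ℝ y (a y) = κ * inner ℝ e (a y) - c * inner ℝ (J e) (a y) := by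
    conv_lhs => rw [hy, inner_sub_left, real_inner_smul_left, real_inner_smul_left, ← hy]
  have h4 : inner ℝ y (a y) ≤ (|κ| + |c|) * T := by
    rw [h3, h1, h2]
    have e1 : κ * -inner ℝ e (a R) ≤ |κ| * |inner ℝ e (a R)| := by
      rw [← abs_mul]
      nlinarith [neg_abs_le (κ * inner ℝ e (a R))]
    have e2 : c * S₀ ≤ |c| * |S₀| := by rw [← abs_mul]; exact le_abs_self _
    have e3 : c * inner ℝ (J e) (a R) ≤ |c| * |inner ℝ (J e) (a R)| := by
      rw [← abs_mul]; exact le_abs_self _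
    -- This quantity enters `⟨y, a y⟩` with a minus sign and can be dropped, which makes the bound
    -- uniform in `lam`.
    have e4 : 0 ≤ lam * c ^ 2 * inner ℝ (b e) e := by positivity
    have e5 : 0 ≤ |κ| * (|inner ℝ (J e) (a R)| + |S₀|) + |c| * |inner ℝ e (a R)| := by positivity
    rw [hT]
    nlinarith
  have h5 := hB.gram κ c
  have h6 := hB.coercive_a y
  set s := |κ| + |c| with hs
  have hs2 : s ^ 2 ≤ 2 * (κ ^ 2 + c ^ 2) := by
    have : s ^ 2 = κ ^ 2 + c ^ 2 + 2 * (|κ| * |c|) := by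
      rw [hs, ← sq_abs κ, ← sq_abs c]; ring
    nlinarith [sq_nonneg (|κ| - |c|), sq_abs κ, sq_abs c]
  have hs0 : 0 ≤ s := by positivity
  have h7 : s * s ≤ s * (2 * K ^ 2 * T) := by
    calc s * s = s ^ 2 := by ring
      _ ≤ 2 * (K * (K * (s * T))) := by
          refine hs2.trans (mul_le_mul_of_nonneg_left (h5.trans ?_) (by norm_num))
          refine mul_le_mul_of_nonneg_left (h6.trans ?_) (by linarith)
          exact mul_le_mul_of_nonneg_left h4 (by linarith)
      _ = s * (2 * K ^ 2 * T) := by ring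
  by_cases hz : s = 0
  · rw [hz]
    positivity
  · exact le_of_mul_le_mul_left h7 (lt_of_le_of_ne hs0 (Ne.symm hz))

/-- Stability uniformly in the thickness. -/
theorem IsBeam.stability (hB : IsBeam K e J I a b) {lam : ℝ} (hlam : 0 ≤ lam) (hlamK : lam ≤ K)
    {p : H} {Q : Submodule ℝ H} {t u γ : H} (hs : IsStaticSolution e J I b lam p Q t u γ) :
    ‖J t‖ ≤ 2 * K ^ 5 * ‖p‖ ∧ ‖J u‖ ≤ 2 * K ^ 6 * ‖p‖ := by
  have hK := hB.one_le
  have hK0 : 0 < K := by linarith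
  have h1 := hs.moment t hs.mem_t hs.mean_t
  have h2 := hs.shear u hs.mem_u hs.mean_u
  have h3 := hs.constitutive γ hs.mem_γ
  have h4 := hs.constitutive u hs.mem_u
  rw [inner_sub_left] at h3 h4
  -- The constitutive law tested with `u` itself. Only `lam * ‖γ‖` appears, which the energy
  -- controls uniformly as `lam → 0`; it would not control `‖γ‖`.
  have hu : ‖u‖ ≤ K * (‖t‖ + lam * ‖γ‖) := by
    have h5 : ‖u‖ * ‖u‖ ≤ ‖u‖ * (K * (‖t‖ + lam * ‖γ‖)) := by
      rw [← real_inner_self_eq_norm_mul_norm]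
      have e1 := (le_abs_self _).trans (abs_inner_le (norm_apply_le hB.norm_J t) (le_refl ‖u‖))
      have e2 := (neg_le_abs _).trans
        (abs_inner_le (norm_apply_le hB.mul_b.norm_le γ) (le_refl ‖u‖))
      have e3 := mul_le_mul_of_nonneg_left e2 hlam
      linarith
    by_cases hz : ‖u‖ = 0
    · rw [hz]
      positivity
    · exact le_of_mul_le_mul_left h5 (lt_of_le_of_ne (norm_nonneg _) (Ne.symm hz))
  -- Energy identity: the moment equation tested with `t`, the shear equation with `u` and the
  -- constitutive law with `γ`; the mixed terms cancel.
  have hen : inner ℝ t (I t) + lam * inner ℝ γ (b γ) = inner ℝ p (J u) := by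
    rw [real_inner_comm (I t) t, real_inner_comm (b γ) γ]
    linarith [real_inner_comm γ u, real_inner_comm (J t) γ]
  have hpJ : inner ℝ p (J u) ≤ ‖p‖ * (K * (K * (‖t‖ + lam * ‖γ‖))) :=
    (real_inner_le_norm _ _).trans (mul_le_mul_of_nonneg_left
      ((norm_apply_le hB.norm_J u).trans (mul_le_mul_of_nonneg_left hu hK0.le)) (norm_nonneg _))
  set x := ‖t‖ with hx
  set z := lam * ‖γ‖ with hz
  have hx0 : 0 ≤ x := norm_nonneg _
  have hz0 : 0 ≤ z := by positivity
  have c1 := hB.coercive_I t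
  have c2 : z ^ 2 ≤ K * (K * (lam * inner ℝ γ (b γ))) := by
    have := mul_le_mul_of_nonneg_left (hB.coercive_b γ) hlam
    calc z ^ 2 = lam * (lam * ‖γ‖ ^ 2) := by rw [hz]; ring
      _ ≤ K * (lam * ‖γ‖ ^ 2) := mul_le_mul_of_nonneg_right hlamK (by positivity)
      _ ≤ K * (lam * (K * inner ℝ γ (b γ))) := mul_le_mul_of_nonneg_left this hK0.le
      _ = _ := by ring
  have c3 : 0 ≤ inner ℝ t (I t) := by nlinarith [sq_nonneg ‖t‖]
  have hsum : x + z ≤ 2 * K ^ 4 * ‖p‖ := by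
    have h8 : (x + z) * (x + z) ≤ (x + z) * (2 * K ^ 4 * ‖p‖) := by
      calc (x + z) * (x + z) ≤ 2 * (x ^ 2 + z ^ 2) := by nlinarith [sq_nonneg (x - z)]
        _ ≤ 2 * (K * (K * (inner ℝ t (I t) + lam * inner ℝ γ (b γ)))) := by
            have : K * inner ℝ t (I t) ≤ K * (K * inner ℝ t (I t)) :=
              mul_le_mul_of_nonneg_left (le_mul_of_one_le_left c3 hK) hK0.le
            nlinarith
        _ ≤ 2 * (K * (K * (‖p‖ * (K * (K * (x + z)))))) := by
            rw [hen]
            gcongr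
        _ = _ := by ring
    by_cases h0 : x + z = 0
    · rw [h0]
      positivity
    · exact le_of_mul_le_mul_left h8 (lt_of_le_of_ne (by positivity) (Ne.symm h0))
  constructor
  · calc ‖J t‖ ≤ K * x := norm_apply_le hB.norm_J t
      _ ≤ K * (2 * K ^ 4 * ‖p‖) := mul_le_mul_of_nonneg_left (by linarith) hK0.le
      _ = _ := by ring
  · calc ‖J u‖ ≤ K * ‖u‖ := norm_apply_le hB.norm_J u
      _ ≤ K * (K * (2 * K ^ 4 * ‖p‖)) := by
          refine mul_le_mul_of_nonneg_left (hu.trans ?_) hK0.le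
          exact mul_le_mul_of_nonneg_left hsum hK0.le
      _ = _ := by ring

/-- Explicit form of the solution of the static problem on the whole space. -/
theorem IsBeam.exists_explicit (hB : IsBeam K e J I a b) {lam : ℝ} (hlam : 0 ≤ lam)
    (hlamK : lam ≤ K) {p : H} {t u γ : H} (hs : IsStaticSolution e J I b lam p ⊤ t u γ) :
    ∃ z₀ γ₀ : ℝ, |z₀| + |γ₀| ≤ 6 * K ^ 7 * ‖p‖ ∧ γ = γ₀ • e + J p ∧ I t = z₀ • e + J γ ∧
      u = J t - lam • b γ := by
  have hK := hB.one_le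
  have hK0 : 0 < K := by linarith
  -- After integration by parts the shear equation says that `γ - J p` is orthogonal to every
  -- mean-zero vector, hence a multiple of `e`. The moment equation is treated in the same way
  -- below.
  obtain ⟨γ₀, -, h1⟩ := exists_sub_smul_orthogonal hB.ne_zero (Q := ⊤) trivial (v := γ - J p)
    (fun g _ hg => by
      have e1 := hs.shear g trivial hg
      have e2 := hB.parts p g
      rw [hg, mul_zero] at e2
      rw [inner_sub_left]
      linarith)
  have hγ : γ = γ₀ • e + J p := by
    have := inner_self_eq_zero.1 (h1 _ trivial)
    rw [sub_sub, sub_eq_zero] at this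
    rw [this, add_comm]
  obtain ⟨z₀, -, h2⟩ := exists_sub_smul_orthogonal hB.ne_zero (Q := ⊤) trivial (v := I t - J γ)
    (fun g _ hg => by
      have e1 := hs.moment g trivial hg
      have e2 := hB.parts γ g
      rw [hg, mul_zero] at e2
      rw [inner_sub_left]
      linarith)
  have ht : I t = z₀ • e + J γ := by
    have := inner_self_eq_zero.1 (h2 _ trivial)
    rw [sub_sub, sub_eq_zero] at this
    rw [this, add_comm]
  have hu : u = J t - lam • b γ := by
    have h3 : J t - u - lam • b γ = 0 := by
      apply inner_self_eq_zero (𝕜 := ℝ) |>.1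
      rw [inner_sub_left, hs.constitutive _ trivial, real_inner_smul_left, sub_self]
    rw [sub_eq_zero] at h3
    rw [← h3]
    abel
  refine ⟨z₀, γ₀, ?_, hγ, ht, hu⟩
  have hcon := hs.constitutive e trivial
  -- Substituting `γ` gives `I t = z₀ e + γ₀ J e + J (J p)`, so the second constant is `-γ₀` and the
  -- remainder is `J (J p)`.
  have := hB.abs_add_abs_le hlam (κ := z₀) (c := -γ₀) (S₀ := lam * inner ℝ (b (J p)) e) (τ := t)
    (R := J (J p)) (by
      rw [← hB.a_I t, ht, hγ]
      congr 1
      rw [map_add, map_smul, neg_smul]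
      abel) hs.mean_t (by
      rw [inner_sub_left, real_inner_comm, hγ, map_add, map_smul, inner_add_left,
        real_inner_smul_left] at hcon
      have h4 := hs.mean_u
      rw [real_inner_comm] at h4 ⊢
      rw [h4, sub_zero] at hcon
      rw [hcon]
      ring)
  rw [abs_neg] at this
  refine this.trans ?_
  have hJp : ‖J p‖ ≤ K * ‖p‖ := norm_apply_le hB.norm_J p
  have hJJp : ‖J (J p)‖ ≤ K * (K * ‖p‖) :=
    (norm_apply_le hB.norm_J _).trans (mul_le_mul_of_nonneg_left hJp hK0.le)
  have haR : ‖a (J (J p))‖ ≤ K * (K * (K * ‖p‖)) :=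
    (norm_apply_le hB.mul_a.norm_le _).trans (mul_le_mul_of_nonneg_left hJJp hK0.le)
  have hJe : ‖J e‖ ≤ K * K :=
    (norm_apply_le hB.norm_J e).trans (mul_le_mul_of_nonneg_left hB.norm_e hK0.le)
  have hbJ : ‖b (J p)‖ ≤ K * (K * ‖p‖) :=
    (norm_apply_le hB.mul_b.norm_le _).trans (mul_le_mul_of_nonneg_left hJp hK0.le)
  have k1 := abs_inner_le hB.norm_e haR
  have k2 := abs_inner_le hJe haR
  have k3 : |lam * inner ℝ (b (J p)) e| ≤ K * (K * (K * ‖p‖) * K) := by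
    rw [abs_mul, abs_of_nonneg hlam]
    exact mul_le_mul hlamK (abs_inner_le hbJ hB.norm_e) (abs_nonneg _) hK0.le
  have k4 : K ^ 4 * ‖p‖ ≤ K ^ 5 * ‖p‖ :=
    mul_le_mul_of_nonneg_right (pow_le_pow_right₀ hK (by norm_num)) (norm_nonneg _)
  calc _ ≤ 2 * K ^ 2 * (3 * (K ^ 5 * ‖p‖)) := by
        refine mul_le_mul_of_nonneg_left ?_ (by positivity)
        nlinarith
    _ = _ := by ring

end Abstract

/-! ### The static error estimate. -/

/-- The arithmetic that closes the error estimate once `h` is small. -/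
theorem error_arithmetic {K h ρ N s σ y υ z : ℝ} (hK : 1 ≤ K) (hh : 0 ≤ h)
    (hsmall : 20 * K ^ 3 * h ≤ 1) (hρ : 0 ≤ ρ) (hN : 0 ≤ N) (hs : 0 ≤ s)
    (h1 : σ ≤ K * (N + h * ρ + s)) (h2 : s ≤ K * (h * (ρ + σ)))
    (h3 : N ^ 2 ≤ K * (ρ * N + (N + ρ) * (s + h * ρ))) (h4 : y ≤ K * (s + h * ρ + h * σ))
    (h5 : υ ≤ K * (y + ρ + s)) (h6 : z ≤ K * (y + h * ρ + s + h * υ)) :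
    y ≤ 25 * K ^ 4 * (h * ρ) ∧ z ≤ 72 * K ^ 6 * (h * ρ) := by
  -- In the application `ρ` is the best approximation error, `N = ‖τ‖`, `s = |κ| + |d|`, `σ = ‖S‖`,
  -- `y = ‖J τ‖`, `υ = ‖U‖` and `z = ‖J μ‖`.
  have hK0 : 0 < K := by linarith
  have p12 : K ≤ K ^ 2 := by nlinarith
  have p23 : K ^ 2 ≤ K ^ 3 := pow_le_pow_right₀ hK (by norm_num)
  have p34 : K ^ 3 ≤ K ^ 4 := pow_le_pow_right₀ hK (by norm_num)
  have p45 : K ^ 4 ≤ K ^ 5 := pow_le_pow_right₀ hK (by norm_num)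
  have p56 : K ^ 5 ≤ K ^ 6 := pow_le_pow_right₀ hK (by norm_num)
  have hh1 : h ≤ 1 := by nlinarith [mul_le_mul_of_nonneg_right (show (1 : ℝ) ≤ K ^ 3 by linarith) hh]
  have hρh : h * ρ ≤ ρ := by nlinarith
  -- Inserting the bound for `σ` puts `s` on the right with a factor `2 K² h ≤ 1 / 2`, which is
  -- absorbed.
  have s1 : s ≤ 4 * K ^ 2 * h * (ρ + N) := by
    have e1 : ρ + σ ≤ 2 * K * (ρ + N + s) := by
      have : K * (h * ρ) ≤ K * ρ := mul_le_mul_of_nonneg_left hρh hK0.le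
      have : ρ ≤ K * ρ := le_mul_of_one_le_left hρ hK
      have : 0 ≤ K * N := by positivity
      have : 0 ≤ K * s := by positivity
      linarith
    have e2 : s ≤ 2 * K ^ 2 * h * (ρ + N + s) := by
      calc s ≤ K * (h * (ρ + σ)) := h2
        _ ≤ K * (h * (2 * K * (ρ + N + s))) := by gcongr
        _ = _ := by ring
    have e3 : 2 * K ^ 2 * h * s ≤ 1 / 2 * s := by
      refine mul_le_mul_of_nonneg_right ?_ hs
      nlinarith [mul_le_mul_of_nonneg_right p23 hh]
    linarith
  have s2 : s ≤ ρ + N := by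
    refine s1.trans ?_
    have : 4 * K ^ 2 * h ≤ 1 := by nlinarith [mul_le_mul_of_nonneg_right p23 hh]
    exact mul_le_of_le_one_left (by positivity) this
  have hNρ : N ≤ (2 * K + 1) * ρ := by
    have e1 : s + h * ρ ≤ 5 * K ^ 2 * h * (ρ + N) := by
      have : h * ρ ≤ K ^ 2 * h * (ρ + N) := by
        have : h * ρ ≤ h * (ρ + N) := mul_le_mul_of_nonneg_left (by linarith) hh
        have h1 : 1 * (h * (ρ + N)) ≤ K ^ 2 * (h * (ρ + N)) :=
          mul_le_mul_of_nonneg_right (by linarith) (by positivity)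
        linarith
      linarith
    have e2 : K * ((N + ρ) * (s + h * ρ)) ≤ 1 / 4 * (N + ρ) ^ 2 := by
      calc K * ((N + ρ) * (s + h * ρ)) ≤ K * ((N + ρ) * (5 * K ^ 2 * h * (ρ + N))) := by gcongr
        _ = 5 * K ^ 3 * h * (N + ρ) ^ 2 := by ring
        _ ≤ 1 / 4 * (N + ρ) ^ 2 := mul_le_mul_of_nonneg_right (by linarith) (sq_nonneg _)
    have e3 : N ^ 2 ≤ 2 * K * (ρ * N) + ρ ^ 2 := by nlinarith [sq_nonneg (N - ρ)]
    by_contra! hcon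
    have h7 : ρ ≤ N := by nlinarith
    have : (2 * K + 1) * ρ * N < N * N ∨ N = 0 := by
      rcases hN.eq_or_lt with h0 | h0
      · exact Or.inr h0.symm
      · exact Or.inl (mul_lt_mul_of_pos_right hcon h0)
    rcases this with h8 | h8
    · nlinarith
    · rw [h8] at hcon
      have : 0 ≤ (2 * K + 1) * ρ := by positivity
      linarith
  have hM : ρ + N ≤ 4 * K * ρ := by
    have : ρ ≤ K * ρ := le_mul_of_one_le_left hρ hK
    linarith
  have hkρ : 0 ≤ h * ρ := by positivity
  have s3 : s ≤ 16 * K ^ 3 * (h * ρ) := by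
    calc s ≤ 4 * K ^ 2 * h * (ρ + N) := s1
      _ ≤ 4 * K ^ 2 * h * (4 * K * ρ) := by gcongr
      _ = _ := by ring
  have hσ' : σ ≤ 8 * K ^ 2 * ρ := by
    calc σ ≤ K * (N + h * ρ + s) := h1
      _ ≤ K * (4 * K * ρ + 4 * K * ρ) := mul_le_mul_of_nonneg_left (by linarith) hK0.le
      _ = _ := by ring
  have hy : y ≤ 25 * K ^ 4 * (h * ρ) := by
    calc y ≤ K * (s + h * ρ + h * σ) := h4
      _ ≤ K * (16 * K ^ 3 * (h * ρ) + h * ρ + h * (8 * K ^ 2 * ρ)) := by gcongr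
      _ = (16 * K ^ 4 + K + 8 * K ^ 3) * (h * ρ) := by ring
      _ ≤ 25 * K ^ 4 * (h * ρ) := mul_le_mul_of_nonneg_right (by linarith) hkρ
  have hυ : υ ≤ 30 * K ^ 5 * ρ := by
    calc υ ≤ K * (y + ρ + s) := h5
      _ ≤ K * (25 * K ^ 4 * ρ + ρ + 4 * K * ρ) := by
          refine mul_le_mul_of_nonneg_left ?_ hK0.le
          have : 25 * K ^ 4 * (h * ρ) ≤ 25 * K ^ 4 * ρ :=
            mul_le_mul_of_nonneg_left hρh (by positivity)
          linarith
      _ = (25 * K ^ 5 + K + 4 * K ^ 2) * ρ := by ring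
      _ ≤ 30 * K ^ 5 * ρ := mul_le_mul_of_nonneg_right (by linarith) hρ
  refine ⟨hy, ?_⟩
  calc z ≤ K * (y + h * ρ + s + h * υ) := h6
    _ ≤ K * (25 * K ^ 4 * (h * ρ) + h * ρ + 16 * K ^ 3 * (h * ρ) + h * (30 * K ^ 5 * ρ)) := by
        gcongr
    _ = (25 * K ^ 5 + K + 16 * K ^ 4 + 30 * K ^ 6) * (h * ρ) := by ring
    _ ≤ 72 * K ^ 6 * (h * ρ) := mul_le_mul_of_nonneg_right (by linarith) hkρ

section ErrorEstimate

variable {H : Type*} [NormedAddCommGroup H] [InnerProductSpace ℝ H]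
variable {K : ℝ} {e : H} {J I a b : H →L[ℝ] H}

/-- Pairing `S` with itself eliminates `q`: a residual orthogonal to `Q` is no longer than any
vector congruent to it modulo `Q`. -/
theorem norm_le_of_orthogonal {Q : Submodule ℝ H} {S : H} (hS : ∀ g ∈ Q, inner ℝ S g = 0) {x q : H}
    (hq : q ∈ Q) (hx : S = x + q) : ‖S‖ ≤ ‖x‖ := by
  have h1 : ‖S‖ * ‖S‖ ≤ ‖S‖ * ‖x‖ := by
    rw [← real_inner_self_eq_norm_mul_norm]
    have : inner ℝ S S = inner ℝ S x := by
      conv_lhs => rw [hx]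
      rw [inner_add_right, ← hx, hS q hq, add_zero]
    rw [this]
    exact real_inner_le_norm _ _
  by_cases h0 : ‖S‖ = 0
  · rw [h0]
    exact norm_nonneg _
  · exact le_of_mul_le_mul_left h1 (lt_of_le_of_ne (norm_nonneg _) (Ne.symm h0))

/-- Superconvergent `L²` error estimate for the static problem, uniformly in the thickness: the
error is one order in `h` better than the best approximation of `t`, `u`, `γ`. -/
theorem IsBeam.error_le (hB : IsBeam K e J I a b) {lam : ℝ} (hlam : 0 ≤ lam) (hlamK : lam ≤ K)
    {p : H} {Q : Submodule ℝ H} {t u γ th uh γh : H} (hs : IsStaticSolution e J I b lam p ⊤ t u γ)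
    (hsh : IsStaticSolution e J I b lam p Q th uh γh) (heQ : e ∈ Q) {h : ℝ} (hh : 0 ≤ h)
    (hQ : Approximates e J h Q) (hsmall : 20 * (10 * K ^ 7) ^ 3 * h ≤ 1) {ρ : ℝ} {qt qu qγ : H}
    (hqt : qt ∈ Q) (hqu : qu ∈ Q) (hqγ : qγ ∈ Q) (ht : ‖t - qt‖ ≤ ρ) (hu : ‖u - qu‖ ≤ ρ)
    (hγ : ‖γ - qγ‖ ≤ ρ) :
    ‖J (t - th)‖ ≤ 25 * (10 * K ^ 7) ^ 4 * (h * ρ) ∧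
      ‖J (u - uh)‖ ≤ 72 * (10 * K ^ 7) ^ 6 * (h * ρ) := by
  have hK := hB.one_le
  have hK0 : 0 < K := by linarith
  have hρ : 0 ≤ ρ := (norm_nonneg _).trans ht
  set D := γ - γh with hD
  set τ := t - th with hτ
  set μ := u - uh with hμ
  -- Both shear equations carry the same load, so `D` is orthogonal to the mean-zero part of `Q`.
  -- The remainder `δ` is therefore bounded by the best approximation of `γ`, with no dependence on
  -- `lam`.
  obtain ⟨d, -, hδ⟩ := exists_sub_smul_orthogonal hB.ne_zero heQ (v := D) (fun g hg hg0 => by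
    rw [hD, inner_sub_left, hs.shear g trivial hg0, hsh.shear g hg hg0, sub_self])
  set δ := D - d • e with hδD
  have hDδ : D = δ + d • e := by rw [hδD]; abel
  have hδρ : ‖δ‖ ≤ ρ := by
    refine (norm_le_of_orthogonal hδ (x := γ - qγ) (q := qγ - γh - d • e)
      (Q.sub_mem (Q.sub_mem hqγ hsh.mem_γ) (Q.smul_mem _ heQ)) ?_).trans hγ
    rw [hδD, hD]
    abel
  -- The difference of the moment equations, with `J` moved by parts, says that `I τ - J D` is
  -- orthogonal to the mean-zero part of `Q`.
  obtain ⟨κ, hSn, hS⟩ := exists_sub_smul_orthogonal hB.ne_zero heQ (v := I τ - J D)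
    (fun g hg hg0 => by
      have e1 := hs.moment g trivial hg0
      have e2 := hsh.moment g hg hg0
      have e3 := hB.parts D g
      rw [hg0, mul_zero, hD, inner_sub_left γ] at e3
      rw [inner_sub_left, hτ, map_sub, inner_sub_left, hD]
      linarith)
  set S := I τ - J D - κ • e with hSdef
  have hIτ : I τ = κ • e - (-d) • J e + (J δ + S) := by
    rw [hSdef, hDδ, map_add, map_smul, neg_smul]
    abel
  have hτa : τ = a (κ • e - (-d) • J e + (J δ + S)) := by rw [← hIτ, hB.a_I]
  have hmean : inner ℝ e τ = 0 := by
    rw [hτ, inner_sub_right, hs.mean_t, hsh.mean_t, sub_zero]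
  have hmeanμ : inner ℝ e μ = 0 := by
    rw [hμ, inner_sub_right, hs.mean_u, hsh.mean_u, sub_zero]
  have hcons : ∀ ψ ∈ Q, inner ℝ (J τ - μ) ψ = lam * inner ℝ (b D) ψ := by
    intro ψ hψ
    have e1 := hs.constitutive ψ trivial
    have e2 := hsh.constitutive ψ hψ
    rw [inner_sub_left] at e1 e2
    rw [hτ, hμ, hD, map_sub, map_sub, inner_sub_left, inner_sub_left, inner_sub_left,
      inner_sub_left]
    linarith
  have hcon : inner ℝ (J τ) e = lam * inner ℝ (b δ) e - lam * (-d) * inner ℝ (b e) e := by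
    have e1 := hcons e heQ
    rw [inner_sub_left, real_inner_comm e μ, hmeanμ, sub_zero] at e1
    rw [e1, hDδ, map_add, map_smul, inner_add_left, real_inner_smul_left]
    ring
  have hsys := hB.abs_add_abs_le hlam hτa hmean hcon
  rw [abs_neg] at hsys
  set s := |κ| + |d| with hs_def
  have hs0 : 0 ≤ s := by positivity
  have hκs : |κ| ≤ s := le_add_of_nonneg_right (abs_nonneg _)
  have hds : |d| ≤ s := le_add_of_nonneg_left (abs_nonneg _)
  have hJδ : ‖J δ‖ ≤ 2 * K ^ 2 * (h * ρ) := by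
    refine (hB.norm_prim_mul_le hB.mul_id hh hQ hδ).trans ?_
    gcongr
  have hJe : ‖J e‖ ≤ K * K :=
    (norm_apply_le hB.norm_J e).trans (mul_le_mul_of_nonneg_left hB.norm_e hK0.le)
  have hkρ : 0 ≤ h * ρ := by positivity
  set σ := ‖S‖ with hσ
  set N := ‖τ‖ with hN
  have hσ0 : 0 ≤ σ := norm_nonneg _
  have hN0 : 0 ≤ N := norm_nonneg _
  have hhσ : 0 ≤ h * σ := by positivity
  have hpow : ∀ {i j : ℕ}, i ≤ j → K ^ i ≤ K ^ j := fun hij => pow_le_pow_right₀ hK hij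
  have hmono : ∀ {i : ℕ} {x : ℝ}, i ≤ 7 → 0 ≤ x → K ^ i * x ≤ K ^ 7 * x := fun hi hx =>
    mul_le_mul_of_nonneg_right (hpow hi) hx
  have hy_le : ‖κ • e - (-d) • J e‖ ≤ K ^ 2 * s := by
    refine (norm_sub_le _ _).trans ?_
    rw [norm_smul, norm_smul, norm_neg, Real.norm_eq_abs, Real.norm_eq_abs]
    have e1 : |κ| * ‖e‖ ≤ |κ| * (K * K) :=
      mul_le_mul_of_nonneg_left (hB.norm_e.trans (le_mul_of_one_le_left hK0.le hK)) (abs_nonneg _)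
    have e2 : |d| * ‖J e‖ ≤ |d| * (K * K) := mul_le_mul_of_nonneg_left hJe (abs_nonneg _)
    calc |κ| * ‖e‖ + |d| * ‖J e‖ ≤ |κ| * (K * K) + |d| * (K * K) := add_le_add e1 e2
      _ = K ^ 2 * s := by rw [hs_def]; ring
  have b1 : σ ≤ K * N + 2 * K ^ 2 * (h * ρ) + K ^ 2 * s := by
    refine hSn.trans ((norm_sub_le _ _).trans ?_)
    have e1 : ‖J D‖ ≤ 2 * K ^ 2 * (h * ρ) + K ^ 2 * s := by
      rw [hDδ, map_add, map_smul]
      refine (norm_add_le _ _).trans (add_le_add hJδ ?_)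
      rw [norm_smul, Real.norm_eq_abs, mul_comm, pow_two]
      exact mul_le_mul hJe hds (abs_nonneg _) (by positivity)
    linarith [norm_apply_le hB.norm_I τ]
  -- Every datum of the system for `κ` and `d` carries a factor `h`: `J δ` by duality, and the
  -- pairings of `S` with `a e`, `a (J e)` and of `δ` with `b e` because `Q` approximates these
  -- vectors.
  have b2 : s ≤ 2 * K ^ 2 * (5 * K ^ 5 * (h * (ρ + σ))) := by
    refine hsys.trans (mul_le_mul_of_nonneg_left ?_ (by positivity))
    have haJ : ‖a (J δ)‖ ≤ K * (2 * K ^ 2 * (h * ρ)) :=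
      (norm_apply_le hB.mul_a.norm_le _).trans (mul_le_mul_of_nonneg_left hJδ hK0.le)
    have k1 : |inner ℝ e (a (J δ))| ≤ K * (K * (2 * K ^ 2 * (h * ρ))) :=
      abs_inner_le hB.norm_e haJ
    have k2 : |inner ℝ (J e) (a (J δ))| ≤ K * K * (K * (2 * K ^ 2 * (h * ρ))) :=
      abs_inner_le hJe haJ
    have k3 : |inner ℝ e (a S)| ≤ K * (h * σ) := by
      rw [← hB.mul_a.symm]
      have := hB.mul_a.abs_inner_le hh hQ hS 1 0
      simp only [one_smul, map_zero, add_zero, abs_one, norm_zero, mul_one] at this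
      linarith
    have k4 : |inner ℝ (J e) (a S)| ≤ K * K * (h * σ) := by
      rw [← hB.mul_a.symm]
      have := hB.mul_a.abs_inner_le hh hQ hS 0 e
      simp only [zero_smul, zero_add, abs_zero] at this
      refine this.trans ?_
      have : h * (K * ‖e‖) * ‖S‖ ≤ h * (K * K) * ‖S‖ := by
        gcongr
        exact hB.norm_e
      linarith
    have k5 : |lam * inner ℝ (b δ) e| ≤ K * (K * (h * ρ)) := by
      rw [abs_mul, abs_of_nonneg hlam]
      refine mul_le_mul hlamK ?_ (abs_nonneg _) hK0.le
      rw [hB.mul_b.symm, real_inner_comm]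
      have := hB.mul_b.abs_inner_le hh hQ hδ 1 0
      simp only [one_smul, map_zero, add_zero, abs_one, norm_zero, mul_one] at this
      refine this.trans ?_
      have : h * K * ‖δ‖ ≤ h * K * ρ := mul_le_mul_of_nonneg_left hδρ (by positivity)
      linarith
    have k6 : |inner ℝ e (a (J δ + S))| ≤ K * (K * (2 * K ^ 2 * (h * ρ))) + K * (h * σ) := by
      rw [map_add, inner_add_right]
      exact (abs_add_le _ _).trans (add_le_add k1 k3)
    have k7 : |inner ℝ (J e) (a (J δ + S))| ≤
        K * K * (K * (2 * K ^ 2 * (h * ρ))) + K * K * (h * σ) := by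
      rw [map_add, inner_add_right]
      exact (abs_add_le _ _).trans (add_le_add k2 k4)
    have m1 : K ^ 4 * (h * ρ) ≤ K ^ 5 * (h * ρ) :=
      mul_le_mul_of_nonneg_right (hpow (by norm_num)) hkρ
    have m2 : K ^ 2 * (h * ρ) ≤ K ^ 5 * (h * ρ) :=
      mul_le_mul_of_nonneg_right (hpow (by norm_num)) hkρ
    have m3 : K ^ 2 * (h * σ) ≤ K ^ 5 * (h * σ) :=
      mul_le_mul_of_nonneg_right (hpow (by norm_num)) hhσ
    have m4 : K ^ 1 * (h * σ) ≤ K ^ 5 * (h * σ) :=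
      mul_le_mul_of_nonneg_right (hpow (by norm_num)) hhσ
    have m5 : 0 ≤ K ^ 5 * (h * σ) := by positivity
    linarith
  -- Coercivity of `I`, with `τ` split through `qt`: the part `qt - th` lies in `Q` and does not see
  -- `S`, so no term in `σ` arises.
  have b3 : N ^ 2 ≤ K * (ρ * (K * N) + (N + ρ) * (K ^ 2 * s + 2 * K ^ 2 * (h * ρ))) := by
    refine (hB.coercive_I τ).trans (mul_le_mul_of_nonneg_left ?_ hK0.le)
    have e1 : inner ℝ τ (I τ) = inner ℝ (t - qt) (I τ) +
        inner ℝ (qt - th) (κ • e - (-d) • J e + J δ) := by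
      have e2 : τ = (t - qt) + (qt - th) := by rw [hτ]; abel
      conv_lhs => rw [e2, inner_add_left]
      rw [← e2]
      congr 1
      rw [hIτ, ← add_assoc, inner_add_right, real_inner_comm S,
        hS _ (Q.sub_mem hqt hsh.mem_t), add_zero]
    rw [e1]
    refine add_le_add ((le_abs_self _).trans (abs_inner_le ht (norm_apply_le hB.norm_I τ)))
      ((le_abs_self _).trans (abs_inner_le ?_ ((norm_add_le _ _).trans (add_le_add hy_le hJδ))))
    have e3 : qt - th = τ - (t - qt) := by rw [hτ]; abel
    rw [e3]
    exact (norm_sub_le _ _).trans (add_le_add le_rfl ht)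
  have b4 : ‖J τ‖ ≤ K * (K * (K ^ 2 * s)) + K * (K * (2 * K ^ 2 * (h * ρ))) +
      2 * K ^ 2 * (h * σ) := by
    have e1 : J τ = J (a (κ • e - (-d) • J e)) + J (a (J δ)) + J (a S) := by
      conv_lhs => rw [hτa]
      simp only [map_add, add_assoc]
    have e2 : ∀ {x : H} {X : ℝ}, ‖x‖ ≤ X → ‖J (a x)‖ ≤ K * (K * X) := fun hx =>
      (norm_apply_le hB.norm_J _).trans (mul_le_mul_of_nonneg_left
        ((norm_apply_le hB.mul_a.norm_le _).trans (mul_le_mul_of_nonneg_left hx hK0.le)) hK0.le)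
    rw [e1]
    refine (norm_add₃_le).trans (add_le_add (add_le_add (e2 hy_le) (e2 hJδ)) ?_)
    exact hB.norm_prim_mul_le hB.mul_a hh hQ hS
  -- Residual of the constitutive law, orthogonal to `Q`. Solving for `μ` expresses `J μ` through `J
  -- τ`, `D` and `J U`, and duality supplies a factor `h` in the last term.
  set U := J τ - μ - lam • b D with hUdef
  have hU : ∀ g ∈ Q, inner ℝ U g = 0 := fun g hg => by
    rw [hUdef, inner_sub_left, hcons g hg, real_inner_smul_left, sub_self]
  have b5 : ‖U‖ ≤ ‖J τ‖ + K * (K * (ρ + K * s)) + ρ := by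
    refine (norm_le_of_orthogonal hU (x := J τ - lam • b D - (u - qu)) (q := uh - qu)
      (Q.sub_mem hsh.mem_u hqu) ?_).trans ?_
    · rw [hUdef, hμ]
      abel
    · refine (norm_sub_le _ _).trans (add_le_add ((norm_sub_le _ _).trans (add_le_add le_rfl ?_)) hu)
      rw [norm_smul, Real.norm_eq_abs, abs_of_nonneg hlam]
      refine mul_le_mul hlamK ?_ (norm_nonneg _) hK0.le
      refine (norm_apply_le hB.mul_b.norm_le _).trans (mul_le_mul_of_nonneg_left ?_ hK0.le)
      rw [hDδ]
      refine (norm_add_le _ _).trans (add_le_add hδρ ?_)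
      rw [norm_smul, Real.norm_eq_abs, mul_comm]
      exact mul_le_mul hB.norm_e hds (abs_nonneg _) hK0.le
  have b6 : ‖J μ‖ ≤ K * ‖J τ‖ + K * (2 * K ^ 2 * (h * ρ)) + K * (s * (K * (K * K))) +
      2 * K ^ 2 * (h * ‖U‖) := by
    have e1 : J μ = J (J τ) - lam • J (b δ) - lam • (d • J (b e)) - J U := by
      have e2 : μ = J τ - lam • b δ - lam • (d • b e) - U := by
        rw [hUdef, hDδ, map_add, map_smul, smul_add]
        abel
      conv_lhs => rw [e2]
      simp only [map_sub, map_smul]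
    rw [e1]
    refine (norm_sub_le _ _).trans (add_le_add ((norm_sub_le _ _).trans (add_le_add
      ((norm_sub_le _ _).trans (add_le_add (norm_apply_le hB.norm_J _) ?_)) ?_)) ?_)
    · rw [norm_smul, Real.norm_eq_abs, abs_of_nonneg hlam]
      refine mul_le_mul hlamK ((hB.norm_prim_mul_le hB.mul_b hh hQ hδ).trans ?_) (norm_nonneg _)
        hK0.le
      gcongr
    · rw [norm_smul, norm_smul, Real.norm_eq_abs, Real.norm_eq_abs, abs_of_nonneg hlam]
      refine mul_le_mul hlamK (mul_le_mul hds ?_ (norm_nonneg _) hs0) (by positivity) hK0.le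
      exact (norm_apply_le hB.norm_J _).trans (mul_le_mul_of_nonneg_left
        ((norm_apply_le hB.mul_b.norm_le _).trans
          (mul_le_mul_of_nonneg_left hB.norm_e hK0.le)) hK0.le)
    · exact hB.norm_prim_mul_le hB.mul_id hh hQ hU
  have hK7 : 1 ≤ 10 * K ^ 7 := by
    have := one_le_pow₀ hK (n := 7)
    linarith
  have hy0 : 0 ≤ ‖J τ‖ := norm_nonneg _
  have hU0 : 0 ≤ h * ‖U‖ := by positivity
  have hsN : 0 ≤ (N + ρ) * s := by positivity
  have hsρ : 0 ≤ (N + ρ) * (h * ρ) := by positivity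
  have hρN : 0 ≤ ρ * N := by positivity
  -- `10 * K ^ 7` dominates the constants in `b1` to `b6`; the largest is `2 K² * 5 K⁵` in `b2`.
  refine error_arithmetic hK7 hh hsmall hρ hN0 hs0 (σ := σ) (υ := ‖U‖) ?_ ?_ ?_ ?_ ?_ ?_
  · have m1 := hmono (i := 1) (by norm_num) hN0
    have m2 := hmono (i := 2) (by norm_num) hkρ
    have m3 := hmono (i := 2) (by norm_num) hs0
    have := hmono (i := 0) (by norm_num) hN0
    have := hmono (i := 0) (by norm_num) hkρ
    have := hmono (i := 0) (by norm_num) hs0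
    linarith
  · linarith
  · have m1 := hmono (i := 2) (by norm_num) hρN
    have m2 := hmono (i := 3) (by norm_num) hsN
    have m3 := hmono (i := 3) (by norm_num) hsρ
    have := hmono (i := 0) (by norm_num) hρN
    have := hmono (i := 0) (by norm_num) hsN
    have := hmono (i := 0) (by norm_num) hsρ
    linarith
  · have m1 := hmono (i := 4) (by norm_num) hs0
    have m2 := hmono (i := 4) (by norm_num) hkρ
    have m3 := hmono (i := 2) (by norm_num) hhσ
    have := hmono (i := 0) (by norm_num) hs0
    have := hmono (i := 0) (by norm_num) hkρ
    have := hmono (i := 0) (by norm_num) hhσ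
    linarith
  · have m1 := hmono (i := 2) (by norm_num) hρ
    have m2 := hmono (i := 3) (by norm_num) hs0
    have := hmono (i := 0) (by norm_num) hy0
    have := hmono (i := 0) (by norm_num) hρ
    have := hmono (i := 0) (by norm_num) hs0
    linarith
  · have m1 := hmono (i := 1) (by norm_num) hy0
    have m2 := hmono (i := 3) (by norm_num) hkρ
    have m3 := hmono (i := 4) (by norm_num) hs0
    have m4 := hmono (i := 2) (by norm_num) hU0
    have := hmono (i := 0) (by norm_num) hy0
    have := hmono (i := 0) (by norm_num) hkρ
    have := hmono (i := 0) (by norm_num) hs0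
    have := hmono (i := 0) (by norm_num) hU0
    linarith

end ErrorEstimate

/-! ### The multiplication operators satisfy the abstract axioms. -/

theorem IsLipschitzMul.mono {H : Type*} [NormedAddCommGroup H] [InnerProductSpace ℝ H] {K K' : ℝ}
    {e : H} {J A : H →L[ℝ] H} (h : IsLipschitzMul K e J A) (hK : K ≤ K') :
    IsLipschitzMul K' e J A where
  norm_le := h.norm_le.trans hK
  symm := h.symm
  primitive c g := by
    obtain ⟨c', g', h1, h2⟩ := h.primitive c g
    exact ⟨c', g', h1, h2.trans (mul_le_mul_of_nonneg_right hK (by positivity))⟩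

theorem inner_mul_operator {a : ℝ → ℝ} {A : L2 L →L[ℝ] L2 L}
    (hA : ∀ f, A f =ᵐ[dom L] fun x => a x * f x) (f g : L2 L) :
    inner ℝ (A f) g = ∫ x, a x * f x * g x ∂(dom L) := by
  rw [inner_L2]
  apply integral_congr_ae
  filter_upwards [hA f] with x hx
  rw [hx]

theorem coercive_mul_operator {a : ℝ → ℝ} {A : L2 L →L[ℝ] L2 L}
    (hA : ∀ f, A f =ᵐ[dom L] fun x => a x * f x) {α : ℝ} (hα : ∀ᵐ x ∂(dom L), α ≤ a x)
    (f : L2 L) : α * ‖f‖ ^ 2 ≤ inner ℝ f (A f) := by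
  rw [inner_L2, L2.norm_sq_eq, ← integral_const_mul]
  refine integral_mono_ae (f.integrable_sq.const_mul α)
    (MemLp.integrable_mul (Lp.memLp _) (Lp.memLp _)) ?_
  filter_upwards [hA f, hα] with x hx h1
  simp only [hx]
  nlinarith [sq_nonneg (f x)]

theorem coeFn_smul_one_add_prim (hL : 0 ≤ L) (c : ℝ) (f : L2 L) :
    (c • one L + prim hL f : L2 L) =ᵐ[dom L] fun x => c + ∫ y in (0 : ℝ)..x, f y := by
  filter_upwards [Lp.coeFn_add (c • one L) (prim hL f), Lp.coeFn_smul c (one L),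
    coeFn_one (L := L), coeFn_prim hL f] with x h1 h2 h3 h4
  rw [h1, Pi.add_apply, h2, Pi.smul_apply, h3, h4]
  simp

/-- By the product rule `a (c + J f)` is again a constant plus a primitive, namely that of `a' (c +
J f) + a f`; one bounded derivative of `a` is enough. -/
theorem isLipschitzMul_of_bddDerivs (hL : 0 < L) {a : ℝ → ℝ} {C : ℝ} (ha : BddDerivs L 1 C a)
    {A : L2 L →L[ℝ] L2 L} (hAn : ‖A‖ ≤ C) (hA : ∀ f, A f =ᵐ[dom L] fun x => a x * f x) :
    IsLipschitzMul (C * (‖one L‖ + L + 1)) (one L) (prim hL.le) A where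
  norm_le := by
    have := ha.nonneg hL
    nlinarith [norm_nonneg (one L)]
  symm f g := by
    rw [inner_mul_operator hA, real_inner_comm, inner_mul_operator hA]
    simp only [mul_right_comm]
  primitive c f := by
    have hC := ha.nonneg hL
    obtain ⟨_, g, a₀, hg, hag⟩ := ha
    obtain ⟨G, hGn, hG⟩ := exists_mul_operator hg.1 hg.2 hC
    have hgi := hg.integrable hL.le
    refine ⟨a₀ * c, G (c • one L + prim hL.le f) + A f, ?_, ?_⟩
    · apply Lp.ext
      refine Filter.EventuallyEq.trans ?_ (coeFn_smul_one_add_prim hL.le _ _).symm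
      filter_upwards [hA (c • one L + prim hL.le f), hag, coeFn_smul_one_add_prim hL.le c f,
        ae_restrict_mem measurableSet_Icc] with x h1 h2 h3 hx
      rw [h1, h2, h3, primitive_mul_primitive hL.le hgi f.integrable a₀ c hx]
      congr 1
      refine primitive_congr (L := L) ?_ ⟨le_rfl, hL.le⟩ hx
      filter_upwards [Lp.coeFn_add (G (c • one L + prim hL.le f)) (A f),
        hG (c • one L + prim hL.le f), hA f, coeFn_smul_one_add_prim hL.le c f, hag]
        with y k1 k2 k3 k4 k5
      rw [k1, Pi.add_apply, k2, k3, k4, k5]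
    · have h1 : ‖c • one L + prim hL.le f‖ ≤ |c| * ‖one L‖ + L * ‖f‖ := by
        refine (norm_add_le _ _).trans (add_le_add ?_ ?_)
        · rw [norm_smul, Real.norm_eq_abs]
        · exact norm_apply_le (norm_prim_le hL.le) f
      have h2 := (norm_apply_le hGn (c • one L + prim hL.le f)).trans
        (mul_le_mul_of_nonneg_left h1 hC)
      have h3 := norm_apply_le hAn f
      refine (norm_add_le _ _).trans ((add_le_add h2 h3).trans ?_)
      have e1 : 0 ≤ C * (|c| * (L + 1)) := by positivity
      have e2 : 0 ≤ C * (‖f‖ * ‖one L‖) := by positivity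
      linarith

theorem norm_sq_smul_one_sub_prim (hL : 0 ≤ L) (κ c : ℝ) :
    ‖κ • one L - c • prim hL (one L)‖ ^ 2 = κ ^ 2 * L - κ * c * L ^ 2 + c ^ 2 * L ^ 3 / 3 := by
  have h1 : inner ℝ (one L) (prim hL (one L)) = L ^ 2 / 2 := by
    have := inner_prim_add hL (one L) (one L)
    rw [real_inner_self_eq_norm_sq, norm_one_sq hL, real_inner_comm] at this
    linarith
  have h2 : ‖prim hL (one L)‖ ^ 2 = L ^ 3 / 3 := by
    rw [L2.norm_sq_eq, integral_congr_ae (g := fun x => x ^ 2), integral_dom hL, integral_pow]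
    · norm_num
    · filter_upwards [coeFn_prim hL (one L), ae_restrict_mem measurableSet_Icc] with x hx hxL
      rw [hx, primitive_congr coeFn_one ⟨le_rfl, hL⟩ hxL]
      simp
  rw [norm_sub_sq_real, norm_smul, norm_smul, mul_pow, mul_pow, norm_one_sq hL, h2,
    real_inner_smul_left, real_inner_smul_right, h1, Real.norm_eq_abs, Real.norm_eq_abs, sq_abs,
    sq_abs]
  ring

/-- Quantitative linear independence of `1` and `x`. The multiple `12 / L³` yields `c²` plus a
square, and `8 / L` yields `κ²` plus a positive definite form. -/
theorem gram_one_prim (hL : 0 < L) (κ c : ℝ) :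
    κ ^ 2 + c ^ 2 ≤ (12 / L ^ 3 + 8 / L) * ‖κ • one L - c • prim hL.le (one L)‖ ^ 2 := by
  rw [norm_sq_smul_one_sub_prim]
  have h : (12 / L ^ 3 + 8 / L) * (κ ^ 2 * L - κ * c * L ^ 2 + c ^ 2 * L ^ 3 / 3) =
      κ ^ 2 + c ^ 2 + (7 * κ ^ 2 - 8 * κ * c * L + 8 / 3 * c ^ 2 * L ^ 2) +
        12 / L ^ 2 * (κ - c * L / 2) ^ 2 := by
    field_simp
    ring
  rw [h]
  have h1 : 0 ≤ 12 / L ^ 2 * (κ - c * L / 2) ^ 2 := by positivity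
  have h2 : 0 ≤ 7 * κ ^ 2 - 8 * κ * c * L + 8 / 3 * c ^ 2 * L ^ 2 := by
    nlinarith [sq_nonneg (7 * κ - 4 * (c * L)), sq_nonneg (c * L)]
  linarith

/-- The multiplication operators of a beam with bounded coefficients. -/
theorem exists_isBeam (hL : 0 < L) {r : ℕ} (hr : 1 ≤ r) (M : ℝ) {α : ℝ} (hα : 0 < α) :
    ∃ K C : ℝ, ∀ Ihat Ahat : ℝ → ℝ, BddDerivs L r M Ihat → BddDerivs L r M Ahat →
      (∀ᵐ x ∂(dom L), α ≤ Ihat x) → (∀ᵐ x ∂(dom L), α ≤ Ahat x) →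
      BddDerivs L r C (fun x => (Ihat x)⁻¹) ∧ BddDerivs L r C (fun x => (Ahat x)⁻¹) ∧
      ∃ I a b : L2 L →L[ℝ] L2 L, (∀ K' ≥ K, IsBeam K' (one L) (prim hL.le) I a b) ∧
        (∀ f, I f =ᵐ[dom L] fun x => Ihat x * f x) ∧
        (∀ f, a f =ᵐ[dom L] fun x => (Ihat x)⁻¹ * f x) ∧
        (∀ f, b f =ᵐ[dom L] fun x => (Ahat x)⁻¹ * f x) := by
  obtain ⟨C, hC⟩ := BddDerivs.exists_inv hL r M hα
  -- A sum dominating every bound required by `IsBeam`. The absolute value is needed because `C ≥ 0`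
  -- is known only once a coefficient is given.
  refine ⟨1 + ‖one L‖ + L + M + |C| * (‖one L‖ + L + 1) + α⁻¹ + (12 / L ^ 3 + 8 / L), C,
    fun Ihat Ahat hI hA hIα hAα => ?_⟩
  have hIi := hC Ihat hI hIα
  have hAi := hC Ahat hA hAα
  have hM := hI.nonneg hL
  have hC0 := hIi.nonneg hL
  have hb0 : ∀ {f : ℝ → ℝ} {B : ℝ}, BddDerivs L r B f →
      ∃ A : L2 L →L[ℝ] L2 L, ‖A‖ ≤ B ∧ ∀ g, A g =ᵐ[dom L] fun x => f x * g x := fun hf =>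
    exists_mul_operator (hf.aestronglyMeasurable hL.le) hf.bound (hf.nonneg hL)
  obtain ⟨I, hIn, hIf⟩ := hb0 hI
  obtain ⟨a, han, haf⟩ := hb0 hIi
  obtain ⟨b, hbn, hbf⟩ := hb0 hAi
  refine ⟨hIi, hAi, I, a, b, fun K' hK' => ?_, hIf, haf, hbf⟩
  rw [abs_of_nonneg hC0] at hK'
  have hone := norm_nonneg (one L)
  have hα' : 0 < α⁻¹ := inv_pos.2 hα
  have hCK : 0 ≤ C * (‖one L‖ + L + 1) := by positivity
  have hGK : 0 ≤ 12 / L ^ 3 + 8 / L := by positivity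
  have hK0 : 0 ≤ K' := by linarith
  have hco : ∀ {f : ℝ → ℝ} {A : L2 L →L[ℝ] L2 L} {β : ℝ}, 0 < β → β⁻¹ ≤ K' →
      (∀ g, A g =ᵐ[dom L] fun x => f x * g x) → (∀ᵐ x ∂(dom L), β ≤ f x) →
      ∀ g, ‖g‖ ^ 2 ≤ K' * inner ℝ g (A g) := by
    intro f A β hβ hβK hA hf g
    have h1 := coercive_mul_operator hA hf g
    have h2 : 0 ≤ inner ℝ g (A g) := le_trans (by positivity) h1
    calc ‖g‖ ^ 2 = β⁻¹ * (β * ‖g‖ ^ 2) := by field_simp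
      _ ≤ β⁻¹ * inner ℝ g (A g) := mul_le_mul_of_nonneg_left h1 (by positivity)
      _ ≤ K' * inner ℝ g (A g) := mul_le_mul_of_nonneg_right hβK h2
  -- The upper bound `M` makes the inverse coefficients coercive; with `M + 1` the denominator is
  -- positive knowing only `0 ≤ M`.
  have hinv : ∀ {f : ℝ → ℝ}, BddDerivs L r M f → (∀ᵐ x ∂(dom L), α ≤ f x) →
      ∀ᵐ x ∂(dom L), (M + 1)⁻¹ ≤ (f x)⁻¹ := by
    intro f hf hfα
    filter_upwards [hf.bound, hfα] with x h1 h2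
    exact inv_anti₀ (by linarith) (by linarith [le_abs_self (f x)])
  exact {
    one_le := by linarith
    norm_e := by linarith
    norm_J := (norm_prim_le hL.le).trans (by linarith)
    norm_I := hIn.trans (by linarith)
    parts := inner_prim_add hL.le
    mul_a := (isLipschitzMul_of_bddDerivs hL (hIi.of_le hL.le hr) han haf).mono (by linarith)
    mul_b := (isLipschitzMul_of_bddDerivs hL (hAi.of_le hL.le hr) hbn hbf).mono (by linarith)
    a_I := fun f => by
      apply Lp.ext
      filter_upwards [haf (I f), hIf f, hIα] with x h1 h2 h3
      rw [h1, h2, inv_mul_cancel_left₀ (by linarith)]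
    coercive_I := hco hα (by linarith) hIf hIα
    coercive_a := hco (β := (M + 1)⁻¹) (by positivity) (by rw [inv_inv]; linarith) haf
      (hinv hI hIα)
    coercive_b := hco (β := (M + 1)⁻¹) (by positivity) (by rw [inv_inv]; linarith) hbf
      (hinv hA hAα)
    gram := fun κ c => (gram_one_prim hL κ c).trans
      (mul_le_mul_of_nonneg_right (by linarith) (sq_nonneg _)) }

/-! ### The elastic beam: regularity and error bound. -/

/-- The mixed formulation of the elastic (memory-free) beam with load `p`. -/
structure IsElasticSolution (Ihat Ahat : ℝ → ℝ) (lam : ℝ) (V : Submodule ℝ (Sobolev L 1))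
    (Q : Submodule ℝ (L2 L)) (p : L2 L) (θ w : Sobolev L 1) (γ : L2 L) : Prop where
  mem_θ : θ ∈ V
  mem_w : w ∈ V
  mem_γ : γ ∈ Q
  momentum : ∀ η ∈ V, ∀ v ∈ V, aForm Ihat θ η + bForm η v γ = loadForm p (fn v)
  constitutive : ∀ ψ ∈ Q, bForm θ w ψ - lam * cForm Ahat γ ψ = 0

theorem loadForm_eq_inner (q v : L2 L) : loadForm q v = inner ℝ q v := (inner_L2 q v).symm

theorem bForm_eq_inner (η v : Sobolev L 1) (γ : L2 L) :
    bForm η v γ = inner ℝ γ (fn η - der v) := by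
  rw [inner_L2]
  apply integral_congr_ae
  filter_upwards [Lp.coeFn_sub (fn η) (der v)] with x hx
  rw [hx, Pi.sub_apply]

theorem aForm_eq_inner {Ihat : ℝ → ℝ} {I : L2 L →L[ℝ] L2 L}
    (hI : ∀ f, I f =ᵐ[dom L] fun x => Ihat x * f x) (θ η : Sobolev L 1) :
    aForm Ihat θ η = inner ℝ (I (der θ)) (der η) := (inner_mul_operator hI _ _).symm

theorem cForm_eq_inner {Ahat : ℝ → ℝ} {b : L2 L →L[ℝ] L2 L}
    (hb : ∀ f, b f =ᵐ[dom L] fun x => (Ahat x)⁻¹ * f x) (γ ψ : L2 L) :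
    cForm Ahat γ ψ = inner ℝ (b γ) ψ := by
  rw [inner_mul_operator hb]
  simp only [cForm, div_eq_inv_mul]

/-- Testing with `(0, v)` and `(η, 0)` separates shear and moment equations. Since test functions
are primitives of their derivatives, and these exhaust the mean-zero part of `Q`, only derivatives
remain. -/
theorem IsElasticSolution.isStaticSolution (hL : 0 < L) {Ihat Ahat : ℝ → ℝ} {lam : ℝ}
    {V : Submodule ℝ (Sobolev L 1)} {Q : Submodule ℝ (L2 L)} {p : L2 L} {θ w : Sobolev L 1}
    {γ : L2 L} (hs : IsElasticSolution Ihat Ahat lam V Q p θ w γ) (hV : V ≤ H10 L)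
    (hVQ : ∀ u ∈ V, der u ∈ Q) (hQV : ∀ q ∈ Q, inner ℝ (one L) q = 0 → ∃ u ∈ V, der u = q)
    {I b : L2 L →L[ℝ] L2 L} (hI : ∀ f, I f =ᵐ[dom L] fun x => Ihat x * f x)
    (hb : ∀ f, b f =ᵐ[dom L] fun x => (Ahat x)⁻¹ * f x) :
    IsStaticSolution (one L) (prim hL.le) I b lam p Q (der θ) (der w) γ where
  mem_t := hVQ θ hs.mem_θ
  mem_u := hVQ w hs.mem_w
  mem_γ := hs.mem_γ
  mean_t := (fn_eq_prim_of_mem_H10 hL (hV hs.mem_θ)).2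
  mean_u := (fn_eq_prim_of_mem_H10 hL (hV hs.mem_w)).2
  shear g hg hg0 := by
    obtain ⟨v, hv, rfl⟩ := hQV g hg hg0
    have h := hs.momentum 0 V.zero_mem v hv
    rw [aForm_eq_inner hI, bForm_eq_inner, loadForm_eq_inner,
      (fn_eq_prim_of_mem_H10 hL (hV hv)).1, fn_zero, show der (0 : Sobolev L 1) = 0 from rfl,
      inner_zero_right, zero_sub, inner_neg_right] at h
    linarith
  moment g hg hg0 := by
    obtain ⟨η, hη, rfl⟩ := hQV g hg hg0
    have h := hs.momentum η hη 0 V.zero_mem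
    rw [aForm_eq_inner hI, bForm_eq_inner, loadForm_eq_inner,
      (fn_eq_prim_of_mem_H10 hL (hV hη)).1, fn_zero, show der (0 : Sobolev L 1) = 0 from rfl,
      inner_zero_right, sub_zero] at h
    exact h
  constitutive ψ hψ := by
    have h := hs.constitutive ψ hψ
    rw [bForm_eq_inner, cForm_eq_inner hb, (fn_eq_prim_of_mem_H10 hL (hV hs.mem_θ)).1,
      real_inner_comm] at h
    linarith

/-- Regularity of the solution of the elastic problem, uniformly in the thickness. -/
theorem exists_regularity (hL : 0 < L) (r : ℕ) (K C : ℝ) :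
    ∃ C' : ℝ, ∀ {Ihat Ahat : ℝ → ℝ} {I a b : L2 L →L[ℝ] L2 L},
      BddDerivs L (r + 1) C (fun x => (Ihat x)⁻¹) → BddDerivs L (r + 1) C (fun x => (Ahat x)⁻¹) →
      IsBeam K (one L) (prim hL.le) I a b →
      (∀ f, a f =ᵐ[dom L] fun x => (Ihat x)⁻¹ * f x) →
      (∀ f, b f =ᵐ[dom L] fun x => (Ahat x)⁻¹ * f x) →
      ∀ {lam : ℝ}, 0 ≤ lam → lam ≤ K → ∀ (p : Sobolev L (r + 1)) {t u γ : L2 L},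
      IsStaticSolution (one L) (prim hL.le) I b lam (fn p) ⊤ t u γ →
      BddDerivs L (r + 1) (C' * ‖p‖) t ∧ BddDerivs L (r + 1) (C' * ‖p‖) u ∧
        BddDerivs L (r + 1) (C' * ‖p‖) γ := by
  set C₀ := (1 + L) / ‖one L‖ + ‖one L‖ with hC₀
  set Cγ := 6 * K ^ 7 + (1 + L) * C₀ with hCγ
  set Cz := 6 * K ^ 7 + (1 + L) * Cγ with hCz
  set Ct := 2 ^ (r + 1) * (C * Cz) with hCt
  set Cb := 2 ^ (r + 1) * (K * (2 ^ (r + 1) * (C * Cγ))) with hCb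
  set Cu := (1 + L) * Ct + Cb with hCu
  refine ⟨|Cγ| + |Ct| + |Cu|, ?_⟩
  intro Ihat Ahat I a b hIi hAi hB ha hb lam hlam hlamK p t u γ hs
  obtain ⟨z₀, γ₀, hzγ, hγe, hte, hue⟩ := hB.exists_explicit hlam hlamK hs
  have hp : ‖fn p‖ ≤ ‖p‖ :=
    PiLp.norm_apply_le (p : PiLp 2 fun _ : Fin (r + 1 + 1) => L2 L) 0
  have hK := hB.one_le
  have hzγ' : |z₀| + |γ₀| ≤ 6 * K ^ 7 * ‖p‖ :=
    hzγ.trans (mul_le_mul_of_nonneg_left hp (by positivity))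
  have hγ : BddDerivs L (r + 1) (Cγ * ‖p‖) γ := by
    -- The Sobolev embedding costs one derivative of `p` and the primitive wins it back; the later
    -- steps all keep order `r + 1`.
    have h1 := (Sobolev.bddDerivs hL p).primitive hL (c := γ₀) (C := 6 * K ^ 7 * ‖p‖)
      (by linarith [abs_nonneg z₀])
    rw [hγe]
    exact (h1.congr (coeFn_smul_one_add_prim hL.le _ _).symm).mono (le_of_eq (by rw [hCγ]; ring))
  have hz : BddDerivs L (r + 1) (Cz * ‖p‖) (I t) := by
    have h1 := hγ.primitive hL (c := z₀) (C := 6 * K ^ 7 * ‖p‖) (by linarith [abs_nonneg γ₀])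
    rw [hte]
    exact ((h1.of_succ hL.le).congr (coeFn_smul_one_add_prim hL.le _ _).symm).mono
      (le_of_eq (by rw [hCz]; ring))
  have ht : BddDerivs L (r + 1) (Ct * ‖p‖) t := by
    have h1 := (hIi.mul hL hz).congr (ha (I t)).symm
    rw [hB.a_I] at h1
    exact h1.mono (le_of_eq (by rw [hCt]; ring))
  have hu : BddDerivs L (r + 1) (Cu * ‖p‖) u := by
    have h1 := (ht.primitive hL (c := 0) (C := 0) (by simp)).of_succ hL.le
    have h2 := ((BddDerivs.const (k := r + 1) (L := L) (c := lam) (B := K)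
      (by rwa [abs_of_nonneg hlam])).mul hL (hAi.mul hL hγ)).neg
    refine ((h1.add hL.le h2).congr ?_).mono (le_of_eq (by rw [hCu, hCb]; ring))
    rw [hue]
    filter_upwards [Lp.coeFn_sub (prim hL.le t) (lam • b γ), Lp.coeFn_smul lam (b γ), hb γ,
      coeFn_prim hL.le t] with x k1 k2 k3 k4
    rw [k1, Pi.sub_apply, k2, Pi.smul_apply, k3, k4, smul_eq_mul]
    ring
  have hP := norm_nonneg p
  refine ⟨ht.mono ?_, hu.mono ?_, hγ.mono ?_⟩ <;> refine mul_le_mul_of_nonneg_right ?_ hP <;>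
    linarith [le_abs_self Ct, le_abs_self Cu, le_abs_self Cγ, abs_nonneg Ct, abs_nonneg Cu,
      abs_nonneg Cγ]

/-- Optimal order `L²` error estimate for the elastic beam, uniform in the thickness and in the
mesh. -/
theorem exists_elastic_error_bound (hL : 0 < L) {r : ℕ} (hr : 1 ≤ r) (M Λ : ℝ) {α : ℝ}
    (hα : 0 < α) :
    ∃ C : ℝ, 0 < C ∧ ∀ Ihat Ahat : ℝ → ℝ, BddDerivs L r M Ihat → BddDerivs L r M Ahat →
      (∀ᵐ x ∂(dom L), α ≤ Ihat x) → (∀ᵐ x ∂(dom L), α ≤ Ahat x) →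
      ∀ lam : ℝ, 0 ≤ lam → lam ≤ Λ → ∀ (m : Mesh L) (p : Sobolev L r)
        (θ w : Sobolev L 1) (γ : L2 L) (θh wh : Sobolev L 1) (γh : L2 L),
        IsElasticSolution Ihat Ahat lam (H10 L) ⊤ (fn p) θ w γ →
        IsElasticSolution Ihat Ahat lam (Vh m r) (Qh m r) (fn p) θh wh γh →
        ‖fn θ - fn θh‖ ≤ C * m.h ^ (r + 1) * ‖p‖ ∧ ‖fn w - fn wh‖ ≤ C * m.h ^ (r + 1) * ‖p‖ := by
  obtain ⟨K₀, C₀, hKC⟩ := exists_isBeam hL hr M hα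
  set K := |K₀| + |Λ| + 1 with hKdef
  have hK1 : 1 ≤ K := by linarith [abs_nonneg K₀, abs_nonneg Λ]
  obtain ⟨k, rfl⟩ : ∃ k, r = k + 1 := ⟨r - 1, by omega⟩
  obtain ⟨C₁, hC₁⟩ := exists_regularity hL k K C₀
  obtain ⟨X, hX⟩ : ∃ X, X = 10 * K ^ 7 := ⟨_, rfl⟩
  have hX1 : 1 ≤ X := by
    rw [hX]
    linarith [one_le_pow₀ hK1 (n := 7)]
  have hX0 : 0 < X := by linarith
  obtain ⟨F, hF⟩ : ∃ F, F = 20 * X ^ 3 := ⟨_, rfl⟩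
  have hFpos : 0 < F := by rw [hF]; positivity
  obtain ⟨G, hG⟩ : ∃ G, G = 72 * X ^ 6 := ⟨_, rfl⟩
  have hGpos : 0 < G := by rw [hG]; positivity
  have hG1 : 25 * X ^ 4 ≤ G := by
    have h1 := pow_le_pow_right₀ hX1 (show 4 ≤ 6 by norm_num)
    have h2 : 0 ≤ X ^ 6 := by positivity
    rw [hG]
    linarith
  refine ⟨4 * K ^ 6 * F ^ (k + 1 + 1) + G * (|C₁| * ‖one L‖), by positivity, ?_⟩
  intro Ihat Ahat hI hA hIα hAα lam hlam hlamΛ m p θ w γ θh wh γh hs hsh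
  obtain ⟨hIi, hAi, I, a, b, hB', hIf, haf, hbf⟩ := hKC Ihat Ahat hI hA hIα hAα
  have hB := hB' K (by linarith [le_abs_self K₀, abs_nonneg Λ])
  have hlamK : lam ≤ K := by linarith [le_abs_self Λ, abs_nonneg K₀]
  have hst := hs.isStaticSolution hL le_rfl (fun _ _ => trivial)
    (fun q _ hq => exists_mem_H10_der_eq hL hq) hIf hbf
  have hsth := hsh.isStaticSolution hL (fun u hu => hu.1) (fun u hu => der_mem_Qh hL hu)
    (fun q hq hq0 => exists_mem_Vh_der_eq hL hq hq0) hIf hbf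
  have hp : ‖fn p‖ ≤ ‖p‖ :=
    PiLp.norm_apply_le (p : PiLp 2 fun _ : Fin (k + 1 + 1) => L2 L) 0
  have hp0 := norm_nonneg p
  have hh := m.h_pos hL
  rw [(fn_eq_prim_of_mem_H10 hL hs.mem_θ).1, (fn_eq_prim_of_mem_H10 hL hs.mem_w).1,
    (fn_eq_prim_of_mem_H10 hL hsh.mem_θ.1).1, (fn_eq_prim_of_mem_H10 hL hsh.mem_w.1).1]
  have hsplit : 0 ≤ 4 * K ^ 6 * F ^ (k + 1 + 1) * m.h ^ (k + 1 + 1) * ‖p‖ ∧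
      0 ≤ G * (|C₁| * ‖one L‖) * m.h ^ (k + 1 + 1) * ‖p‖ := ⟨by positivity, by positivity⟩
  -- If `F h ≤ 1` the superconvergent estimate applies. Otherwise `(F h)^(r + 1) ≥ 1`, and stability
  -- of both solutions already gives the bound.
  rcases le_or_gt (F * m.h) 1 with hsmall | hlarge
  · obtain ⟨rt, ru, rγ⟩ := hC₁ hIi hAi hB haf hbf hlam hlamK p hst
    obtain ⟨qt, hqt, hqt'⟩ := exists_mem_Qh_norm_sub_le hL m rt
    obtain ⟨qu, hqu, hqu'⟩ := exists_mem_Qh_norm_sub_le hL m ru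
    obtain ⟨qγ, hqγ, hqγ'⟩ := exists_mem_Qh_norm_sub_le hL m rγ
    obtain ⟨e1, e2⟩ := hB.error_le hlam hlamK hst hsth (one_mem_Qh m hr) hh.le
      (exists_mem_Qh_norm_primitive_sub_le hL m hr) (by rwa [← hX, ← hF]) hqt hqu hqγ hqt' hqu' hqγ'
    rw [← hX] at e1 e2
    rw [← hG] at e2
    have hle : m.h * (m.h ^ (k + 1) * (C₁ * ‖p‖ * ‖one L‖)) ≤
        m.h * (m.h ^ (k + 1) * (|C₁| * ‖p‖ * ‖one L‖)) := by
      gcongr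
      exact le_abs_self _
    have hnn : 0 ≤ m.h * (m.h ^ (k + 1) * (|C₁| * ‖p‖ * ‖one L‖)) := by positivity
    rw [← map_sub, ← map_sub]
    have key : G * (m.h * (m.h ^ (k + 1) * (|C₁| * ‖p‖ * ‖one L‖))) ≤
        (4 * K ^ 6 * F ^ (k + 1 + 1) + G * (|C₁| * ‖one L‖)) * m.h ^ (k + 1 + 1) * ‖p‖ := by
      have : G * (m.h * (m.h ^ (k + 1) * (|C₁| * ‖p‖ * ‖one L‖))) =
          G * (|C₁| * ‖one L‖) * m.h ^ (k + 1 + 1) * ‖p‖ := by ring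
      linarith [hsplit.1]
    constructor
    · exact e1.trans ((mul_le_mul_of_nonneg_left hle (by positivity)).trans
        ((mul_le_mul_of_nonneg_right hG1 hnn).trans key))
    · exact e2.trans ((mul_le_mul_of_nonneg_left hle hGpos.le).trans key)
  · obtain ⟨s1, s2⟩ := hB.stability hlam hlamK hst
    obtain ⟨s3, s4⟩ := hB.stability hlam hlamK hsth
    have hone : 1 ≤ F ^ (k + 1 + 1) * m.h ^ (k + 1 + 1) := by
      rw [← mul_pow]
      exact one_le_pow₀ hlarge.le
    have key : 4 * K ^ 6 * ‖fn p‖ ≤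
        (4 * K ^ 6 * F ^ (k + 1 + 1) + G * (|C₁| * ‖one L‖)) * m.h ^ (k + 1 + 1) * ‖p‖ := by
      have h1 : 4 * K ^ 6 * ‖fn p‖ ≤
          4 * K ^ 6 * ‖p‖ * (F ^ (k + 1 + 1) * m.h ^ (k + 1 + 1)) :=
        (mul_le_mul_of_nonneg_left hp (by positivity)).trans
          (le_mul_of_one_le_right (by positivity) hone)
      linarith [hsplit.2]
    have h56 : K ^ 5 * ‖fn p‖ ≤ K ^ 6 * ‖fn p‖ :=
      mul_le_mul_of_nonneg_right (pow_le_pow_right₀ hK1 (by norm_num)) (norm_nonneg _)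
    constructor
    · exact (norm_sub_le _ _).trans (by linarith)
    · exact (norm_sub_le _ _).trans (by linarith)

/-! ### Volterra equations of convolution type in `L¹`. -/

section Volterra

variable {X : Type*} [NormedAddCommGroup X] [NormedSpace ℝ X]

theorem integrable_convolution_smul {k : ℝ → ℝ} (hk : Integrable k) {f : ℝ → X}
    (hf : Integrable f) : Integrable fun t => ∫ s, k (t - s) • f s :=
  hf.integrable_convolution (ContinuousLinearMap.lsmul ℝ ℝ).flip hk

theorem ae_integrable_smul_sub {k : ℝ → ℝ} (hk : Integrable k) {f : ℝ → X}
    (hf : Integrable f) : ∀ᵐ t, Integrable fun s => k (t - s) • f s :=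
  hf.ae_convolution_exists (ContinuousLinearMap.lsmul ℝ ℝ).flip hk

/-- Young's inequality for the convolution of two integrable functions. -/
theorem integral_norm_convolution_smul_le {k : ℝ → ℝ} (hk : Integrable k) {f : ℝ → X}
    (hf : Integrable f) :
    ∫ t, ‖∫ s, k (t - s) • f s‖ ≤ (∫ t, |k t|) * ∫ t, ‖f t‖ := by
  have h1 := integral_convolution (ContinuousLinearMap.mul ℝ ℝ) hf.norm hk.norm
    (μ := volume) (ν := volume)
  have h2 : ∫ x, (convolution (fun t => ‖f t‖) (fun t => ‖k t‖) (ContinuousLinearMap.mul ℝ ℝ)) x =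
      (∫ t, |k t|) * ∫ t, ‖f t‖ := by
    rw [h1, mul_comm]
    rfl
  rw [← h2]
  refine integral_mono (integrable_convolution_smul hk hf).norm
    (hf.norm.integrable_convolution _ hk.norm) fun t => ?_
  refine (norm_integral_le_integral_norm _).trans (le_of_eq ?_)
  simp only [convolution, norm_smul, mul_comm, ContinuousLinearMap.mul_apply']

/-- Convolution equations with a small kernel are solvable in `L¹`. -/
theorem exists_solution_of_small_kernel [CompleteSpace X] {k : ℝ → ℝ} (hk : Integrable k)
    (hk1 : ∫ t, |k t| ≤ 1 / 2) {D : Set ℝ} (hD : MeasurableSet D) {q : ℝ → X}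
    (hq : Integrable q) :
    ∃ p : ℝ → X, Integrable p ∧ (∀ᵐ t, p t = q t + ∫ s, k (t - s) • D.indicator p s) ∧
      ∫ t, ‖p t‖ ≤ 2 * ∫ t, ‖q t‖ := by
  have hind : ∀ f : Lp X 1 (volume : Measure ℝ), Integrable (D.indicator f) := fun f =>
    (L1.integrable_coeFn f).indicator hD
  have hΦ : ∀ f : Lp X 1 (volume : Measure ℝ),
      Integrable fun t => q t + ∫ s, k (t - s) • D.indicator f s := fun f =>
    hq.add (integrable_convolution_smul hk (hind f))
  -- By Young's inequality `Ψ` contracts `L¹` with factor `1 / 2`; its fixed point is the solution.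
  let Ψ : Lp X 1 (volume : Measure ℝ) → Lp X 1 (volume : Measure ℝ) := fun f => (hΦ f).toL1 _
  have hΨ : ∀ f, Ψ f =ᵐ[volume] fun t => q t + ∫ s, k (t - s) • D.indicator f s := fun f =>
    (hΦ f).coeFn_toL1
  have hbound : ∀ g : ℝ → X, Integrable g →
      ∫ t, ‖∫ s, k (t - s) • D.indicator g s‖ ≤ 1 / 2 * ∫ t, ‖g t‖ := by
    intro g hg
    refine (integral_norm_convolution_smul_le hk (hg.indicator hD)).trans ?_
    refine mul_le_mul hk1 ?_ (integral_nonneg fun _ => norm_nonneg _) (by norm_num)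
    exact integral_mono (hg.indicator hD).norm hg.norm fun t => norm_indicator_le_norm_self _ _
  have hcontr : ContractingWith (1 / 2) Ψ := by
    refine ⟨by rw [← NNReal.coe_lt_coe]; norm_num, LipschitzWith.of_dist_le_mul fun f g => ?_⟩
    rw [dist_eq_norm, dist_eq_norm, L1.norm_eq_integral_norm, L1.norm_eq_integral_norm]
    have h1 : ∫ t, ‖(Ψ f - Ψ g) t‖ = ∫ t, ‖∫ s, k (t - s) • D.indicator (f - g : Lp X 1 volume) s‖ := by
      apply integral_congr_ae
      filter_upwards [Lp.coeFn_sub (Ψ f) (Ψ g), hΨ f, hΨ g, ae_integrable_smul_sub hk (hind f),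
        ae_integrable_smul_sub hk (hind g)] with t h1 h2 h3 h4 h5
      rw [h1, Pi.sub_apply, h2, h3, add_sub_add_left_eq_sub, ← integral_sub h4 h5]
      congr 1
      apply integral_congr_ae
      filter_upwards [Lp.coeFn_sub f g] with s hs
      by_cases hsD : s ∈ D
      · simp only [Set.indicator_of_mem hsD, hs, Pi.sub_apply, smul_sub]
      · simp only [Set.indicator_of_notMem hsD, smul_zero, sub_zero]
    rw [h1]
    refine (hbound _ (L1.integrable_coeFn _)).trans (le_of_eq ?_)
    simp
  obtain ⟨p, hp⟩ : ∃ p, Ψ p = p := ⟨_, hcontr.fixedPoint_isFixedPt⟩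
  have hpe : ∀ᵐ t, p t = q t + ∫ s, k (t - s) • D.indicator p s := by
    have := hΨ p
    rwa [hp] at this
  refine ⟨p, L1.integrable_coeFn p, hpe, ?_⟩
  have h1 : ∫ t, ‖p t‖ ≤ (∫ t, ‖q t‖) + 1 / 2 * ∫ t, ‖p t‖ := by
    refine le_trans ?_ (add_le_add_right (hbound p (L1.integrable_coeFn p)) _)
    rw [← integral_add hq.norm (integrable_convolution_smul hk (hind p)).norm]
    refine integral_mono_ae (L1.integrable_coeFn p).norm
      (hq.norm.add (integrable_convolution_smul hk (hind p)).norm) ?_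
    filter_upwards [hpe] with t ht
    conv_lhs => rw [ht]
    exact norm_add_le _ _
  linarith

/-- The Volterra equation of convolution type is solvable in `L¹(0, T; X)`. -/
theorem exists_volterra_solution [CompleteSpace X] {T : ℝ} {κ : ℝ → ℝ}
    (hκ : ContinuousOn κ (Set.Icc 0 T)) :
    ∃ C : ℝ, 0 ≤ C ∧ ∀ q : ℝ → X, Integrable q (dom T) →
      ∃ p : ℝ → X, Integrable p (dom T) ∧
        (∀ᵐ t ∂(dom T), p t = q t + ∫ s in (0 : ℝ)..t, κ (t - s) • p s) ∧
        ∫ t, ‖p t‖ ∂(dom T) ≤ C * ∫ t, ‖q t‖ ∂(dom T) := by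
  obtain ⟨M₀, hM₀⟩ := isCompact_Icc.exists_bound_of_continuousOn hκ
  obtain ⟨M, hM, hM1⟩ : ∃ M, (∀ t ∈ Set.Icc 0 T, ‖κ t‖ ≤ M) ∧ 0 < M :=
    ⟨|M₀| + 1, fun t ht => (hM₀ t ht).trans (by linarith [le_abs_self M₀]), by positivity⟩
  -- The weight `e^{-c t}` preserves the convolution form, as `e^{-c t} = e^{-c (t - s)} e^{-c s}`,
  -- and gives the kernel an `L¹` norm of at most `M / c = 1 / 2`. The price is the factor `e^{c T}`
  -- when the weight is undone.
  set c := 2 * M with hc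
  have hc0 : 0 < c := by positivity
  set k : ℝ → ℝ := (Set.Icc 0 T).indicator fun t => Real.exp (-(c * t)) * κ t with hk
  have hexp : Continuous fun t : ℝ => Real.exp (-(c * t)) := by fun_prop
  have hki : Integrable k := by
    rw [hk, integrable_indicator_iff measurableSet_Icc]
    exact (hexp.continuousOn.mul hκ).integrableOn_compact isCompact_Icc
  have hk1 : ∫ t, |k t| ≤ 1 / 2 := by
    have e0 : IntegrableOn (fun t => M * Real.exp (-c * t)) (Set.Ioi 0) :=
      (integrableOn_exp_mul_Ioi (by linarith) 0).const_mul M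
    calc ∫ t, |k t| ≤ ∫ t, (Set.Ici (0 : ℝ)).indicator (fun t => M * Real.exp (-c * t)) t := by
          refine integral_mono hki.abs ?_ fun t => ?_
          · rw [integrable_indicator_iff measurableSet_Ici, integrableOn_Ici_iff_integrableOn_Ioi]
            exact e0
          · by_cases ht : t ∈ Set.Icc 0 T
            · simp only [hk]
              rw [Set.indicator_of_mem ht, Set.indicator_of_mem (show t ∈ Set.Ici 0 from ht.1),
                abs_mul, abs_of_pos (Real.exp_pos _), mul_comm, neg_mul]
              exact mul_le_mul_of_nonneg_right (hM t ht) (Real.exp_pos _).le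
            · simp only [hk]
              rw [Set.indicator_of_notMem ht, abs_zero]
              exact Set.indicator_nonneg (fun _ _ => by positivity) _
      _ = ∫ t in Set.Ioi 0, M * Real.exp (-c * t) := by
          rw [integral_indicator measurableSet_Ici, integral_Ici_eq_integral_Ioi]
      _ = 1 / 2 := by
          rw [integral_const_mul, integral_exp_mul_Ioi (by linarith)]
          simp [hc]
          field_simp
  refine ⟨Real.exp (c * T) * 2, by positivity, fun q hq => ?_⟩
  have hqi : Integrable ((Set.Icc 0 T).indicator fun t => Real.exp (-(c * t)) • q t) := by
    rw [integrable_indicator_iff measurableSet_Icc]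
    exact IntegrableOn.continuousOn_smul hq hexp.continuousOn isCompact_Icc
  obtain ⟨p, hpi, hp, hpn⟩ := exists_solution_of_small_kernel hki hk1
    (measurableSet_Icc (a := (0 : ℝ)) (b := T)) hqi
  have hexp' : Continuous fun t : ℝ => Real.exp (c * t) := by fun_prop
  have hP : Integrable (fun t => Real.exp (c * t) • p t) (dom T) :=
    IntegrableOn.continuousOn_smul hpi.integrableOn hexp'.continuousOn isCompact_Icc
  refine ⟨fun t => Real.exp (c * t) • p t, hP, ?_, ?_⟩
  · rw [ae_dom_iff]
    filter_upwards [hp] with t ht htT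
    rw [ht, Set.indicator_of_mem htT, smul_add, smul_smul, ← Real.exp_add, add_neg_cancel,
      Real.exp_zero, one_smul, ← integral_smul]
    congr 1
    rw [intervalIntegral.integral_of_le htT.1, ← integral_Icc_eq_integral_Ioc,
      ← integral_indicator measurableSet_Icc]
    congr 1
    ext s
    by_cases hs : s ∈ Set.Icc 0 t
    · have h1 : s ∈ Set.Icc 0 T := ⟨hs.1, hs.2.trans htT.2⟩
      have h2 : t - s ∈ Set.Icc 0 T := ⟨by linarith [hs.2], by linarith [hs.1, htT.2]⟩
      rw [Set.indicator_of_mem hs, Set.indicator_of_mem h1, hk, Set.indicator_of_mem h2, smul_smul,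
        smul_smul, ← mul_assoc, ← Real.exp_add, mul_comm (κ _)]
      congr 3
      ring
    · rw [Set.indicator_of_notMem hs]
      by_cases h1 : s ∈ Set.Icc 0 T
      · have h2 : t - s ∉ Set.Icc 0 T := fun h => hs ⟨h1.1, by linarith [h.1]⟩
        rw [hk, Set.indicator_of_notMem h2, zero_smul, smul_zero]
      · rw [Set.indicator_of_notMem h1, smul_zero, smul_zero]
  · have h1 : ∫ t, ‖Real.exp (c * t) • p t‖ ∂(dom T) ≤ Real.exp (c * T) * ∫ t, ‖p t‖ := by
      calc ∫ t, ‖Real.exp (c * t) • p t‖ ∂(dom T)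
          ≤ ∫ t, Real.exp (c * T) * ‖p t‖ ∂(dom T) := by
            refine integral_mono_ae hP.norm (hpi.integrableOn.norm.const_mul _) ?_
            filter_upwards [ae_restrict_mem measurableSet_Icc] with t ht
            rw [norm_smul, Real.norm_eq_abs, abs_of_pos (Real.exp_pos _)]
            refine mul_le_mul_of_nonneg_right (Real.exp_le_exp.2 ?_) (norm_nonneg _)
            exact mul_le_mul_of_nonneg_left ht.2 hc0.le
        _ ≤ Real.exp (c * T) * ∫ t, ‖p t‖ := by
            rw [integral_const_mul]
            refine mul_le_mul_of_nonneg_left ?_ (Real.exp_pos _).le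
            exact setIntegral_le_integral hpi.norm (Filter.Eventually.of_forall fun _ => norm_nonneg _)
    have h2 : ∫ t, ‖(Set.Icc 0 T).indicator (fun t => Real.exp (-(c * t)) • q t) t‖ ≤
        ∫ t, ‖q t‖ ∂(dom T) := by
      rw [← integral_indicator measurableSet_Icc]
      refine integral_mono hqi.norm ((integrable_indicator_iff measurableSet_Icc).2 hq.norm)
        fun t => ?_
      by_cases ht : t ∈ Set.Icc 0 T
      · simp only [Set.indicator_of_mem ht]
        rw [norm_smul, Real.norm_eq_abs, abs_of_pos (Real.exp_pos _)]
        refine mul_le_of_le_one_left (norm_nonneg _) (Real.exp_le_one_iff.2 ?_)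
        have := mul_nonneg hc0.le ht.1
        linarith
      · simp only [Set.indicator_of_notMem ht, norm_zero, le_refl]
    calc ∫ t, ‖Real.exp (c * t) • p t‖ ∂(dom T) ≤ Real.exp (c * T) * ∫ t, ‖p t‖ := h1
      _ ≤ Real.exp (c * T) * (2 * ∫ t, ‖q t‖ ∂(dom T)) :=
          mul_le_mul_of_nonneg_left (hpn.trans (mul_le_mul_of_nonneg_left h2 (by norm_num)))
            (Real.exp_pos _).le
      _ = _ := by ring

/-- Uniqueness for the Volterra equation. -/
theorem ae_eq_zero_of_volterra {T : ℝ} (hT : 0 ≤ T) {κ : ℝ → ℝ}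
    (hκ : ContinuousOn κ (Set.Icc 0 T)) {D : ℝ → X} (hD : Integrable D (dom T))
    (h : ∀ᵐ t ∂(dom T), D t = ∫ s in (0 : ℝ)..t, κ (t - s) • D s) : ∀ᵐ t ∂(dom T), D t = 0 := by
  obtain ⟨M, hM⟩ := isCompact_Icc.exists_bound_of_continuousOn hκ
  have hu : Integrable (fun t => ‖D t‖) (dom T) := hD.norm
  have hle : ∀ᵐ t ∂(dom T), ‖D t‖ ≤ M * ∫ s in (0 : ℝ)..t, ‖D s‖ := by
    filter_upwards [h, ae_restrict_mem measurableSet_Icc] with t ht htT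
    conv_lhs => rw [ht]
    refine (intervalIntegral.norm_integral_le_integral_norm htT.1).trans ?_
    rw [← intervalIntegral.integral_const_mul]
    have hi : IntervalIntegrable (fun s => ‖D s‖) volume 0 t :=
      intervalIntegrable_of_dom hu ⟨le_rfl, hT⟩ htT
    have hmem : ∀ s ∈ Set.Icc 0 t, t - s ∈ Set.Icc 0 T := fun s hs =>
      ⟨by linarith [hs.2], by linarith [hs.1, htT.2]⟩
    refine intervalIntegral.integral_mono_on htT.1 ?_ (hi.const_mul M) fun s hs => ?_
    · simp only [norm_smul]
      refine hi.continuousOn_mul ?_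
      rw [Set.uIcc_of_le htT.1]
      exact (hκ.comp (by fun_prop) hmem).norm
    · rw [norm_smul]
      exact mul_le_mul_of_nonneg_right (hM _ (hmem s hs)) (norm_nonneg _)
  have hexp : Continuous fun t : ℝ => -M * Real.exp (-M * t) := by fun_prop
  have hei : Integrable (fun t : ℝ => -M * Real.exp (-M * t)) (dom T) :=
    hexp.continuousOn.integrableOn_compact isCompact_Icc
  have hprim : ∀ x : ℝ, 1 + ∫ y in (0 : ℝ)..x, -M * Real.exp (-M * y) = Real.exp (-M * x) := by
    intro x
    rw [intervalIntegral.integral_eq_sub_of_hasDerivAt (f := fun y => Real.exp (-M * y))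
      (fun y _ => ?_) (hexp.intervalIntegrable _ _)]
    · simp
    · have := ((hasDerivAt_id y).const_mul (-M)).exp
      simpa [mul_comm] using this
  -- Grönwall in integrated form: `e^{-M t} ∫₀ᵗ ‖D‖` vanishes at `0` and by `hle` has nonpositive
  -- derivative, so its value at `T` is at most zero.
  have key := primitive_mul_primitive hT hei hu 1 0 (x := T) ⟨hT, le_rfl⟩
  simp only [hprim, zero_add, mul_zero] at key
  have hle2 : ∫ y in (0 : ℝ)..T, (-M * Real.exp (-M * y) * (∫ z in (0 : ℝ)..y, ‖D z‖) +
      Real.exp (-M * y) * ‖D y‖) ≤ 0 := by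
    rw [← integral_dom hT]
    refine integral_nonpos_of_ae ?_
    filter_upwards [hle] with y hy
    have := mul_le_mul_of_nonneg_left hy (Real.exp_pos (-M * y)).le
    simp only [Pi.zero_apply]
    linarith
  rw [← key, ← integral_dom hT] at hle2
  have h0 : ∫ t, ‖D t‖ ∂(dom T) = 0 :=
    le_antisymm (nonpos_of_mul_nonpos_right hle2 (Real.exp_pos _))
      (integral_nonneg fun _ => norm_nonneg _)
  rw [integral_eq_zero_iff_of_nonneg (fun _ => norm_nonneg _) hu] at h0
  filter_upwards [h0] with t ht
  exact norm_eq_zero.1 ht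

end Volterra

/-! ### Removing the memory term. -/

/-- Each weak derivative condition equates two continuous functionals. Closedness gives the
completeness needed to solve the Volterra equation with values in `H^r`. -/
theorem Sobolev.isClosed (L : ℝ) (k : ℕ) :
    IsClosed (Sobolev L k : Set (PiLp 2 fun _ : Fin (k + 1) => L2 L)) := by
  have hcont : ∀ (i : Fin (k + 1)) {ψ : ℝ → ℝ}, Continuous ψ → HasCompactSupport ψ →
      Continuous fun u : PiLp 2 fun _ : Fin (k + 1) => L2 L => ∫ x, u i x * ψ x ∂(dom L) := by
    intro i ψ hψ hψc
    have hm : MemLp ψ 2 (dom L) := hψ.memLp_of_hasCompactSupport hψc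
    have e : (fun u : PiLp 2 fun _ : Fin (k + 1) => L2 L => ∫ x, u i x * ψ x ∂(dom L)) =
        fun u => inner ℝ (u i) (hm.toLp ψ) := by
      funext u
      rw [inner_L2]
      apply integral_congr_ae
      filter_upwards [hm.coeFn_toLp] with x hx
      rw [hx]
    rw [e]
    exact (PiLp.continuous_apply 2 _ i).inner continuous_const
  have hset : (Sobolev L k : Set (PiLp 2 fun _ : Fin (k + 1) => L2 L)) =
      ⋂ (j : Fin k) (φ : ℝ → ℝ) (_ : IsTest L φ), {u | ∫ x, u j.castSucc x * deriv φ x ∂(dom L) =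
        -∫ x, u j.succ x * φ x ∂(dom L)} := by
    ext u
    simp only [Set.mem_iInter]
    rfl
  rw [hset]
  refine isClosed_iInter fun j => isClosed_iInter fun φ => isClosed_iInter fun hφ => ?_
  exact isClosed_eq (hcont _ hφ.continuous_deriv hφ.compact.deriv)
    (hcont _ hφ.smooth.continuous hφ.compact).neg

instance (L : ℝ) (k : ℕ) : CompleteSpace (Sobolev L k) := (Sobolev.isClosed L k).completeSpace_coe

/-- The underlying function, as a continuous linear map. -/
def fnL (L : ℝ) (k : ℕ) : Sobolev L k →L[ℝ] L2 L :=
  (PiLp.proj 2 (fun _ : Fin (k + 1) => L2 L) 0 : _ →L[ℝ] L2 L) ∘L (Sobolev L k).subtypeL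

/-- The weak derivative, as a continuous linear map. -/
def derL (L : ℝ) : Sobolev L 1 →L[ℝ] L2 L :=
  (PiLp.proj 2 (fun _ : Fin (1 + 1) => L2 L) 1 : _ →L[ℝ] L2 L) ∘L (Sobolev L 1).subtypeL

/-- Pairing with the image of an operator, as an element of the dual space. -/
def pairing {V : Type*} [NormedAddCommGroup V] [NormedSpace ℝ V] (P : V →L[ℝ] L2 L) :
    L2 L →L[ℝ] (V →L[ℝ] ℝ) :=
  (ContinuousLinearMap.compL ℝ V (L2 L) ℝ).flip P ∘L (innerSL ℝ : L2 L →L[ℝ] L2 L →L[ℝ] ℝ)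

theorem intervalIntegrable_convolution {Y : Type*} [NormedAddCommGroup Y] [NormedSpace ℝ Y]
    {T : ℝ} {κ : ℝ → ℝ} (hκ : ContinuousOn κ (Set.Icc 0 T)) {F : ℝ → Y}
    (hF : Integrable F (dom T)) {t : ℝ} (ht : t ∈ Set.Icc 0 T) :
    IntervalIntegrable (fun s => κ (t - s) • F s) volume 0 t := by
  have h1 : IntegrableOn F (Set.uIcc 0 t) := by
    rw [Set.uIcc_of_le ht.1]
    exact IntegrableOn.mono_set hF (Set.Icc_subset_Icc_right ht.2)
  refine h1.intervalIntegrable.continuousOn_smul ?_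
  rw [Set.uIcc_of_le ht.1]
  exact hκ.comp (by fun_prop) fun s hs => ⟨by linarith [hs.2], by linarith [hs.1, ht.2]⟩

/-- A functional-valued solution of a Volterra equation whose data are `A (q t)` is `A (p t)`, where
`p` solves the equation with data `q`. -/
theorem ae_eq_apply_of_volterra {X W : Type*} [NormedAddCommGroup X] [NormedSpace ℝ X]
    [CompleteSpace X] [NormedAddCommGroup W] [NormedSpace ℝ W] {T : ℝ} (hT : 0 ≤ T) {κ : ℝ → ℝ}
    (hκ : ContinuousOn κ (Set.Icc 0 T)) (A : X →L[ℝ] (W →L[ℝ] ℝ)) {q p : ℝ → X}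
    (hp : Integrable p (dom T))
    (hpq : ∀ᵐ t ∂(dom T), p t = q t + ∫ s in (0 : ℝ)..t, κ (t - s) • p s)
    {G : ℝ → (W →L[ℝ] ℝ)} (hG : Integrable G (dom T))
    (hGq : ∀ᵐ t ∂(dom T), ∀ x, G t x = A (q t) x + ∫ s in (0 : ℝ)..t, κ (t - s) * G s x) :
    ∀ᵐ t ∂(dom T), G t = A (p t) := by
  have hAp : Integrable (fun t => A (p t)) (dom T) := A.integrable_comp hp
  have hzero : ∀ᵐ t ∂(dom T), G t - A (p t) = 0 := by
    refine ae_eq_zero_of_volterra hT hκ (hG.sub hAp) ?_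
    filter_upwards [hGq, hpq, ae_restrict_mem measurableSet_Icc] with t h1 h2 ht
    have e1 : G t = A (q t) + ∫ s in (0 : ℝ)..t, κ (t - s) • G s := by
      refine ContinuousLinearMap.ext fun x => ?_
      rw [h1, _root_.add_apply,
        ContinuousLinearMap.intervalIntegral_apply (intervalIntegrable_convolution hκ hG ht)]
      rfl
    have e2 : A (p t) = A (q t) + ∫ s in (0 : ℝ)..t, κ (t - s) • A (p s) := by
      conv_lhs => rw [h2]
      rw [map_add, ← ContinuousLinearMap.intervalIntegral_comp_comm _ (intervalIntegrable_convolution hκ hp ht)]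
      simp only [map_smul]
    rw [e1, e2, add_sub_add_left_eq_sub,
      ← intervalIntegral.integral_sub (intervalIntegrable_convolution hκ hG ht) (intervalIntegrable_convolution hκ hAp ht)]
    simp only [smul_sub]
  filter_upwards [hzero] with t h using sub_eq_zero.1 h

set_option maxSynthPendingDepth 5 in
/-- For almost every time, a solution of the problem with memory solves the elastic problem whose
load is the solution of the corresponding Volterra equation. -/
theorem IsMixedSolution.ae_isElasticSolution {T : ℝ} (hT : 0 ≤ T) {E Ihat Ahat : ℝ → ℝ}
    {lam B : ℝ} (hIm : AEStronglyMeasurable Ihat (dom L)) (hIb : ∀ᵐ x ∂(dom L), |Ihat x| ≤ B)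
    (hB : 0 ≤ B) {κ : ℝ → ℝ} (hκ : ContinuousOn κ (Set.Icc 0 T))
    (hκE : ∀ t s, kernel T E t s = κ (t - s)) {r : ℕ}
    {V : Submodule ℝ (Sobolev L 1)} {Q : Submodule ℝ (L2 L)} {q p : ℝ → Sobolev L r}
    (hp : Integrable p (dom T))
    (hpq : ∀ᵐ t ∂(dom T), p t = q t + ∫ s in (0 : ℝ)..t, κ (t - s) • p s)
    {θ w : ℝ → Sobolev L 1} {γ : ℝ → L2 L}
    (hs : IsMixedSolution T E Ihat Ahat lam V Q (fun t => fn (q t)) θ w γ) :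
    ∀ᵐ t ∂(dom T), IsElasticSolution Ihat Ahat lam V Q (fn (p t)) (θ t) (w t) (γ t) := by
  obtain ⟨I, -, hI⟩ := exists_mul_operator hIm hIb hB
  let Pη : V × V →L[ℝ] L2 L := derL L ∘L V.subtypeL ∘L ContinuousLinearMap.fst ℝ V V
  let Pb : V × V →L[ℝ] L2 L := fnL L 1 ∘L V.subtypeL ∘L ContinuousLinearMap.fst ℝ V V -
    derL L ∘L V.subtypeL ∘L ContinuousLinearMap.snd ℝ V V
  let Pl : V × V →L[ℝ] L2 L := fnL L 1 ∘L V.subtypeL ∘L ContinuousLinearMap.snd ℝ V V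
  let A : Sobolev L r →L[ℝ] (V × V →L[ℝ] ℝ) := pairing Pl ∘L fnL L r
  -- Bundling all test pairs into one dual-valued function makes the momentum equation a single
  -- Volterra equation in a normed space, to which uniqueness applies.
  let G : ℝ → (V × V →L[ℝ] ℝ) := fun t =>
    (pairing Pη ∘L I ∘L derL L) (θ t) + pairing Pb (γ t)
  have hG : ∀ t (x : V × V), G t x = aForm Ihat (θ t) x.1 + bForm x.1 x.2 (γ t) := by
    intro t x
    rw [aForm_eq_inner hI, bForm_eq_inner]
    rfl
  have hA : ∀ u (x : V × V), A u x = loadForm (fn u) (fn (x.2 : Sobolev L 1)) := by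
    intro u x
    rw [loadForm_eq_inner]
    rfl
  have hGi : Integrable G (dom T) :=
    ((pairing Pη ∘L I ∘L derL L).integrable_comp hs.integrable_rotation).add
      ((pairing Pb).integrable_comp hs.integrable_shear)
  have hGA : ∀ᵐ t ∂(dom T), G t = A (p t) := by
    refine ae_eq_apply_of_volterra hT hκ A hp hpq hGi ?_
    filter_upwards [hs.momentum] with t h1 x
    simp only [hG, hA, ← hκE]
    exact h1 _ x.1.2 _ x.2.2
  filter_upwards [hGA, hs.mem, hs.constitutive] with t h1 h2 h3
  refine ⟨h2.1, h2.2.1, h2.2.2, fun η hη v hv => ?_, h3⟩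
  have h4 := congrArg (fun F : V × V →L[ℝ] ℝ => F (⟨η, hη⟩, ⟨v, hv⟩)) h1
  simp only [hG, hA] at h4
  exact h4

end Timoshenko

end

/-! ### Assembly of the final estimate. -/

theorem proposition3p2
    -- beam length, observation time, polynomial degree
    (L T : ℝ) (hL : 0 < L) (hT : 0 ≤ T) (r : ℕ) (hr : 1 ≤ r)
    -- relaxation modulus and Poisson ratio
    (E : ℝ → ℝ) (hE0 : 0 < E 0) (hE : ContDiffOn ℝ 1 E (Set.Icc 0 T))
    (ν : ℝ) (hν : -1 < ν)
    -- largest thickness parameter and bounds on the coefficients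
    (εmax : ℝ) (cE CE cG CG M : ℝ) (hcE : 0 < cE) (hcG : 0 < cG) :
    ∃ C : ℝ, 0 < C ∧
      ∀ (Ihat Ahat : ℝ → ℝ),
        Timoshenko.SobolevInftyBound L r M Ihat →
        Timoshenko.SobolevInftyBound L r M Ahat →
        (∀ᵐ x ∂(Timoshenko.dom L), cE ≤ E 0 * Ihat x ∧ E 0 * Ihat x ≤ CE) →
        (∀ᵐ x ∂(Timoshenko.dom L),
          cG ≤ E 0 / (2 * (1 + ν)) * Ahat x ∧ E 0 / (2 * (1 + ν)) * Ahat x ≤ CG) →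
      ∀ ε : ℝ, 0 < ε → ε ≤ εmax →
      ∀ (m : Timoshenko.Mesh L)
        (qE : ℝ → Timoshenko.Sobolev L r),
        MeasureTheory.Integrable qE (MeasureTheory.volume.restrict (Set.Icc 0 T)) →
      ∀ (θ w : ℝ → Timoshenko.Sobolev L 1) (γ : ℝ → Timoshenko.L2 L)
        (θh wh : ℝ → Timoshenko.Sobolev L 1) (γh : ℝ → Timoshenko.L2 L),
        Timoshenko.IsMixedSolution T E Ihat Ahat (2 * (1 + ν) * ε ^ 2)
          (Timoshenko.H10 L) ⊤ (fun t => Timoshenko.fn (qE t)) θ w γ →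
        Timoshenko.IsMixedSolution T E Ihat Ahat (2 * (1 + ν) * ε ^ 2)
          (Timoshenko.Vh m r) (Timoshenko.Qh m r) (fun t => Timoshenko.fn (qE t)) θh wh γh →
        ∫ t in Set.Icc 0 T,
            Real.sqrt (‖Timoshenko.fn (θ t) - Timoshenko.fn (θh t)‖ ^ 2 + ‖Timoshenko.fn (w t) - Timoshenko.fn (wh t)‖ ^ 2)
          ≤ C * m.h ^ (r + 1) * ∫ t in Set.Icc 0 T, ‖qE t‖ := by
  have hν' : 0 < 2 * (1 + ν) := by linarith
  -- For `T = 0` both time integrals vanish. The case is separate because continuity of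
  -- `derivWithin` on `[0, T]` uses unique differentiability, which fails for a point.
  rcases hT.eq_or_lt with rfl | hTpos
  · refine ⟨1, one_pos, ?_⟩
    intro Ihat Ahat _ _ _ _ ε _ _ m qE _ θ w γ θh wh γh _ _
    simp
  have hκ : ContinuousOn (fun t => derivWithin E (Set.Icc 0 T) t / E 0) (Set.Icc 0 T) :=
    (hE.continuousOn_derivWithin (uniqueDiffOn_Icc hTpos) le_rfl).div_const _
  obtain ⟨C₁, hC₁, hvol⟩ := Timoshenko.exists_volterra_solution (X := Timoshenko.Sobolev L r) hκ
  -- `α` is a common lower bound for both coefficients, and the second numerical argument bounds `λ`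
  -- through `εmax`.
  obtain ⟨C₂, hC₂, hell⟩ := Timoshenko.exists_elastic_error_bound hL hr M
    (2 * (1 + ν) * εmax ^ 2) (α := min (cE / E 0) (cG * (2 * (1 + ν)) / E 0)) (by positivity)
  -- The factor `2` covers the `√2` from combining the two components; `C₁ + 1` is positive, whereas
  -- `C₁` is only known to be nonnegative.
  refine ⟨2 * C₂ * (C₁ + 1), by positivity, ?_⟩
  intro Ihat Ahat hI hA hIE hAG ε hε hεm m qE hq θ w γ θh wh γh hs hsh
  have hI' := hI.bddDerivs hL
  have hA' := hA.bddDerivs hL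
  obtain ⟨p, hp, hpq, hpn⟩ := hvol qE hq
  have e1 := hs.ae_isElasticSolution hT (hI'.aestronglyMeasurable hL.le) hI'.bound (hI'.nonneg hL)
    hκ (fun _ _ => rfl) hp hpq
  have e2 := hsh.ae_isElasticSolution hT (hI'.aestronglyMeasurable hL.le) hI'.bound
    (hI'.nonneg hL) hκ (fun _ _ => rfl) hp hpq
  have hIα : ∀ᵐ x ∂(Timoshenko.dom L), min (cE / E 0) (cG * (2 * (1 + ν)) / E 0) ≤ Ihat x := by
    filter_upwards [hIE] with x hx
    refine (min_le_left _ _).trans ?_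
    rw [div_le_iff₀ hE0]
    linarith [hx.1]
  have hAα : ∀ᵐ x ∂(Timoshenko.dom L), min (cE / E 0) (cG * (2 * (1 + ν)) / E 0) ≤ Ahat x := by
    filter_upwards [hAG] with x hx
    refine (min_le_right _ _).trans ?_
    have h1 := hx.1
    rw [div_mul_eq_mul_div, le_div_iff₀ hν'] at h1
    rw [div_le_iff₀ hE0]
    linarith
  have hh := (m.h_pos hL).le
  have hlam : 2 * (1 + ν) * ε ^ 2 ≤ 2 * (1 + ν) * εmax ^ 2 :=
    mul_le_mul_of_nonneg_left (pow_le_pow_left₀ hε.le hεm 2) hν'.le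
  have hpt : ∀ᵐ t ∂(Timoshenko.dom T),
      Real.sqrt (‖Timoshenko.fn (θ t) - Timoshenko.fn (θh t)‖ ^ 2 +
        ‖Timoshenko.fn (w t) - Timoshenko.fn (wh t)‖ ^ 2) ≤
      2 * C₂ * m.h ^ (r + 1) * ‖p t‖ := by
    filter_upwards [e1, e2] with t h1 h2
    obtain ⟨k1, k2⟩ := hell Ihat Ahat hI' hA' hIα hAα _ (by positivity) hlam m (p t) _ _ _ _ _ _ h1 h2
    refine Real.sqrt_le_iff.2 ⟨by positivity, ?_⟩
    have l1 := pow_le_pow_left₀ (norm_nonneg _) k1 2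
    have l2 := pow_le_pow_left₀ (norm_nonneg _) k2 2
    have l3 : 0 ≤ (C₂ * m.h ^ (r + 1) * ‖p t‖) ^ 2 := sq_nonneg _
    linarith
  calc _ ≤ ∫ t, 2 * C₂ * m.h ^ (r + 1) * ‖p t‖ ∂(Timoshenko.dom T) :=
        MeasureTheory.integral_mono_of_nonneg
          (Filter.Eventually.of_forall fun _ => Real.sqrt_nonneg _) (hp.norm.const_mul _) hpt
    _ = 2 * C₂ * m.h ^ (r + 1) * ∫ t, ‖p t‖ ∂(Timoshenko.dom T) :=
        MeasureTheory.integral_const_mul _ _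
    _ ≤ 2 * C₂ * m.h ^ (r + 1) * ((C₁ + 1) * ∫ t, ‖qE t‖ ∂(Timoshenko.dom T)) := by
        refine mul_le_mul_of_nonneg_left (hpn.trans ?_) (by positivity)
        refine mul_le_mul_of_nonneg_right (by linarith) ?_
        exact MeasureTheory.integral_nonneg fun _ => norm_nonneg _
    _ = _ := by ring
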